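/- Let $\mathbf k$ be a field of characteristic zero and $V=\bigoplus_{i\in\mathbb Z}V^i$ a graded vector space over $\mathbf k$. Let $\mathrm{Sym}(V)$ be the graded symmetric algebra (the tensor algebra modulo $x\otimes y-(-1)^{|x||y|}y\otimes x$ for homogeneous $x,y\in V$), $\overline{\mathrm{Sym}}(V)=\bigoplus_{n\ge1}\mathrm{Sym}^n(V)$, and let $\mathrm{Hom}^k(\mathrm{Sym}(V)\otimes\overline{\mathrm{Sym}}(V),V)$ be the space of linear maps of degree $k$. For $f$ in it, $f_{p,q}$ denotes the restriction of $f$ to $\mathrm{Sym}^p(V)\otimes\mathrm{Sym}^q(V)$. For a permutation $\sigma$ let $\varepsilon(\sigma)$ be the Koszul sign, $v_1\cdots v_n=\varepsilon(\sigma)v_{\sigma(1)}\cdots v_{\sigma(n)}$, and let $\mathbb S_{(i_1,\dots,i_r)}$ be the set of $(i_1,\dots,i_r)$-shuffles; in exponents of $-1$ an element stands for its degree. For $f\in\mathrm{Hom}^k(\mathrm{Sym}(V)\otimes\overline{\mathrm{Sym}}(V),V)$ and $g\in\mathrm{Hom}^l(\mathrm{Sym}(V)\otimes\overline{\mathrm{Sym}}(V),V)$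 there is exactly one $f\circ g\in\mathrm{Hom}^{k+l}(\mathrm{Sym}(V)\otimes\overline{\mathrm{Sym}}(V),V)$ such that for all $n\ge0$, $m\ge1$ and all homogeneous $x_1,\dots,x_n,y_1,\dots,y_m\in V$ $$\begin{aligned}&(f\circ g)(x_1\cdots x_n\otimes y_1\cdots y_m)\\&=\sum_{\substack{0\le p\le n-1,\ 1\le q\le n-p\\ \sigma\in\mathbb S_{(p,q,n-p-q)}}}\varepsilon(\sigma)\,f_{n-p-q+1,m}\big(g_{p,q}(x_{\sigma(1)}\cdots x_{\sigma(p)}\otimes x_{\sigma(p+1)}\cdots x_{\sigma(p+q)})\,x_{\sigma(p+q+1)}\cdots x_{\sigma(n)}\otimes y_1\cdots y_m\big)\\&\quad+\sum_{\substack{0\le p\le n,\ 1\le q\le m\\ \sigma\in\mathbb S_{(n-p,p)},\ \tau\in\mathbb S_{(q,m-q)}}}\varepsilon(\sigma)\varepsilon(\tau)(-1)^{l(x_{\sigma(1)}+\cdots+x_{\sigma(n-p)})}\\&\qquad f_{n-p,m-q+1}\big(x_{\sigma(1)}\cdots x_{\sigma(n-p)}\otimes g_{p,q}(x_{\sigma(n-p+1)}\cdots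 x_{\sigma(n)}\otimes y_{\tau(1)}\cdots y_{\tau(q)})\,y_{\tau(q+1)}\cdots y_{\tau(m)}\big),\end{aligned}$$ and $\bigoplus_{k\in\mathbb Z}\mathrm{Hom}^k(\mathrm{Sym}(V)\otimes\overline{\mathrm{Sym}}(V),V)$ with the bracket $[f,g]=f\circ g-(-1)^{kl}g\circ f$ is a graded Lie algebra. Moreover, this bracket is transported from coderivations, as follows. There are unique linear maps $\Delta,\delta$ from $C=\mathrm{Sym}(V)\otimes\overline{\mathrm{Sym}}(V)$ to $C\otimes C$ with $$\begin{aligned}\Delta(x_1\cdots x_n\otimes y_1\cdots y_m)=\sum_{\substack{0\le i\le n,\ 1\le j\le m-1\\ \sigma\in\mathbb S_{(i,n-i)},\ \tau\in\mathbb S_{(j,m-j)}}}&\varepsilon(\sigma)\varepsilon(\tau)(-1)^{(x_{\sigma(i+1)}+\cdots+x_{\sigma(n)})(y_{\tau(1)}+\cdots+y_{\tau(j)})}\\&(x_{\sigma(1)}\cdots x_{\sigma(i)}\otimes y_{\tau(1)}\cdots y_{\tau(j)})\otimes(x_{\sigma(i+1)}\cdots x_{\sigma(n)}\otimes y_{\tau(j+1)}\cdots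 y_{\tau(m)}),\\ \delta(x_1\cdots x_n\otimes y_1\cdots y_m)=\sum_{\substack{0\le i\le n-1,\ 1\le j\le n-i\\ \sigma\in\mathbb S_{(i,j,n-i-j)}}}&\varepsilon(\sigma)(x_{\sigma(1)}\cdots x_{\sigma(i)}\otimes x_{\sigma(i+1)}\cdots x_{\sigma(i+j)})\otimes(x_{\sigma(i+j+1)}\cdots x_{\sigma(n)}\otimes y_1\cdots y_m)\end{aligned}$$ (the structure maps of the standard model of the cofree conilpotent graded cocommutative cotrialgebra on $V$). Let $\mathrm{coDer}^k$ be the space of degree $k$ linear maps $D:C\to C$ with $\Delta D=(D\otimes\mathrm{Id}+\mathrm{Id}\otimes D)\Delta$ and $\delta D=(D\otimes\mathrm{Id}+\mathrm{Id}\otimes D)\delta$, where $(\mathrm{Id}\otimes D)(s\otimes t)=(-1)^{k|s|}s\otimes D(t)$. Then $\bigoplus_k\mathrm{coDer}^k$ is a graded Lie algebra under $[D,E]_C=DE-(-1)^{kl}ED$ for $D\in\mathrm{coDer}^k$, $E\in\mathrm{coDer}^l$, and there are linear isomorphisms $\Psi:\mathrm{Hom}^k(C,V)\to\mathrm{coDer}^k$,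 $k\in\mathbb Z$, with $$\begin{aligned}&\Psi(R)(x_1\cdots x_n\otimes y_1\cdots y_m)\\&=\sum_{\substack{0\le p\le n-1,\ 1\le q\le n-p\\ \sigma\in\mathbb S_{(p,q,n-p-q)}}}\varepsilon(\sigma)\,R(x_{\sigma(1)}\cdots x_{\sigma(p)}\otimes x_{\sigma(p+1)}\cdots x_{\sigma(p+q)})\,x_{\sigma(p+q+1)}\cdots x_{\sigma(n)}\otimes y_1\cdots y_m\\&\quad+\sum_{\substack{0\le p\le n,\ 1\le q\le m\\ \sigma\in\mathbb S_{(n-p,p)},\ \tau\in\mathbb S_{(q,m-q)}}}\varepsilon(\sigma)\varepsilon(\tau)(-1)^{k(x_{\sigma(1)}+\cdots+x_{\sigma(n-p)})}\\&\qquad x_{\sigma(1)}\cdots x_{\sigma(n-p)}\otimes R(x_{\sigma(n-p+1)}\cdots x_{\sigma(n)}\otimes y_{\tau(1)}\cdots y_{\tau(q)})\,y_{\tau(q+1)}\cdots y_{\tau(m)}\end{aligned}$$ and $\Psi([f,g])=[\Psi(f),\Psi(g)]_C$. -/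

import Mathlib

set_option maxSynthPendingDepth 3

open scoped TensorProduct

noncomputable section

namespace PostLie

variable {K : Type*} [Field K] {V : Type*} [AddCommGroup V] [Module K V]

/-! ### Graded linear maps and graded Lie algebras -/

/-- Linear maps of degree `k` between two graded vector spaces. -/
def HomDeg {A B : Type*} [AddCommGroup A] [Module K A] [AddCommGroup B] [Module K B]
    (𝒜 : ℤ → Submodule K A) (ℬ : ℤ → Submodule K B) (k : ℤ) : Submodule K (A →ₗ[K] B) where
  carrier := {f | ∀ d, ∀ a ∈ 𝒜 d, f a ∈ ℬ (d + k)}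
  zero_mem' := fun _ _ _ => Submodule.zero_mem _
  add_mem' := fun hf hg d a ha => Submodule.add_mem _ (hf d a ha) (hg d a ha)
  smul_mem' := fun c _ hf d a ha => Submodule.smul_mem _ c (hf d a ha)

/-- A graded Lie algebra structure on the `ℤ`-graded vector space `⨁ i, L i`: a bilinear bracket of
degree `0` that is graded antisymmetric and satisfies the graded Jacobi identity (both identities
between homogeneous elements are read in `⨁ i, L i`). -/
structure GradedLieAlgebra (K : Type*) [Field K] (L : ℤ → Type*) [∀ i, AddCommGroup (L i)]
    [∀ i, Module K (L i)] where
  bracket : ∀ i j : ℤ, L i →ₗ[K] L j →ₗ[K] L (i + j)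
  antisymm : ∀ (i j : ℤ) (x : L i) (y : L j),
    DirectSum.lof K ℤ L (i + j) (bracket i j x y) =
      -((-1 : K) ^ (i * j) • DirectSum.lof K ℤ L (j + i) (bracket j i y x))
  jacobi : ∀ (i j k : ℤ) (x : L i) (y : L j) (z : L k),
    DirectSum.lof K ℤ L (i + (j + k)) (bracket i (j + k) x (bracket j k y z)) =
      DirectSum.lof K ℤ L (i + j + k) (bracket (i + j) k (bracket i j x y) z) +
      (-1 : K) ^ (i * j) •
        DirectSum.lof K ℤ L (j + (i + k)) (bracket j (i + k) y (bracket i k x z))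

/-! ### The graded symmetric algebra -/

/-- The relations `x ⊗ y = (-1)^{|x||y|} y ⊗ x` for homogeneous `x, y ∈ V`. -/
inductive SymRel (𝒱 : ℤ → Submodule K V) : TensorAlgebra K V → TensorAlgebra K V → Prop
  | swap {i j : ℤ} {x y : V} (hx : x ∈ 𝒱 i) (hy : y ∈ 𝒱 j) :
      SymRel 𝒱 (TensorAlgebra.ι K x * TensorAlgebra.ι K y)
        ((-1 : K) ^ (i * j) • (TensorAlgebra.ι K y * TensorAlgebra.ι K x))

/-- The graded symmetric algebra `Sym(V)`. -/
def Sym (𝒱 : ℤ → Submodule K V) : Type _ := RingQuot (SymRel 𝒱)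

instance (𝒱 : ℤ → Submodule K V) : Ring (Sym 𝒱) := inferInstanceAs (Ring (RingQuot (SymRel 𝒱)))

instance (𝒱 : ℤ → Submodule K V) : Algebra K (Sym 𝒱) :=
  inferInstanceAs (Algebra K (RingQuot (SymRel 𝒱)))

namespace Sym

variable (𝒱 : ℤ → Submodule K V)

/-- The canonical map `V → Sym(V)`. -/
def ι : V →ₗ[K] Sym 𝒱 :=
  (RingQuot.mkAlgHom K (SymRel 𝒱)).toLinearMap ∘ₗ TensorAlgebra.ι K

/-- The universal property of `Sym(V)`. -/
def lift {A : Type*} [Ring A] [Algebra K A] (f : V →ₗ[K] A)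
    (hf : ∀ (i j : ℤ) (x y : V), x ∈ 𝒱 i → y ∈ 𝒱 j → f x * f y = (-1 : K) ^ (i * j) • (f y * f x)) :
    Sym 𝒱 →ₐ[K] A :=
  RingQuot.liftAlgHom K ⟨TensorAlgebra.lift K f, by
    rintro _ _ ⟨hx, hy⟩
    simpa using hf _ _ _ _ hx hy⟩

@[simp] theorem lift_ι {A : Type*} [Ring A] [Algebra K A] (f : V →ₗ[K] A)
    (hf : ∀ (i j : ℤ) (x y : V), x ∈ 𝒱 i → y ∈ 𝒱 j → f x * f y = (-1 : K) ^ (i * j) • (f y * f x))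
    (v : V) : lift 𝒱 f hf (ι 𝒱 v) = f v := by
  have h := RingQuot.liftAlgHom_mkAlgHom_apply K (TensorAlgebra.lift K f) (s := SymRel 𝒱)
    (by rintro _ _ ⟨hx, hy⟩; simpa using hf _ _ _ _ hx hy) (TensorAlgebra.ι K v)
  rw [TensorAlgebra.lift_ι_apply] at h
  exact h

theorem ι_mul_ι {i j : ℤ} {x y : V} (hx : x ∈ 𝒱 i) (hy : y ∈ 𝒱 j) :
    ι 𝒱 x * ι 𝒱 y = (-1 : K) ^ (i * j) • (ι 𝒱 y * ι 𝒱 x) := by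
  have h := RingQuot.mkAlgHom_rel K (SymRel.swap (𝒱 := 𝒱) hx hy)
  rw [map_smul, map_mul, map_mul] at h
  exact h

theorem algHom_ext {A : Type*} [Ring A] [Algebra K A] {f g : Sym 𝒱 →ₐ[K] A}
    (h : ∀ v, f (ι 𝒱 v) = g (ι 𝒱 v)) : f = g := by
  apply RingQuot.ringQuot_ext'
  apply TensorAlgebra.hom_ext
  ext v
  exact h v

/-- The counit `Sym(V) → K`, which kills `Sym^n(V)` for `n ≥ 1`. -/
def counit : Sym 𝒱 →ₐ[K] K := lift 𝒱 0 (by simp)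

/-- `S̅ym(V) = ⨁_{n ≥ 1} Sym^n(V)`, the kernel of the counit. -/
def bar : Submodule K (Sym 𝒱) := LinearMap.ker (counit 𝒱).toLinearMap

/-- The projection `Sym(V) → S̅ym(V)` along `Sym^0(V) = K`; it is the identity on every product
`v₁ ⋯ vₙ` with `n ≥ 1`, and serves to regard such a product as an element of `S̅ym(V)`. -/
def toBar : Sym 𝒱 →ₗ[K] bar 𝒱 :=
  LinearMap.codRestrict (bar 𝒱)
    (LinearMap.id - Algebra.linearMap K (Sym 𝒱) ∘ₗ (counit 𝒱).toLinearMap)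
    (fun x => by simp [bar])

theorem toBar_of_mem {x : Sym 𝒱} (hx : x ∈ bar 𝒱) : (toBar 𝒱 x : Sym 𝒱) = x := by
  have h : counit 𝒱 x = 0 := hx
  change x - algebraMap K (Sym 𝒱) (counit 𝒱 x) = x
  rw [h, map_zero, sub_zero]

/-- For a sequence `v₁, …, vₙ`, the product `v_{s+1} v_{s+2} ⋯ v_t` in `Sym(V)`. -/
def block {n : ℕ} (v : Fin n → V) (s t : ℕ) : Sym 𝒱 :=
  ((((List.ofFn v).take t).drop s).map (ι 𝒱)).prod

/-- The linear map `v ↦ (-1)^{k|v|} v` on `V`. -/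
def signV [DirectSum.Decomposition 𝒱] (k : ℤ) : V →ₗ[K] V :=
  DirectSum.toModule K ℤ V (fun i => (-1 : K) ^ (k * i) • (𝒱 i).subtype) ∘ₗ
    (DirectSum.decomposeLinearEquiv 𝒱).toLinearMap

theorem signV_of_mem [DirectSum.Decomposition 𝒱] (k : ℤ) {i : ℤ} {x : V} (hx : x ∈ 𝒱 i) :
    signV 𝒱 k x = (-1 : K) ^ (k * i) • x := by
  change DirectSum.toModule K ℤ V (fun i => (-1 : K) ^ (k * i) • (𝒱 i).subtype)
    (DirectSum.decompose 𝒱 x) = _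
  rw [DirectSum.decompose_of_mem 𝒱 hx, ← DirectSum.lof_eq_of K, DirectSum.toModule_lof]
  rfl

/-- The linear map `a ↦ (-1)^{k|a|} a` on `Sym(V)`. -/
def sign [DirectSum.Decomposition 𝒱] (k : ℤ) : Sym 𝒱 →ₐ[K] Sym 𝒱 :=
  lift 𝒱 (ι 𝒱 ∘ₗ signV 𝒱 k) (by
    intro i j x y hx hy
    simp only [LinearMap.comp_apply, signV_of_mem 𝒱 k hx, signV_of_mem 𝒱 k hy, map_smul,
      smul_mul_assoc, mul_smul_comm, ι_mul_ι 𝒱 hx hy, smul_smul]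
    congr 1
    ring)

theorem counit_sign [DirectSum.Decomposition 𝒱] (k : ℤ) (x : Sym 𝒱) :
    counit 𝒱 (sign 𝒱 k x) = counit 𝒱 x := by
  have h : (counit 𝒱).comp (sign 𝒱 k) = counit 𝒱 :=
    algHom_ext 𝒱 (fun v => by simp [counit, sign])
  exact DFunLike.congr_fun h x

/-- The restriction of `Sym.sign` to `S̅ym(V)`. -/
def signBar [DirectSum.Decomposition 𝒱] (k : ℤ) : bar 𝒱 →ₗ[K] bar 𝒱 :=
  (sign 𝒱 k).toLinearMap.restrict (fun x hx => by
    have h : counit 𝒱 x = 0 := hx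
    show counit 𝒱 (sign 𝒱 k x) = 0
    rw [counit_sign, h])

end Sym

/-! ### Shuffles and Koszul signs -/

/-- The `(i, n - i)`-shuffles in `𝕊_n`. -/
def shuffles₂ (n i : ℕ) : Finset (Equiv.Perm (Fin n)) :=
  Finset.univ.filter fun σ => ∀ a b : Fin n, a < b → ((b : ℕ) < i ∨ i ≤ (a : ℕ)) → σ a < σ b

/-- The `(i, j, n - i - j)`-shuffles in `𝕊_n`. -/
def shuffles₃ (n i j : ℕ) : Finset (Equiv.Perm (Fin n)) :=
  Finset.univ.filter fun σ => ∀ a b : Fin n, a < b →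
    ((b : ℕ) < i ∨ (i ≤ (a : ℕ) ∧ (b : ℕ) < i + j) ∨ i + j ≤ (a : ℕ)) → σ a < σ b

/-- The Koszul sign `ε(σ; v₁, …, vₙ)`, where `d i` is the degree of `v_i`: one factor
`(-1)^{|v||w|}` for each pair of entries whose order is changed in passing from `v₁ ⋯ vₙ` to
`v_{σ(1)} ⋯ v_{σ(n)}`. -/
def koszulSign (K : Type*) [Field K] {n : ℕ} (d : Fin n → ℤ) (σ : Equiv.Perm (Fin n)) : K :=
  ∏ ab ∈ (Finset.univ : Finset (Fin n × Fin n)).filter (fun ab => ab.1 < ab.2 ∧ σ ab.2 < σ ab.1),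
    (-1 : K) ^ (d (σ ab.1) * d (σ ab.2))

/-- The partial sum `d_{s+1} + ⋯ + d_t` of a sequence of degrees `d₁, …, dₙ`. -/
def degSum {n : ℕ} (d : Fin n → ℤ) (s t : ℕ) : ℤ :=
  ∑ i ∈ Finset.univ.filter (fun i : Fin n => s ≤ (i : ℕ) ∧ (i : ℕ) < t), d i

/-! ### The cotrialgebra on `Sym(V) ⊗ S̅ym(V)` -/

section

variable (𝒱 : ℤ → Submodule K V)

/-- The space `Sym(V) ⊗ S̅ym(V)`. -/
abbrev Trias : Type _ := Sym 𝒱 ⊗[K] Sym.bar 𝒱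

/-- The element `a ⊗ b` of `Sym(V) ⊗ S̅ym(V)`, for `a ∈ Sym(V)` and `b ∈ S̅ym(V) ⊆ Sym(V)`. -/
def tm (a b : Sym 𝒱) : Trias 𝒱 := a ⊗ₜ[K] Sym.toBar 𝒱 b

/-- The element `x₁ ⋯ xₙ ⊗ y₁ ⋯ yₘ` of `Sym(V) ⊗ S̅ym(V)` (for `m ≥ 1`). -/
def mono {n m : ℕ} (x : Fin n → V) (y : Fin m → V) : Trias 𝒱 :=
  tm 𝒱 (Sym.block 𝒱 x 0 n) (Sym.block 𝒱 y 0 m)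

/-- The part of total degree `d` of `Sym(V) ⊗ S̅ym(V)`. -/
def triasGr (d : ℤ) : Submodule K (Trias 𝒱) :=
  Submodule.span K {t | ∃ (n m : ℕ) (x : Fin n → V) (y : Fin m → V) (a : Fin n → ℤ)
    (b : Fin m → ℤ), 1 ≤ m ∧ (∀ i, x i ∈ 𝒱 (a i)) ∧ (∀ i, y i ∈ 𝒱 (b i)) ∧
      ∑ i, a i + ∑ i, b i = d ∧ t = mono 𝒱 x y}

/-- `F x y a b` holds for all `n ≥ 0`, `m ≥ 1` and all sequences of homogeneous elements
`x₁, …, xₙ` and `y₁, …, yₘ` of `V`, of degrees `a₁, …, aₙ` and `b₁, …, bₘ`. -/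
def ForAllHomogeneous
    (F : ∀ {n m : ℕ}, (Fin n → V) → (Fin m → V) → (Fin n → ℤ) → (Fin m → ℤ) → Prop) : Prop :=
  ∀ (n m : ℕ) (x : Fin n → V) (y : Fin m → V) (a : Fin n → ℤ) (b : Fin m → ℤ), 1 ≤ m →
    (∀ i, x i ∈ 𝒱 (a i)) → (∀ i, y i ∈ 𝒱 (b i)) → F x y a b

/-- `Δ` is the coproduct
`Δ(x₁⋯xₙ ⊗ y₁⋯yₘ) = ∑ ± (x_{σ(1)}⋯x_{σ(i)} ⊗ y_{τ(1)}⋯y_{τ(j)}) ⊗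
  (x_{σ(i+1)}⋯x_{σ(n)} ⊗ y_{τ(j+1)}⋯y_{τ(m)})`. -/
def IsCoproductΔ (Δ : Trias 𝒱 →ₗ[K] Trias 𝒱 ⊗[K] Trias 𝒱) : Prop :=
  ForAllHomogeneous 𝒱 fun {n m} x y a b =>
    Δ (mono 𝒱 x y) =
      ∑ i ∈ Finset.range (n + 1), ∑ j ∈ Finset.Ico 1 m,
        ∑ σ ∈ shuffles₂ n i, ∑ τ ∈ shuffles₂ m j,
          (koszulSign K a σ * koszulSign K b τ *
              (-1 : K) ^ (degSum (a ∘ σ) i n * degSum (b ∘ τ) 0 j)) •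
            (tm 𝒱 (Sym.block 𝒱 (x ∘ σ) 0 i) (Sym.block 𝒱 (y ∘ τ) 0 j) ⊗ₜ[K]
              tm 𝒱 (Sym.block 𝒱 (x ∘ σ) i n) (Sym.block 𝒱 (y ∘ τ) j m))

/-- `δ` is the coproduct
`δ(x₁⋯xₙ ⊗ y₁⋯yₘ) = ∑ ε(σ) (x_{σ(1)}⋯x_{σ(i)} ⊗ x_{σ(i+1)}⋯x_{σ(i+j)}) ⊗
  (x_{σ(i+j+1)}⋯x_{σ(n)} ⊗ y₁⋯yₘ)`. -/
def IsCoproductδ (δ : Trias 𝒱 →ₗ[K] Trias 𝒱 ⊗[K] Trias 𝒱) : Prop :=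
  ForAllHomogeneous 𝒱 fun {n m} x y a _ =>
    δ (mono 𝒱 x y) =
      ∑ i ∈ Finset.range n, ∑ j ∈ Finset.Icc 1 (n - i), ∑ σ ∈ shuffles₃ n i j,
        koszulSign K a σ •
          (tm 𝒱 (Sym.block 𝒱 (x ∘ σ) 0 i) (Sym.block 𝒱 (x ∘ σ) i (i + j)) ⊗ₜ[K]
            tm 𝒱 (Sym.block 𝒱 (x ∘ σ) (i + j) n) (Sym.block 𝒱 y 0 m))

/-- The linear map `t ↦ (-1)^{k|t|} t` on `Sym(V) ⊗ S̅ym(V)`. -/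
def triasSign [DirectSum.Decomposition 𝒱] (k : ℤ) : Trias 𝒱 →ₗ[K] Trias 𝒱 :=
  TensorProduct.map (Sym.sign 𝒱 k).toLinearMap (Sym.signBar 𝒱 k)

/-- For a map `D` of degree `k`, the map `D ⊗ Id + Id ⊗ D`, with the Koszul convention
`(Id ⊗ D)(s ⊗ t) = (-1)^{k|s|} s ⊗ D t`. -/
def leibniz [DirectSum.Decomposition 𝒱] (k : ℤ) (D : Trias 𝒱 →ₗ[K] Trias 𝒱) :
    Trias 𝒱 ⊗[K] Trias 𝒱 →ₗ[K] Trias 𝒱 ⊗[K] Trias 𝒱 :=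
  TensorProduct.map D LinearMap.id + TensorProduct.map (triasSign 𝒱 k) D

/-- The coderivations of degree `k` of `(Sym(V) ⊗ S̅ym(V), Δ, δ)`. -/
def coDer [DirectSum.Decomposition 𝒱] (Δ δ : Trias 𝒱 →ₗ[K] Trias 𝒱 ⊗[K] Trias 𝒱) (k : ℤ) :
    Submodule K (Trias 𝒱 →ₗ[K] Trias 𝒱) where
  carrier := {D | D ∈ HomDeg (triasGr 𝒱) (triasGr 𝒱) k ∧
    Δ ∘ₗ D = leibniz 𝒱 k D ∘ₗ Δ ∧ δ ∘ₗ D = leibniz 𝒱 k D ∘ₗ δ}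
  zero_mem' := ⟨Submodule.zero_mem _, by simp [leibniz], by simp [leibniz]⟩
  add_mem' := by
    rintro D E ⟨hD, hD₁, hD₂⟩ ⟨hE, hE₁, hE₂⟩
    have h : leibniz 𝒱 k (D + E) = leibniz 𝒱 k D + leibniz 𝒱 k E := by
      simp only [leibniz, TensorProduct.map_add_left, TensorProduct.map_add_right]; abel
    exact ⟨Submodule.add_mem _ hD hE, by rw [LinearMap.comp_add, h, LinearMap.add_comp, hD₁, hE₁],
      by rw [LinearMap.comp_add, h, LinearMap.add_comp, hD₂, hE₂]⟩
  smul_mem' := by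
    rintro c D ⟨hD, hD₁, hD₂⟩
    have h : leibniz 𝒱 k (c • D) = c • leibniz 𝒱 k D := by
      simp only [leibniz, TensorProduct.map_smul_left, TensorProduct.map_smul_right, smul_add]
    exact ⟨Submodule.smul_mem _ c hD, by rw [LinearMap.comp_smul, h, LinearMap.smul_comp, hD₁],
      by rw [LinearMap.comp_smul, h, LinearMap.smul_comp, hD₂]⟩

/-! ### The composition on `Hom(Sym(V) ⊗ S̅ym(V), V)` and the map `Ψ` -/

/-- `Hom^k(Sym(V) ⊗ S̅ym(V), V)`. The component `f_{p,q}` of an element `f` is the restriction of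
`f` to `Sym^p(V) ⊗ Sym^q(V)`. -/
abbrev PLHom (k : ℤ) : Submodule K (Trias 𝒱 →ₗ[K] V) := HomDeg (triasGr 𝒱) 𝒱 k

/-- `D = Ψ(R)` for `R` of degree `k`: for all `n ≥ 0`, `m ≥ 1`,
`D(x₁⋯xₙ ⊗ y₁⋯yₘ) = ∑ ± R(x_{σ(1)}⋯x_{σ(p)} ⊗ x_{σ(p+1)}⋯x_{σ(p+q)}) x_{σ(p+q+1)}⋯x_{σ(n)} ⊗ y₁⋯yₘ
+ ∑ ± x_{σ(1)}⋯x_{σ(n-p)} ⊗ R(x_{σ(n-p+1)}⋯x_{σ(n)} ⊗ y_{τ(1)}⋯y_{τ(q)}) y_{τ(q+1)}⋯y_{τ(m)}`. -/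
def IsHat (k : ℤ) (R : Trias 𝒱 →ₗ[K] V) (D : Trias 𝒱 →ₗ[K] Trias 𝒱) : Prop :=
  ForAllHomogeneous 𝒱 fun {n m} x y a b =>
    D (mono 𝒱 x y) =
      (∑ p ∈ Finset.range n, ∑ q ∈ Finset.Icc 1 (n - p), ∑ σ ∈ shuffles₃ n p q,
        koszulSign K a σ •
          tm 𝒱
            (Sym.ι 𝒱 (R (tm 𝒱 (Sym.block 𝒱 (x ∘ σ) 0 p) (Sym.block 𝒱 (x ∘ σ) p (p + q)))) *
              Sym.block 𝒱 (x ∘ σ) (p + q) n)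
            (Sym.block 𝒱 y 0 m)) +
      ∑ p ∈ Finset.range (n + 1), ∑ q ∈ Finset.Icc 1 m,
        ∑ σ ∈ shuffles₂ n (n - p), ∑ τ ∈ shuffles₂ m q,
          (koszulSign K a σ * koszulSign K b τ * (-1 : K) ^ (k * degSum (a ∘ σ) 0 (n - p))) •
            tm 𝒱
              (Sym.block 𝒱 (x ∘ σ) 0 (n - p))
              (Sym.ι 𝒱 (R (tm 𝒱 (Sym.block 𝒱 (x ∘ σ) (n - p) n) (Sym.block 𝒱 (y ∘ τ) 0 q))) *
                Sym.block 𝒱 (y ∘ τ) q m)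

/-- `h = f ∘ g` for `g` of degree `l`: for all `n ≥ 0`, `m ≥ 1`,
`h(x₁⋯xₙ ⊗ y₁⋯yₘ) =
∑ ± f(g(x_{σ(1)}⋯x_{σ(p)} ⊗ x_{σ(p+1)}⋯x_{σ(p+q)}) x_{σ(p+q+1)}⋯x_{σ(n)} ⊗ y₁⋯yₘ)
+ ∑ ± f(x_{σ(1)}⋯x_{σ(n-p)} ⊗ g(x_{σ(n-p+1)}⋯x_{σ(n)} ⊗ y_{τ(1)}⋯y_{τ(q)}) y_{τ(q+1)}⋯y_{τ(m)})`. -/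
def IsCirc (l : ℤ) (f g h : Trias 𝒱 →ₗ[K] V) : Prop :=
  ForAllHomogeneous 𝒱 fun {n m} x y a b =>
    h (mono 𝒱 x y) =
      (∑ p ∈ Finset.range n, ∑ q ∈ Finset.Icc 1 (n - p), ∑ σ ∈ shuffles₃ n p q,
        koszulSign K a σ •
          f (tm 𝒱
            (Sym.ι 𝒱 (g (tm 𝒱 (Sym.block 𝒱 (x ∘ σ) 0 p) (Sym.block 𝒱 (x ∘ σ) p (p + q)))) *
              Sym.block 𝒱 (x ∘ σ) (p + q) n)
            (Sym.block 𝒱 y 0 m))) +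
      ∑ p ∈ Finset.range (n + 1), ∑ q ∈ Finset.Icc 1 m,
        ∑ σ ∈ shuffles₂ n (n - p), ∑ τ ∈ shuffles₂ m q,
          (koszulSign K a σ * koszulSign K b τ * (-1 : K) ^ (l * degSum (a ∘ σ) 0 (n - p))) •
            f (tm 𝒱
              (Sym.block 𝒱 (x ∘ σ) 0 (n - p))
              (Sym.ι 𝒱 (g (tm 𝒱 (Sym.block 𝒱 (x ∘ σ) (n - p) n) (Sym.block 𝒱 (y ∘ τ) 0 q))) *
                Sym.block 𝒱 (y ∘ τ) q m))

end

end PostLie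

end

/-!
Write `S = Sym(V)` and `C = S ⊗ S̅ym(V)`. All the structure on `C` is obtained by restriction from
the larger space `B = S ⊗ S` (`BiSym`), which is generated from `1 ⊗ 1` by the left
multiplications `L_v` and `M_v` by elements `v ∈ V` of its two factors. Because these operators
satisfy no relations except graded commutativity, a linear map out of `B` may be prescribed by its
value at `1 ⊗ 1` and by operators `λ_v`, `μ_v` on the target, commuting in the graded sense, to
which it carries `L_v` and `M_v` (`GradedAction.orbit`). The coproducts `Δ` and `δ` are defined in
this way: `L_v` and `M_v` are primitive for `Δ`, while `δ` carries `L_v` to `(L_v + M_v) ⊗ Id + Id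
⊗ L_v` and `M_v` to `Id ⊗ M_v`. In Sweedler notation, up to Koszul signs, `Δ(a ⊗ b) = (a₍₁₎ ⊗
b₍₁₎) ⊗ (a₍₂₎ ⊗ b₍₂₎)` and `δ(a ⊗ b) = (a₍₁₎ ⊗ a₍₂₎) ⊗ (a₍₃₎ ⊗ b)`.

For `R : B → V` of degree `k` let `ψ₁(R)(c) = L_{R(c')} c''` with `δ c = c' ⊗ c''`, and `ψ₂(R)(c)
= M_{R(c')} c''` with `Δ c = c' ⊗ c''`; then `Ψ(R) = ψ₁(R) + ψ₂(R)`. The graded commutators of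
`ψ₁(R)` and `ψ₂(R)` with `L_v` and `M_v` are again of the form `ψ₁(R')`, `ψ₂(R')`, where `R'` is
the composite of `R` with `L_v`, `M_v` or `L_v + M_v`. The coderivation identities therefore
follow by induction on the number of operators applied to `1 ⊗ 1`, with `R` varying: the induction
step is a computation with operators (`coder_step`), and no shuffle ever occurs (`coΔ_psi`,
`coδ_psi`).

Shuffles are needed only to recognise the explicit formulas. A shuffle together with its shape is
the same thing as a colouring of the entries by the blocks in which they are placed; it is the
stable sorting permutation of that colouring (`sum_shufflesOf_eq_sum`). Sums over colourings
satisfy the recursions that define `Δ` and `δ`, which gives the formulas for `Δ`, `δ` and `Ψ`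
(`isCoproductΔ_triasΔ`, `isCoproductδ_triasδ`, `isHat_hat`).

Let `π : C → V` be the projection. Then `π Ψ(R) = R` (`triasProj_comp_hat`). Conversely, a
coderivation `D` with `π D = 0` vanishes: by induction on the length of a monomial `t`, the
element `D t` is annihilated by `Δ`, `δ` and `π`, and such an element is zero
(`eq_zero_of_primitive`). Indeed, `δ` annihilates only elements of `1 ⊗ S̅ym(V)`. For these,
consider `c ↦ π(c') (ε ⊗ Id)(c'')`, where `Δ c = c' ⊗ c''` in `B ⊗ B` and `ε` is the counit: this
Euler operator multiplies by the weight, hence is injective in characteristic zero. It vanishes at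
an element annihilated by `Δ` and `π`, because the restriction of `Δ` to `C` omits from the
coproduct of `B` only terms whose contribution is `π(c)`. So `Ψ` is an isomorphism onto the
coderivations. Finally `f ∘ g = f Ψ(g)`, so that `[f, g] = π [Ψ(f), Ψ(g)]`; since graded
commutators of coderivations are coderivations, `Ψ` carries this bracket to the graded commutator,
and the Jacobi identity is inherited.
-/

noncomputable section

namespace PostLie

variable {K : Type*} [Field K] {V : Type*} [AddCommGroup V] [Module K V]

/-! ### Homogeneous elements and signs -/

theorem sgn_add (a b : ℤ) : (-1 : K) ^ (a + b) = (-1 : K) ^ a * (-1 : K) ^ b :=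
  zpow_add₀ (by simp) a b

theorem sgn_mul_self (a : ℤ) : (-1 : K) ^ a * (-1 : K) ^ a = 1 := by
  rw [← mul_zpow]; simp

theorem sgn_eq_of_even_sub {a b : ℤ} (h : Even (a - b)) : (-1 : K) ^ a = (-1 : K) ^ b := by
  rw [← sub_add_cancel a b, sgn_add, h.neg_one_zpow, one_mul]

section

variable (𝒱 : ℤ → Submodule K V) [DirectSum.Decomposition 𝒱]

variable {𝒱} in
theorem homogeneous_induction {p : V → Prop} (h : ∀ i, ∀ v ∈ 𝒱 i, p v)
    (hadd : ∀ v w, p v → p w → p (v + w)) (v : V) : p v :=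
  DirectSum.Decomposition.inductionOn 𝒱 (h 0 0 (Submodule.zero_mem _))
    (fun {i} m => h i m m.2) hadd v

/-- The linear map on `V` that is given by `F i` on the part of degree `i`. -/
def gradedGlue {W : Type*} [AddCommGroup W] [Module K W] (F : ℤ → V →ₗ[K] W) : V →ₗ[K] W :=
  DirectSum.toModule K ℤ W (fun i => F i ∘ₗ (𝒱 i).subtype) ∘ₗ
    (DirectSum.decomposeLinearEquiv 𝒱).toLinearMap

theorem gradedGlue_of_mem {W : Type*} [AddCommGroup W] [Module K W] (F : ℤ → V →ₗ[K] W)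
    {i : ℤ} {v : V} (hv : v ∈ 𝒱 i) : gradedGlue 𝒱 F v = F i v := by
  change DirectSum.toModule K ℤ W (fun i => F i ∘ₗ (𝒱 i).subtype) (DirectSum.decompose 𝒱 v) = _
  rw [DirectSum.decompose_of_mem 𝒱 hv, ← DirectSum.lof_eq_of K, DirectSum.toModule_lof]
  rfl

end

namespace Sym

variable (𝒱 : ℤ → Submodule K V)

variable {𝒱} in
/-- Induction principle: `Sym(V)` is generated by `V` as an algebra. -/
theorem induction {p : Sym 𝒱 → Prop} (hr : ∀ r, p (algebraMap K _ r)) (hι : ∀ v, p (ι 𝒱 v))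
    (hmul : ∀ a b, p a → p b → p (a * b)) (hadd : ∀ a b, p a → p b → p (a + b)) (a : Sym 𝒱) :
    p a := by
  obtain ⟨t, rfl⟩ := RingQuot.mkAlgHom_surjective K (SymRel 𝒱) a
  induction t using TensorAlgebra.induction with
  | algebraMap r => rw [AlgHom.commutes]; exact hr r
  | ι v => exact hι v
  | mul a b ha hb => rw [map_mul]; exact hmul _ _ ha hb
  | add a b ha hb => rw [map_add]; exact hadd _ _ ha hb

@[simp] theorem counit_ι (v : V) : counit 𝒱 (ι 𝒱 v) = 0 := by simp [counit]

@[simp] theorem toBar_coe (b : bar 𝒱) : toBar 𝒱 b = b :=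
  Subtype.ext (toBar_of_mem 𝒱 b.2)

theorem coe_toBar (a : Sym 𝒱) :
    (toBar 𝒱 a : Sym 𝒱) = a - algebraMap K (Sym 𝒱) (counit 𝒱 a) := rfl

@[simp] theorem toBar_one : toBar 𝒱 1 = 0 := by
  apply Subtype.ext; rw [coe_toBar]; simp

theorem sign_ι [DirectSum.Decomposition 𝒱] (k : ℤ) {i : ℤ} {v : V} (hv : v ∈ 𝒱 i) :
    sign 𝒱 k (ι 𝒱 v) = (-1 : K) ^ (k * i) • ι 𝒱 v := by
  rw [sign, lift_ι, LinearMap.comp_apply, signV_of_mem 𝒱 k hv, map_smul]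

theorem sign_add [DirectSum.Decomposition 𝒱] (k l : ℤ) :
    sign 𝒱 (k + l) = (sign 𝒱 k).comp (sign 𝒱 l) := by
  apply algHom_ext
  refine homogeneous_induction (𝒱 := 𝒱) (fun i v hv => ?_) (fun v w hv hw => ?_)
  · rw [AlgHom.comp_apply, sign_ι 𝒱 _ hv, sign_ι 𝒱 _ hv, map_smul, sign_ι 𝒱 _ hv, smul_smul,
      add_mul, sgn_add, mul_comm]
  · rw [map_add, map_add, map_add, hv, hw]

end Sym

/-! ### Operators on `Sym(V) ⊗ Sym(V)` -/

section

variable (𝒱 : ℤ → Submodule K V)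

/-- The space `Sym(V) ⊗ Sym(V)`, which contains `Sym(V) ⊗ S̅ym(V)` as a direct summand. -/
abbrev BiSym : Type _ := Sym 𝒱 ⊗[K] Sym 𝒱

/-- Left multiplication on the first factor: `L_v (a ⊗ b) = v a ⊗ b`. -/
def opL : V →ₗ[K] Module.End K (BiSym 𝒱) :=
  LinearMap.rTensorHom (Sym 𝒱) ∘ₗ LinearMap.mul K (Sym 𝒱) ∘ₗ Sym.ι 𝒱

@[simp] theorem opL_tmul (v : V) (a b : Sym 𝒱) :
    opL 𝒱 v (a ⊗ₜ b) = (Sym.ι 𝒱 v * a) ⊗ₜ b := rfl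

/-- The unit `1 ⊗ 1`. -/
def unit₂ : BiSym 𝒱 := 1 ⊗ₜ 1

variable [DirectSum.Decomposition 𝒱]

/-- Left multiplication on the second factor, with the Koszul sign:
`M_v (a ⊗ b) = (-1)^{|a||v|} a ⊗ v b`. -/
def opM : V →ₗ[K] Module.End K (BiSym 𝒱) :=
  gradedGlue 𝒱 fun i =>
    TensorProduct.mapBilinear (RingHom.id K) _ _ _ _ (Sym.sign 𝒱 i).toLinearMap ∘ₗ
      LinearMap.mul K (Sym 𝒱) ∘ₗ Sym.ι 𝒱

theorem opM_tmul {i : ℤ} {v : V} (hv : v ∈ 𝒱 i) (a b : Sym 𝒱) :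
    opM 𝒱 v (a ⊗ₜ b) = Sym.sign 𝒱 i a ⊗ₜ (Sym.ι 𝒱 v * b) := by
  rw [opM, gradedGlue_of_mem 𝒱 _ hv]; rfl

/-- `M_v (1 ⊗ b) = 1 ⊗ v b`. -/
theorem opM_one_tmul (v : V) (b : Sym 𝒱) :
    opM 𝒱 v (1 ⊗ₜ b) = 1 ⊗ₜ (Sym.ι 𝒱 v * b) := by
  induction v using homogeneous_induction (𝒱 := 𝒱) with
  | h i v hv => rw [opM_tmul 𝒱 hv, map_one]
  | hadd v w hv hw =>
    rw [map_add, LinearMap.add_apply, hv, hw, map_add, add_mul, TensorProduct.tmul_add]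

/-- The operator `c ↦ (-1)^{k|c|} c` on `Sym(V) ⊗ Sym(V)`. -/
def sgnOp (k : ℤ) : Module.End K (BiSym 𝒱) :=
  TensorProduct.map (Sym.sign 𝒱 k).toLinearMap (Sym.sign 𝒱 k).toLinearMap

@[simp] theorem sgnOp_tmul (k : ℤ) (a b : Sym 𝒱) :
    sgnOp 𝒱 k (a ⊗ₜ b) = Sym.sign 𝒱 k a ⊗ₜ Sym.sign 𝒱 k b := rfl

@[simp] theorem sgnOp_unit₂ (k : ℤ) : sgnOp 𝒱 k (unit₂ 𝒱) = unit₂ 𝒱 := by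
  simp [unit₂]

theorem sgnOp_add (k l : ℤ) : sgnOp 𝒱 (k + l) = sgnOp 𝒱 k * sgnOp 𝒱 l := by
  apply TensorProduct.ext'
  intro a b
  simp [Sym.sign_add]

theorem sgnOp_comm (k l : ℤ) : sgnOp 𝒱 k * sgnOp 𝒱 l = sgnOp 𝒱 l * sgnOp 𝒱 k := by
  rw [← sgnOp_add, add_comm, sgnOp_add]

end

/-- Two endomorphisms of degrees `i` and `j` that commute in the graded sense:
`X Y = (-1)^{ij} Y X`. -/
def GComm {W : Type*} [AddCommGroup W] [Module K W] (i j : ℤ) (X Y : Module.End K W) : Prop :=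
  X * Y = (-1 : K) ^ (i * j) • (Y * X)

namespace GComm

variable {W W' : Type*} [AddCommGroup W] [Module K W] [AddCommGroup W'] [Module K W']
  {i j : ℤ} {X X' Y Y' : Module.End K W}

theorem symm (h : GComm i j X Y) : GComm j i Y X := by
  unfold GComm at *
  rw [h, smul_smul, mul_comm j i, sgn_mul_self, one_smul]

theorem add_left (h : GComm i j X Y) (h' : GComm i j X' Y) : GComm i j (X + X') Y := by
  unfold GComm at *
  rw [add_mul, h, h', mul_add, smul_add]

theorem add_right (h : GComm i j X Y) (h' : GComm i j X Y') : GComm i j X (Y + Y') := by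
  unfold GComm at *
  rw [mul_add, h, h', add_mul, smul_add]

theorem map_one_map_one (h : GComm i j X Y) :
    GComm i j (TensorProduct.map X (1 : Module.End K W')) (TensorProduct.map Y 1) := by
  unfold GComm at *
  rw [← TensorProduct.map_mul, ← TensorProduct.map_mul, h, TensorProduct.map_smul_left]

theorem map_one_map {S : Module.End K W} (h : X * S = (-1 : K) ^ (i * j) • (S * X))
    (Z : Module.End K W') : GComm i j (TensorProduct.map X 1) (TensorProduct.map S Z) := by
  unfold GComm at *
  rw [← TensorProduct.map_mul, ← TensorProduct.map_mul, h, TensorProduct.map_smul_left, one_mul,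
    mul_one]

theorem map_map {S T : Module.End K W'} (hST : S * T = T * S) (h : GComm i j X Y) :
    GComm i j (TensorProduct.map S X) (TensorProduct.map T Y) := by
  unfold GComm at *
  rw [← TensorProduct.map_mul, ← TensorProduct.map_mul, h, TensorProduct.map_smul_right, hST]

end GComm

theorem gComm_opL_opL (𝒱 : ℤ → Submodule K V) {i j : ℤ} {v w : V} (hv : v ∈ 𝒱 i)
    (hw : w ∈ 𝒱 j) :
    GComm i j (opL 𝒱 v) (opL 𝒱 w) := by
  apply TensorProduct.ext'
  intro a b
  simp only [Module.End.mul_apply, LinearMap.smul_apply, opL_tmul, ← mul_assoc,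
    Sym.ι_mul_ι 𝒱 hv hw, smul_mul_assoc, TensorProduct.smul_tmul']

section

variable (𝒱 : ℤ → Submodule K V) [DirectSum.Decomposition 𝒱] {i j : ℤ} {v w : V}

theorem opL_sgnOp (hv : v ∈ 𝒱 i) (k : ℤ) :
    opL 𝒱 v * sgnOp 𝒱 k = (-1 : K) ^ (i * k) • (sgnOp 𝒱 k * opL 𝒱 v) := by
  apply TensorProduct.ext'
  intro a b
  simp only [Module.End.mul_apply, LinearMap.smul_apply, sgnOp_tmul, opL_tmul, map_mul,
    Sym.sign_ι 𝒱 k hv, smul_mul_assoc, TensorProduct.smul_tmul', smul_smul]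
  rw [mul_comm k i, sgn_mul_self, one_smul]

theorem opM_sgnOp (hv : v ∈ 𝒱 i) (k : ℤ) :
    opM 𝒱 v * sgnOp 𝒱 k = (-1 : K) ^ (i * k) • (sgnOp 𝒱 k * opM 𝒱 v) := by
  apply TensorProduct.ext'
  intro a b
  simp only [Module.End.mul_apply, LinearMap.smul_apply, sgnOp_tmul, opM_tmul 𝒱 hv, map_mul,
    Sym.sign_ι 𝒱 k hv, smul_mul_assoc, TensorProduct.tmul_smul, smul_smul]
  rw [mul_comm k i, sgn_mul_self, one_smul, ← AlgHom.comp_apply, ← AlgHom.comp_apply,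
    ← Sym.sign_add, ← Sym.sign_add, add_comm]

theorem gComm_opM_opM (hv : v ∈ 𝒱 i) (hw : w ∈ 𝒱 j) : GComm i j (opM 𝒱 v) (opM 𝒱 w) := by
  apply TensorProduct.ext'
  intro a b
  simp only [Module.End.mul_apply, LinearMap.smul_apply, opM_tmul 𝒱 hv, opM_tmul 𝒱 hw, ← mul_assoc,
    Sym.ι_mul_ι 𝒱 hv hw, smul_mul_assoc, TensorProduct.tmul_smul]
  rw [← AlgHom.comp_apply, ← AlgHom.comp_apply, ← Sym.sign_add, ← Sym.sign_add, add_comm]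

theorem gComm_opL_opM (hv : v ∈ 𝒱 i) (hw : w ∈ 𝒱 j) : GComm i j (opL 𝒱 v) (opM 𝒱 w) := by
  apply TensorProduct.ext'
  intro a b
  simp only [Module.End.mul_apply, LinearMap.smul_apply, opM_tmul 𝒱 hw, opL_tmul, map_mul,
    Sym.sign_ι 𝒱 _ hv, smul_mul_assoc, TensorProduct.smul_tmul', smul_smul]
  rw [mul_comm j i, sgn_mul_self, one_smul]

end

/-! ### Linear maps out of `Sym(V) ⊗ Sym(V)` -/

/-- Operators `λ_v`, `μ_v` on a vector space `W`, depending linearly on `v ∈ V`, that commute with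
each other in the same graded sense as the operators `L_v`, `M_v` on `Sym(V) ⊗ Sym(V)`. -/
structure GradedAction (𝒱 : ℤ → Submodule K V) (W : Type*) [AddCommGroup W] [Module K W] where
  lam : V →ₗ[K] Module.End K W
  mu : V →ₗ[K] Module.End K W
  lam_lam : ∀ {i j v w}, v ∈ 𝒱 i → w ∈ 𝒱 j → GComm i j (lam v) (lam w)
  mu_mu : ∀ {i j v w}, v ∈ 𝒱 i → w ∈ 𝒱 j → GComm i j (mu v) (mu w)
  lam_mu : ∀ {i j v w}, v ∈ 𝒱 i → w ∈ 𝒱 j → GComm i j (lam v) (mu w)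

namespace GradedAction

variable {𝒱 : ℤ → Submodule K V} {W : Type*} [AddCommGroup W] [Module K W]
  (A : GradedAction 𝒱 W)

/-- The action of `Sym(V)` on `W` generated by the operators `λ_v`. -/
def lamHom : Sym 𝒱 →ₐ[K] Module.End K W :=
  Sym.lift 𝒱 A.lam fun _ _ _ _ hx hy => A.lam_lam hx hy

/-- The action of `Sym(V)` on `W` generated by the operators `μ_v`. -/
def muHom : Sym 𝒱 →ₐ[K] Module.End K W :=
  Sym.lift 𝒱 A.mu fun _ _ _ _ hx hy => A.mu_mu hx hy

theorem lamHom_ι (v : V) : A.lamHom (Sym.ι 𝒱 v) = A.lam v := Sym.lift_ι 𝒱 A.lam _ v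

theorem muHom_ι (v : V) : A.muHom (Sym.ι 𝒱 v) = A.mu v := Sym.lift_ι 𝒱 A.mu _ v

/-- The linear map `Sym(V) ⊗ Sym(V) → W` that sends `1 ⊗ 1` to `w` and carries `L_v`, `M_v` to
`λ_v`, `μ_v`. -/
def orbit (w : W) : BiSym 𝒱 →ₗ[K] W :=
  TensorProduct.lift <| LinearMap.mk₂ K (fun a b => A.lamHom a (A.muHom b w))
    (fun _ _ _ => by rw [map_add, LinearMap.add_apply])
    (fun _ _ _ => by rw [map_smul, LinearMap.smul_apply])
    (fun _ _ _ => by rw [map_add, LinearMap.add_apply, map_add])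
    (fun _ _ _ => by rw [map_smul, LinearMap.smul_apply, map_smul])

theorem orbit_tmul (w : W) (a b : Sym 𝒱) : A.orbit w (a ⊗ₜ b) = A.lamHom a (A.muHom b w) := rfl

theorem orbit_unit₂ (w : W) : A.orbit w (unit₂ 𝒱) = w := by
  simp [unit₂, orbit_tmul]

theorem orbit_opL (w : W) (v : V) (c : BiSym 𝒱) :
    A.orbit w (opL 𝒱 v c) = A.lam v (A.orbit w c) := by
  induction c using TensorProduct.induction_on with
  | zero => simp
  | add c d hc hd => simp only [map_add, hc, hd]
  | tmul a b => simp [orbit_tmul, lamHom_ι]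

variable [DirectSum.Decomposition 𝒱]

theorem lamHom_sign {j : ℤ} {v : V} (hv : v ∈ 𝒱 j) (a : Sym 𝒱) :
    A.lamHom (Sym.sign 𝒱 j a) * A.mu v = A.mu v * A.lamHom a := by
  induction a using Sym.induction with
  | hr r => simp [Algebra.algebraMap_eq_smul_one]
  | hι u =>
    induction u using homogeneous_induction (𝒱 := 𝒱) with
    | h i u hu =>
      have h := A.lam_mu hu hv
      unfold GComm at h
      rw [Sym.sign_ι 𝒱 _ hu, map_smul, lamHom_ι, smul_mul_assoc, h, smul_smul,
        mul_comm j i, sgn_mul_self, one_smul]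
    | hadd u u' hu hu' => simp only [map_add, add_mul, mul_add, hu, hu']
  | hmul a b ha hb => rw [map_mul, map_mul, mul_assoc, hb, ← mul_assoc, ha, map_mul, mul_assoc]
  | hadd a b ha hb => simp only [map_add, add_mul, mul_add, ha, hb]

theorem orbit_opM (w : W) (v : V) (c : BiSym 𝒱) :
    A.orbit w (opM 𝒱 v c) = A.mu v (A.orbit w c) := by
  induction v using homogeneous_induction (𝒱 := 𝒱) with
  | hadd u u' hu hu' => simp only [map_add, LinearMap.add_apply, hu, hu']
  | h i v hv =>
    induction c using TensorProduct.induction_on with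
    | zero => simp
    | add c d hc hd => simp only [map_add, hc, hd]
    | tmul a b =>
      have h := LinearMap.congr_fun (A.lamHom_sign hv a) (A.muHom b w)
      rw [opM_tmul 𝒱 hv, orbit_tmul, orbit_tmul, map_mul]
      simpa [muHom_ι] using h

end GradedAction

/-! ### The grading of `Sym(V) ⊗ Sym(V)` -/

section

variable (𝒱 : ℤ → Submodule K V) [DirectSum.Decomposition 𝒱]

/-- The elements of `Sym(V) ⊗ Sym(V)` obtained from `1 ⊗ 1` by applying finitely many operators
`L_v`, `M_v` with `v` homogeneous, and their degrees. -/
inductive Word : ℤ → BiSym 𝒱 → Prop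
  | unit : Word 0 (unit₂ 𝒱)
  | opL {i d : ℤ} {v : V} {c : BiSym 𝒱} : v ∈ 𝒱 i → Word d c → Word (i + d) (opL 𝒱 v c)
  | opM {i d : ℤ} {v : V} {c : BiSym 𝒱} : v ∈ 𝒱 i → Word d c → Word (i + d) (opM 𝒱 v c)

/-- The part of degree `d` of `Sym(V) ⊗ Sym(V)`. -/
def biGr (d : ℤ) : Submodule K (BiSym 𝒱) := Submodule.span K {c | Word 𝒱 d c}

theorem span_word : Submodule.span K {c | ∃ d, Word 𝒱 d c} = ⊤ := by
  set N := Submodule.span K {c | ∃ d, Word 𝒱 d c} with hN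
  have hL : ∀ v, ∀ c ∈ N, opL 𝒱 v c ∈ N := by
    intro v c hc
    induction v using homogeneous_induction (𝒱 := 𝒱) with
    | hadd u u' hu hu' => rw [map_add]; exact N.add_mem hu hu'
    | h i v hv =>
      refine Submodule.span_induction (p := fun c _ => opL 𝒱 v c ∈ N) ?_ ?_ ?_ ?_ hc
      · rintro c ⟨d, hd⟩
        exact Submodule.subset_span ⟨_, .opL hv hd⟩
      · rw [map_zero]; exact N.zero_mem
      · intro c d _ _ h h'; rw [map_add]; exact N.add_mem h h'
      · intro r c _ h; rw [map_smul]; exact N.smul_mem r h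
  have hM : ∀ v, ∀ c ∈ N, opM 𝒱 v c ∈ N := by
    intro v c hc
    induction v using homogeneous_induction (𝒱 := 𝒱) with
    | hadd u u' hu hu' => rw [map_add]; exact N.add_mem hu hu'
    | h i v hv =>
      refine Submodule.span_induction (p := fun c _ => opM 𝒱 v c ∈ N) ?_ ?_ ?_ ?_ hc
      · rintro c ⟨d, hd⟩
        exact Submodule.subset_span ⟨_, .opM hv hd⟩
      · rw [map_zero]; exact N.zero_mem
      · intro c d _ _ h h'; rw [map_add]; exact N.add_mem h h'
      · intro r c _ h; rw [map_smul]; exact N.smul_mem r h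
  have h1 : ∀ b b' : Sym 𝒱, 1 ⊗ₜ[K] b' ∈ N → 1 ⊗ₜ[K] (b * b') ∈ N := by
    intro b
    induction b using Sym.induction with
    | hr r =>
      intro b' h
      rw [← Algebra.smul_def, TensorProduct.tmul_smul]; exact N.smul_mem r h
    | hι v => intro b' h; rw [← opM_one_tmul]; exact hM v _ h
    | hmul a b ha hb => intro b' h; rw [mul_assoc]; exact ha _ (hb _ h)
    | hadd a b ha hb =>
      intro b' h
      rw [add_mul, TensorProduct.tmul_add]; exact N.add_mem (ha _ h) (hb _ h)
  have h2 : ∀ a a' b : Sym 𝒱, a' ⊗ₜ[K] b ∈ N → (a * a') ⊗ₜ[K] b ∈ N := by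
    intro a
    induction a using Sym.induction with
    | hr r =>
      intro a' b h
      rw [← Algebra.smul_def, ← TensorProduct.smul_tmul']; exact N.smul_mem r h
    | hι v => intro a' b h; exact hL v _ h
    | hmul a b ha hb => intro a' b' h; rw [mul_assoc]; exact ha _ _ (hb _ _ h)
    | hadd a b ha hb =>
      intro a' b' h
      rw [add_mul, TensorProduct.add_tmul]; exact N.add_mem (ha _ _ h) (hb _ _ h)
  rw [eq_top_iff]
  rintro c -
  induction c using TensorProduct.induction_on with
  | zero => exact N.zero_mem
  | add c d hc hd => exact N.add_mem hc hd
  | tmul a b =>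
    have := h2 a 1 b (by
      have := h1 b 1 (Submodule.subset_span ⟨0, .unit⟩)
      rwa [mul_one] at this)
    rwa [mul_one] at this

variable {𝒱}

/-- A linear identity on `Sym(V) ⊗ Sym(V)` may be checked on words. -/
theorem bi_ext {W : Type*} [AddCommGroup W] [Module K W] {f g : BiSym 𝒱 →ₗ[K] W}
    (h : ∀ d c, Word 𝒱 d c → f c = g c) : f = g :=
  LinearMap.ext_on (span_word 𝒱) (by rintro c ⟨d, hd⟩; exact h d c hd)

/-- A linear map on `Sym(V) ⊗ Sym(V)` is determined by its value at `1 ⊗ 1` and by the operators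
to which it carries the `L_v` and the `M_v`. -/
theorem bi_ext' {W : Type*} [AddCommGroup W] [Module K W] {f g : BiSym 𝒱 →ₗ[K] W}
    (h1 : f (unit₂ 𝒱) = g (unit₂ 𝒱))
    (hL : ∀ i, ∀ v ∈ 𝒱 i, ∀ c, f c = g c → f (opL 𝒱 v c) = g (opL 𝒱 v c))
    (hM : ∀ i, ∀ v ∈ 𝒱 i, ∀ c, f c = g c → f (opM 𝒱 v c) = g (opM 𝒱 v c)) : f = g := by
  apply bi_ext
  intro d c hc
  induction hc with
  | unit => exact h1
  | opL hv _ ih => exact hL _ _ hv _ ih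
  | opM hv _ ih => exact hM _ _ hv _ ih

theorem homDeg_biGr {W : Type*} [AddCommGroup W] [Module K W] {𝒲 : ℤ → Submodule K W} {k : ℤ}
    {f : BiSym 𝒱 →ₗ[K] W} (h : ∀ d c, Word 𝒱 d c → f c ∈ 𝒲 (d + k)) :
    f ∈ HomDeg (biGr 𝒱) 𝒲 k := by
  intro d c hc
  have : biGr 𝒱 d ≤ (𝒲 (d + k)).comap f := Submodule.span_le.2 fun c hc => h d c hc
  exact this hc

theorem opL_mem_homDeg {i : ℤ} {v : V} (hv : v ∈ 𝒱 i) :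
    opL 𝒱 v ∈ HomDeg (biGr 𝒱) (biGr 𝒱) i :=
  homDeg_biGr fun d c hc => Submodule.subset_span (by rw [add_comm]; exact .opL hv hc)

theorem opM_mem_homDeg {i : ℤ} {v : V} (hv : v ∈ 𝒱 i) :
    opM 𝒱 v ∈ HomDeg (biGr 𝒱) (biGr 𝒱) i :=
  homDeg_biGr fun d c hc => Submodule.subset_span (by rw [add_comm]; exact .opM hv hc)

theorem sgnOp_word {d : ℤ} {c : BiSym 𝒱} (hc : Word 𝒱 d c) (k : ℤ) :
    sgnOp 𝒱 k c = (-1 : K) ^ (k * d) • c := by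
  have aux : ∀ {i d : ℤ} {X : Module.End K (BiSym 𝒱)} {c : BiSym 𝒱},
      X * sgnOp 𝒱 k = (-1 : K) ^ (i * k) • (sgnOp 𝒱 k * X) →
      sgnOp 𝒱 k c = (-1 : K) ^ (k * d) • c →
      sgnOp 𝒱 k (X c) = (-1 : K) ^ (k * (i + d)) • X c := by
    intro i d X c hX hc
    have h := LinearMap.congr_fun hX c
    simp only [Module.End.mul_apply, LinearMap.smul_apply, hc, map_smul] at h
    rw [mul_add, sgn_add, mul_smul, h, smul_smul, mul_comm k i, sgn_mul_self, one_smul]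
  induction hc with
  | unit => simp
  | opL hv _ ih => exact aux (opL_sgnOp 𝒱 hv k) ih
  | opM hv _ ih => exact aux (opM_sgnOp 𝒱 hv k) ih

theorem mem_homDeg_comp {A B C : Type*} [AddCommGroup A] [Module K A] [AddCommGroup B] [Module K B]
    [AddCommGroup C] [Module K C] {𝒜 : ℤ → Submodule K A} {ℬ : ℤ → Submodule K B}
    {𝒞 : ℤ → Submodule K C} {k l : ℤ} {f : B →ₗ[K] C} {g : A →ₗ[K] B}
    (hf : f ∈ HomDeg ℬ 𝒞 k) (hg : g ∈ HomDeg 𝒜 ℬ l) : f ∘ₗ g ∈ HomDeg 𝒜 𝒞 (k + l) := by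
  intro d a ha
  have := hf _ _ (hg d a ha)
  rwa [add_assoc, add_comm l k] at this

end

/-! ### The coproducts on `Sym(V) ⊗ Sym(V)` -/

section

variable (𝒱 : ℤ → Submodule K V)

/-- The operators `X_v ⊗ Id`, `v ∈ V`. -/
def actFst (X : V →ₗ[K] Module.End K (BiSym 𝒱)) : V →ₗ[K] Module.End K (BiSym 𝒱 ⊗[K] BiSym 𝒱) :=
  LinearMap.rTensorHom (BiSym 𝒱) ∘ₗ X

theorem actFst_apply (X : V →ₗ[K] Module.End K (BiSym 𝒱)) (v : V) :
    actFst 𝒱 X v = TensorProduct.map (X v) 1 := rfl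

variable [DirectSum.Decomposition 𝒱]

/-- The operators `Id ⊗ X_v`, `v ∈ V`, with the Koszul sign:
`(Id ⊗ X_v)(s ⊗ t) = (-1)^{|v||s|} s ⊗ X_v t`. -/
def actSnd (X : V →ₗ[K] Module.End K (BiSym 𝒱)) : V →ₗ[K] Module.End K (BiSym 𝒱 ⊗[K] BiSym 𝒱) :=
  gradedGlue 𝒱 fun i => TensorProduct.mapBilinear (RingHom.id K) _ _ _ _ (sgnOp 𝒱 i) ∘ₗ X

variable {𝒱}

theorem actSnd_of_mem (X : V →ₗ[K] Module.End K (BiSym 𝒱)) {i : ℤ} {v : V} (hv : v ∈ 𝒱 i) :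
    actSnd 𝒱 X v = TensorProduct.map (sgnOp 𝒱 i) (X v) := by
  rw [actSnd, gradedGlue_of_mem 𝒱 _ hv]; rfl

/-- Operators `X ⊗ Id + Id ⊗ X'` and `Y ⊗ Id + Id ⊗ Y'` commute in the graded sense as soon as `X`
commutes with `Y` and `X'` with `Y'`. -/
theorem gComm_add_map {i j : ℤ} {X X' Y Y' : Module.End K (BiSym 𝒱)}
    (h : GComm i j X Y) (h' : GComm i j X' Y')
    (hX : X * sgnOp 𝒱 j = (-1 : K) ^ (i * j) • (sgnOp 𝒱 j * X))
    (hY : Y * sgnOp 𝒱 i = (-1 : K) ^ (j * i) • (sgnOp 𝒱 i * Y)) :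
    GComm i j (TensorProduct.map X 1 + TensorProduct.map (sgnOp 𝒱 i) X')
      (TensorProduct.map Y 1 + TensorProduct.map (sgnOp 𝒱 j) Y') :=
  .add_left (.add_right h.map_one_map_one (.map_one_map hX _))
    (.add_right (GComm.map_one_map hY _).symm (.map_map (sgnOp_comm 𝒱 i j) h'))

/-- `N_v = L_v + M_v`. -/
def opN (𝒱 : ℤ → Submodule K V) [DirectSum.Decomposition 𝒱] : V →ₗ[K] Module.End K (BiSym 𝒱) :=
  opL 𝒱 + opM 𝒱

theorem opN_apply (v : V) : opN 𝒱 v = opL 𝒱 v + opM 𝒱 v := rfl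

theorem opN_sgnOp {i : ℤ} {v : V} (hv : v ∈ 𝒱 i) (k : ℤ) :
    opN 𝒱 v * sgnOp 𝒱 k = (-1 : K) ^ (i * k) • (sgnOp 𝒱 k * opN 𝒱 v) := by
  rw [opN_apply, add_mul, opL_sgnOp 𝒱 hv, opM_sgnOp 𝒱 hv, mul_add, smul_add]

theorem gComm_opN_opN {i j : ℤ} {v w : V} (hv : v ∈ 𝒱 i) (hw : w ∈ 𝒱 j) :
    GComm i j (opN 𝒱 v) (opN 𝒱 w) :=
  .add_left (.add_right (gComm_opL_opL 𝒱 hv hw) (gComm_opL_opM 𝒱 hv hw))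
    (.add_right (gComm_opL_opM 𝒱 hw hv).symm (gComm_opM_opM 𝒱 hv hw))

/-- The operators through which `Δ` is compatible with `L_v` and `M_v`: both are primitive. -/
def actΔ (𝒱 : ℤ → Submodule K V) [DirectSum.Decomposition 𝒱] :
    GradedAction 𝒱 (BiSym 𝒱 ⊗[K] BiSym 𝒱) where
  lam := actFst 𝒱 (opL 𝒱) + actSnd 𝒱 (opL 𝒱)
  mu := actFst 𝒱 (opM 𝒱) + actSnd 𝒱 (opM 𝒱)
  lam_lam hv hw := by
    simp only [LinearMap.add_apply, actFst_apply, actSnd_of_mem _ hv, actSnd_of_mem _ hw]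
    exact gComm_add_map (gComm_opL_opL 𝒱 hv hw) (gComm_opL_opL 𝒱 hv hw) (opL_sgnOp 𝒱 hv _)
      (opL_sgnOp 𝒱 hw _)
  mu_mu hv hw := by
    simp only [LinearMap.add_apply, actFst_apply, actSnd_of_mem _ hv, actSnd_of_mem _ hw]
    exact gComm_add_map (gComm_opM_opM 𝒱 hv hw) (gComm_opM_opM 𝒱 hv hw) (opM_sgnOp 𝒱 hv _)
      (opM_sgnOp 𝒱 hw _)
  lam_mu hv hw := by
    simp only [LinearMap.add_apply, actFst_apply, actSnd_of_mem _ hv, actSnd_of_mem _ hw]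
    exact gComm_add_map (gComm_opL_opM 𝒱 hv hw) (gComm_opL_opM 𝒱 hv hw) (opL_sgnOp 𝒱 hv _)
      (opM_sgnOp 𝒱 hw _)

/-- The operators through which `δ` is compatible with `L_v` and `M_v`: in
`δ(a ⊗ b) = (a₍₁₎ ⊗ a₍₂₎) ⊗ (a₍₃₎ ⊗ b)` a factor `v` of `a` may go to either side of the first
`Sym(V) ⊗ Sym(V)` or to the left of the second one, and a factor `v` of `b` goes to the very
right. -/
def actδ (𝒱 : ℤ → Submodule K V) [DirectSum.Decomposition 𝒱] :
    GradedAction 𝒱 (BiSym 𝒱 ⊗[K] BiSym 𝒱) where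
  lam := actFst 𝒱 (opN 𝒱) + actSnd 𝒱 (opL 𝒱)
  mu := actSnd 𝒱 (opM 𝒱)
  lam_lam hv hw := by
    simp only [LinearMap.add_apply, actFst_apply, actSnd_of_mem _ hv, actSnd_of_mem _ hw]
    exact gComm_add_map (gComm_opN_opN hv hw) (gComm_opL_opL 𝒱 hv hw) (opN_sgnOp hv _)
      (opN_sgnOp hw _)
  mu_mu hv hw := by
    simp only [actSnd_of_mem _ hv, actSnd_of_mem _ hw]
    exact .map_map (sgnOp_comm 𝒱 _ _) (gComm_opM_opM 𝒱 hv hw)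
  lam_mu hv hw := by
    simp only [LinearMap.add_apply, actFst_apply, actSnd_of_mem _ hv, actSnd_of_mem _ hw]
    exact .add_left (.map_one_map (opN_sgnOp hv _) _)
      (.map_map (sgnOp_comm 𝒱 _ _) (gComm_opL_opM 𝒱 hv hw))

/-- The coproduct `Δ` on all of `Sym(V) ⊗ Sym(V)`. -/
def coΔ (𝒱 : ℤ → Submodule K V) [DirectSum.Decomposition 𝒱] :
    BiSym 𝒱 →ₗ[K] BiSym 𝒱 ⊗[K] BiSym 𝒱 :=
  (actΔ 𝒱).orbit (unit₂ 𝒱 ⊗ₜ unit₂ 𝒱)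

/-- The coproduct `δ` on all of `Sym(V) ⊗ Sym(V)`. -/
def coδ (𝒱 : ℤ → Submodule K V) [DirectSum.Decomposition 𝒱] :
    BiSym 𝒱 →ₗ[K] BiSym 𝒱 ⊗[K] BiSym 𝒱 :=
  (actδ 𝒱).orbit (unit₂ 𝒱 ⊗ₜ unit₂ 𝒱)

theorem coΔ_unit₂ : coΔ 𝒱 (unit₂ 𝒱) = unit₂ 𝒱 ⊗ₜ unit₂ 𝒱 := (actΔ 𝒱).orbit_unit₂ _

theorem coδ_unit₂ : coδ 𝒱 (unit₂ 𝒱) = unit₂ 𝒱 ⊗ₜ unit₂ 𝒱 := (actδ 𝒱).orbit_unit₂ _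

/-- The operator `X ⊗ Id + Id ⊗ Y`, where `Y` has degree `k`. -/
def primOp (k : ℤ) (X Y : Module.End K (BiSym 𝒱)) : Module.End K (BiSym 𝒱 ⊗[K] BiSym 𝒱) :=
  TensorProduct.map X 1 + TensorProduct.map (sgnOp 𝒱 k) Y

variable {i : ℤ} {v : V}

theorem coΔ_opL (hv : v ∈ 𝒱 i) (c : BiSym 𝒱) :
    coΔ 𝒱 (opL 𝒱 v c) = primOp i (opL 𝒱 v) (opL 𝒱 v) (coΔ 𝒱 c) := by
  rw [coΔ, GradedAction.orbit_opL, primOp, ← actSnd_of_mem _ hv]; rfl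

theorem coΔ_opM (hv : v ∈ 𝒱 i) (c : BiSym 𝒱) :
    coΔ 𝒱 (opM 𝒱 v c) = primOp i (opM 𝒱 v) (opM 𝒱 v) (coΔ 𝒱 c) := by
  rw [coΔ, GradedAction.orbit_opM, primOp, ← actSnd_of_mem _ hv]; rfl

theorem coδ_opL (hv : v ∈ 𝒱 i) (c : BiSym 𝒱) :
    coδ 𝒱 (opL 𝒱 v c) = primOp i (opN 𝒱 v) (opL 𝒱 v) (coδ 𝒱 c) := by
  rw [coδ, GradedAction.orbit_opL, primOp, ← actSnd_of_mem _ hv]; rfl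

theorem coδ_opM (hv : v ∈ 𝒱 i) (c : BiSym 𝒱) :
    coδ 𝒱 (opM 𝒱 v c) = primOp i 0 (opM 𝒱 v) (coδ 𝒱 c) := by
  rw [coδ, GradedAction.orbit_opM, primOp, ← actSnd_of_mem _ hv, TensorProduct.map_zero_left,
    zero_add]; rfl

/-- Commuting `A ⊗ Id + Id ⊗ B`, of degree `k`, past `X ⊗ Id + Id ⊗ Y`, of degree `i`; `A'` and `B'`
are the graded commutators of `A` with `X` and of `B` with `Y`. -/
theorem primOp_mul_primOp {k i : ℤ} {A A' B B' X Y : Module.End K (BiSym 𝒱)}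
    (hA : A * X = (-1 : K) ^ (k * i) • (X * A) + A')
    (hB : B * Y = (-1 : K) ^ (k * i) • (Y * B) + B')
    (hAs : A * sgnOp 𝒱 i = (-1 : K) ^ (k * i) • (sgnOp 𝒱 i * A))
    (hXs : X * sgnOp 𝒱 k = (-1 : K) ^ (i * k) • (sgnOp 𝒱 k * X)) :
    primOp k A B * primOp i X Y =
      (-1 : K) ^ (k * i) • (primOp i X Y * primOp k A B) + primOp (k + i) A' B' := by
  have hXs' : sgnOp 𝒱 k * X = (-1 : K) ^ (k * i) • (X * sgnOp 𝒱 k) := by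
    rw [hXs, smul_smul, mul_comm i k, sgn_mul_self, one_smul]
  simp only [primOp, add_mul, mul_add, ← TensorProduct.map_mul, one_mul, mul_one, hA, hB, hAs, hXs',
    TensorProduct.map_add_left, TensorProduct.map_add_right, TensorProduct.map_smul_left,
    TensorProduct.map_smul_right, smul_add, sgnOp_add, sgnOp_comm 𝒱 i k]
  abel

theorem sgnOp_of_mem_biGr {d : ℤ} {c : BiSym 𝒱} (hc : c ∈ biGr 𝒱 d) (k : ℤ) :
    sgnOp 𝒱 k c = (-1 : K) ^ (k * d) • c := by
  refine Submodule.span_induction (p := fun c _ => sgnOp 𝒱 k c = (-1 : K) ^ (k * d) • c)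
    (fun c hc => sgnOp_word hc k) (by simp) (fun c c' _ _ h h' => ?_) (fun r c _ h => ?_) hc
  · rw [map_add, h, h', smul_add]
  · rw [map_smul, h, smul_comm]

theorem homDeg_mul_sgnOp {k : ℤ} {D : Module.End K (BiSym 𝒱)}
    (hD : D ∈ HomDeg (biGr 𝒱) (biGr 𝒱) k) (i : ℤ) :
    D * sgnOp 𝒱 i = (-1 : K) ^ (k * i) • (sgnOp 𝒱 i * D) := by
  apply bi_ext
  intro d c hc
  rw [Module.End.mul_apply, LinearMap.smul_apply, Module.End.mul_apply, sgnOp_word hc, map_smul,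
    sgnOp_of_mem_biGr (hD d c (Submodule.subset_span hc)), smul_smul, ← sgn_add]
  congr 1
  exact sgn_eq_of_even_sub ⟨-(k * i), by ring⟩

/-! ### The two halves of the map `Ψ` on `Sym(V) ⊗ Sym(V)` -/

/-- `a ⊗ b ↦ R(a₍₁₎ ⊗ a₍₂₎) a₍₃₎ ⊗ b`. -/
def psi₁ (R : BiSym 𝒱 →ₗ[K] V) : Module.End K (BiSym 𝒱) :=
  TensorProduct.lift (opL 𝒱) ∘ₗ R.rTensor (BiSym 𝒱) ∘ₗ coδ 𝒱

/-- `a ⊗ b ↦ ± a₍₁₎ ⊗ R(a₍₂₎ ⊗ b₍₁₎) b₍₂₎`. -/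
def psi₂ (R : BiSym 𝒱 →ₗ[K] V) : Module.End K (BiSym 𝒱) :=
  TensorProduct.lift (opM 𝒱) ∘ₗ R.rTensor (BiSym 𝒱) ∘ₗ coΔ 𝒱

theorem psi₁_add (R S : BiSym 𝒱 →ₗ[K] V) : psi₁ (R + S) = psi₁ R + psi₁ S := by
  simp only [psi₁, LinearMap.rTensor_add, LinearMap.add_comp, LinearMap.comp_add]

theorem psi₂_add (R S : BiSym 𝒱 →ₗ[K] V) : psi₂ (R + S) = psi₂ R + psi₂ S := by
  simp only [psi₂, LinearMap.rTensor_add, LinearMap.add_comp, LinearMap.comp_add]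

theorem psi₁_smul (r : K) (R : BiSym 𝒱 →ₗ[K] V) : psi₁ (r • R) = r • psi₁ R := by
  simp only [psi₁, LinearMap.rTensor_smul, LinearMap.smul_comp, LinearMap.comp_smul]

theorem psi₂_smul (r : K) (R : BiSym 𝒱 →ₗ[K] V) : psi₂ (r • R) = r • psi₂ R := by
  simp only [psi₂, LinearMap.rTensor_smul, LinearMap.smul_comp, LinearMap.comp_smul]

theorem psi₁_unit₂ (R : BiSym 𝒱 →ₗ[K] V) :
    psi₁ R (unit₂ 𝒱) = opL 𝒱 (R (unit₂ 𝒱)) (unit₂ 𝒱) := by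
  simp [psi₁, coδ_unit₂]

theorem psi₂_unit₂ (R : BiSym 𝒱 →ₗ[K] V) :
    psi₂ R (unit₂ 𝒱) = opM 𝒱 (R (unit₂ 𝒱)) (unit₂ 𝒱) := by
  simp [psi₂, coΔ_unit₂]

variable {k : ℤ} {R : BiSym 𝒱 →ₗ[K] V}

theorem lift_rTensor_primOp (hR : R ∈ HomDeg (biGr 𝒱) 𝒱 k) {Z : V →ₗ[K] Module.End K (BiSym 𝒱)}
    {X Y : Module.End K (BiSym 𝒱)} (hZ : ∀ j, ∀ w ∈ 𝒱 j, GComm j i (Z w) Y)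
    (t : BiSym 𝒱 ⊗[K] BiSym 𝒱) :
    TensorProduct.lift Z (R.rTensor _ (primOp i X Y t)) =
      (-1 : K) ^ (k * i) • Y (TensorProduct.lift Z (R.rTensor _ t)) +
        TensorProduct.lift Z ((R ∘ₗ X).rTensor _ t) := by
  have h : TensorProduct.lift Z ∘ₗ R.rTensor _ ∘ₗ TensorProduct.map (sgnOp 𝒱 i) Y =
      (-1 : K) ^ (k * i) • (Y ∘ₗ TensorProduct.lift Z ∘ₗ R.rTensor _) := by
    refine TensorProduct.ext (bi_ext fun d c hc => LinearMap.ext fun c' => ?_)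
    have h := LinearMap.congr_fun (hZ _ _ (hR d c (Submodule.subset_span hc))) c'
    simp only [Module.End.mul_apply, LinearMap.smul_apply] at h
    simp only [LinearMap.compr₂ₛₗ_apply, TensorProduct.mk_apply,
      LinearMap.comp_apply, TensorProduct.map_tmul, LinearMap.rTensor_tmul,
      TensorProduct.lift.tmul, LinearMap.smul_apply,
      sgnOp_word hc, map_smul, h, smul_smul, ← sgn_add]
    congr 1
    exact sgn_eq_of_even_sub ⟨i * d, by ring⟩
  have h' := LinearMap.congr_fun h t
  simp only [LinearMap.comp_apply, LinearMap.smul_apply] at h'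
  rw [primOp, LinearMap.add_apply, map_add, map_add, h', add_comm]
  congr 2
  rw [LinearMap.rTensor_comp]; rfl

theorem psi₁_mul_opL (hR : R ∈ HomDeg (biGr 𝒱) 𝒱 k) (hv : v ∈ 𝒱 i) :
    psi₁ R * opL 𝒱 v = (-1 : K) ^ (k * i) • (opL 𝒱 v * psi₁ R) + psi₁ (R ∘ₗ opN 𝒱 v) := by
  refine LinearMap.ext fun c => ?_
  have := lift_rTensor_primOp (X := opN 𝒱 v) hR (fun j w hw => gComm_opL_opL 𝒱 hw hv) (coδ 𝒱 c)
  rwa [← coδ_opL hv] at this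

theorem psi₁_mul_opM (hR : R ∈ HomDeg (biGr 𝒱) 𝒱 k) (hv : v ∈ 𝒱 i) :
    psi₁ R * opM 𝒱 v = (-1 : K) ^ (k * i) • (opM 𝒱 v * psi₁ R) := by
  refine LinearMap.ext fun c => ?_
  have := lift_rTensor_primOp (X := 0) hR (fun j w hw => gComm_opL_opM 𝒱 hw hv) (coδ 𝒱 c)
  rw [← coδ_opM hv] at this
  rw [LinearMap.comp_zero, LinearMap.rTensor_zero, LinearMap.zero_apply, map_zero, add_zero] at this
  exact this

theorem psi₂_mul_opL (hR : R ∈ HomDeg (biGr 𝒱) 𝒱 k) (hv : v ∈ 𝒱 i) :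
    psi₂ R * opL 𝒱 v = (-1 : K) ^ (k * i) • (opL 𝒱 v * psi₂ R) + psi₂ (R ∘ₗ opL 𝒱 v) := by
  refine LinearMap.ext fun c => ?_
  have := lift_rTensor_primOp (X := opL 𝒱 v) hR (fun j w hw => (gComm_opL_opM 𝒱 hv hw).symm)
    (coΔ 𝒱 c)
  rwa [← coΔ_opL hv] at this

theorem psi₂_mul_opM (hR : R ∈ HomDeg (biGr 𝒱) 𝒱 k) (hv : v ∈ 𝒱 i) :
    psi₂ R * opM 𝒱 v = (-1 : K) ^ (k * i) • (opM 𝒱 v * psi₂ R) + psi₂ (R ∘ₗ opM 𝒱 v) := by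
  refine LinearMap.ext fun c => ?_
  have := lift_rTensor_primOp (X := opM 𝒱 v) hR (fun j w hw => gComm_opM_opM 𝒱 hw hv)
    (coΔ 𝒱 c)
  rwa [← coΔ_opM hv] at this

theorem opN_mem_homDeg (hv : v ∈ 𝒱 i) : opN 𝒱 v ∈ HomDeg (biGr 𝒱) (biGr 𝒱) i :=
  Submodule.add_mem _ (opL_mem_homDeg hv) (opM_mem_homDeg hv)

theorem unit₂_mem_biGr : unit₂ 𝒱 ∈ biGr 𝒱 0 := Submodule.subset_span .unit

theorem apply_unit₂_mem (hR : R ∈ HomDeg (biGr 𝒱) 𝒱 k) : R (unit₂ 𝒱) ∈ 𝒱 k := by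
  simpa using hR 0 _ unit₂_mem_biGr

/-- An element is homogeneous of degree `i + d + k` if it is a combination of the two terms that
arise from moving an operator of degree `k` past `v`. -/
theorem add_mem_biGr {d : ℤ} {X : Module.End K (BiSym 𝒱)} {c c' : BiSym 𝒱} (r : K)
    (hX : X ∈ HomDeg (biGr 𝒱) (biGr 𝒱) i) (hc : c ∈ biGr 𝒱 (d + k))
    (hc' : c' ∈ biGr 𝒱 (d + (k + i))) : r • X c + c' ∈ biGr 𝒱 (i + d + k) := by
  refine Submodule.add_mem _ (Submodule.smul_mem _ _ ?_) ?_
  · have := hX _ _ hc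
    rwa [show d + k + i = i + d + k by ring] at this
  · rwa [show d + (k + i) = i + d + k by ring] at hc'

theorem psi₁_mem_homDeg (hR : R ∈ HomDeg (biGr 𝒱) 𝒱 k) :
    psi₁ R ∈ HomDeg (biGr 𝒱) (biGr 𝒱) k := by
  apply homDeg_biGr
  intro d c hc
  induction hc generalizing k R with
  | unit =>
    rw [psi₁_unit₂]
    exact Submodule.subset_span (by rw [add_comm]; exact .opL (apply_unit₂_mem hR) .unit)
  | opL hv _ ih =>
    rw [← Module.End.mul_apply, psi₁_mul_opL hR hv, LinearMap.add_apply, LinearMap.smul_apply,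
      Module.End.mul_apply]
    exact add_mem_biGr _ (opL_mem_homDeg hv) (ih hR) (ih (mem_homDeg_comp hR (opN_mem_homDeg hv)))
  | @opM i _ _ _ hv _ ih =>
    rw [← Module.End.mul_apply, psi₁_mul_opM hR hv, LinearMap.smul_apply,
      Module.End.mul_apply]
    have := add_mem_biGr ((-1 : K) ^ (k * i)) (opM_mem_homDeg hv) (ih hR) (Submodule.zero_mem _)
    rwa [add_zero] at this

theorem psi₂_mem_homDeg (hR : R ∈ HomDeg (biGr 𝒱) 𝒱 k) :
    psi₂ R ∈ HomDeg (biGr 𝒱) (biGr 𝒱) k := by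
  apply homDeg_biGr
  intro d c hc
  induction hc generalizing k R with
  | unit =>
    rw [psi₂_unit₂]
    exact Submodule.subset_span (by rw [add_comm]; exact .opM (apply_unit₂_mem hR) .unit)
  | opL hv _ ih =>
    rw [← Module.End.mul_apply, psi₂_mul_opL hR hv, LinearMap.add_apply, LinearMap.smul_apply,
      Module.End.mul_apply]
    exact add_mem_biGr _ (opL_mem_homDeg hv) (ih hR) (ih (mem_homDeg_comp hR (opL_mem_homDeg hv)))
  | opM hv _ ih =>
    rw [← Module.End.mul_apply, psi₂_mul_opM hR hv, LinearMap.add_apply, LinearMap.smul_apply,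
      Module.End.mul_apply]
    exact add_mem_biGr _ (opM_mem_homDeg hv) (ih hR) (ih (mem_homDeg_comp hR (opM_mem_homDeg hv)))

/-! ### The map `Ψ` takes values in coderivations -/

theorem primOp_unit₂ {w : V} (k : ℤ) (X Y : V →ₗ[K] Module.End K (BiSym 𝒱)) :
    primOp k (X w) (Y w) (unit₂ 𝒱 ⊗ₜ unit₂ 𝒱) =
      X w (unit₂ 𝒱) ⊗ₜ unit₂ 𝒱 + unit₂ 𝒱 ⊗ₜ Y w (unit₂ 𝒱) := by
  simp [primOp]

/-- The induction step shared by the coderivation identities: if `Γ D = (A ⊗ Id + Id ⊗ B) Γ` holds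
at `c`, and likewise for the graded commutators `D'`, `A'`, `B'`, then it holds at `Y c`. -/
theorem coder_step {Γ : BiSym 𝒱 →ₗ[K] BiSym 𝒱 ⊗[K] BiSym 𝒱} {c : BiSym 𝒱}
    {D D' A A' B B' X Y Y' : Module.End K (BiSym 𝒱)}
    (hΓ : ∀ c, Γ (Y c) = primOp i X Y' (Γ c))
    (hD : D * Y = (-1 : K) ^ (k * i) • (Y * D) + D')
    (hA : A * X = (-1 : K) ^ (k * i) • (X * A) + A')
    (hB : B * Y' = (-1 : K) ^ (k * i) • (Y' * B) + B')
    (hAs : A ∈ HomDeg (biGr 𝒱) (biGr 𝒱) k)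
    (hXs : X * sgnOp 𝒱 k = (-1 : K) ^ (i * k) • (sgnOp 𝒱 k * X))
    (hc : Γ (D c) = primOp k A B (Γ c)) (hc' : Γ (D' c) = primOp (k + i) A' B' (Γ c)) :
    Γ (D (Y c)) = primOp k A B (Γ (Y c)) := by
  rw [← Module.End.mul_apply, hD, LinearMap.add_apply, LinearMap.smul_apply, map_add, map_smul,
    Module.End.mul_apply, hΓ, hΓ, hc, hc', ← Module.End.mul_apply, ← Module.End.mul_apply,
    primOp_mul_primOp hA hB (homDeg_mul_sgnOp hAs i) hXs]
  rfl

theorem primOp_zero (k : ℤ) : primOp (𝒱 := 𝒱) k 0 0 = 0 := by simp [primOp]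

theorem coΔ_psi₁ (hR : R ∈ HomDeg (biGr 𝒱) 𝒱 k) (c : BiSym 𝒱) :
    coΔ 𝒱 (psi₁ R c) = primOp k (psi₁ R) (psi₁ R) (coΔ 𝒱 c) := by
  refine LinearMap.congr_fun (f := coΔ 𝒱 ∘ₗ psi₁ R) (g := primOp k (psi₁ R) (psi₁ R) ∘ₗ coΔ 𝒱)
    (bi_ext fun d c hc => ?_) c
  simp only [LinearMap.comp_apply]
  induction hc generalizing k R with
  | unit =>
    rw [psi₁_unit₂, coΔ_opL (apply_unit₂_mem hR), coΔ_unit₂, primOp_unit₂, primOp]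
    simp [psi₁_unit₂]
  | opL hv _ ih =>
    have h := psi₁_mul_opL hR hv
    exact coder_step (coΔ_opL hv) h h h (psi₁_mem_homDeg hR) (opL_sgnOp 𝒱 hv k) (ih hR)
      (ih (mem_homDeg_comp hR (opN_mem_homDeg hv)))
  | opM hv _ ih =>
    have h := (psi₁_mul_opM hR hv).trans (add_zero _).symm
    exact coder_step (coΔ_opM hv) h h h (psi₁_mem_homDeg hR) (opM_sgnOp 𝒱 hv k) (ih hR)
      (by rw [primOp_zero]; simp)

theorem coΔ_psi₂ (hR : R ∈ HomDeg (biGr 𝒱) 𝒱 k) (c : BiSym 𝒱) :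
    coΔ 𝒱 (psi₂ R c) = primOp k (psi₂ R) (psi₂ R) (coΔ 𝒱 c) := by
  refine LinearMap.congr_fun (f := coΔ 𝒱 ∘ₗ psi₂ R) (g := primOp k (psi₂ R) (psi₂ R) ∘ₗ coΔ 𝒱)
    (bi_ext fun d c hc => ?_) c
  simp only [LinearMap.comp_apply]
  induction hc generalizing k R with
  | unit =>
    rw [psi₂_unit₂, coΔ_opM (apply_unit₂_mem hR), coΔ_unit₂, primOp_unit₂, primOp]
    simp [psi₂_unit₂]
  | opL hv _ ih =>
    have h := psi₂_mul_opL hR hv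
    exact coder_step (coΔ_opL hv) h h h (psi₂_mem_homDeg hR) (opL_sgnOp 𝒱 hv k) (ih hR)
      (ih (mem_homDeg_comp hR (opL_mem_homDeg hv)))
  | opM hv _ ih =>
    have h := psi₂_mul_opM hR hv
    exact coder_step (coΔ_opM hv) h h h (psi₂_mem_homDeg hR) (opM_sgnOp 𝒱 hv k) (ih hR)
      (ih (mem_homDeg_comp hR (opM_mem_homDeg hv)))

theorem coδ_psi₂ (hR : R ∈ HomDeg (biGr 𝒱) 𝒱 k) (c : BiSym 𝒱) :
    coδ 𝒱 (psi₂ R c) = primOp k 0 (psi₂ R) (coδ 𝒱 c) := by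
  refine LinearMap.congr_fun (f := coδ 𝒱 ∘ₗ psi₂ R) (g := primOp k 0 (psi₂ R) ∘ₗ coδ 𝒱)
    (bi_ext fun d c hc => ?_) c
  simp only [LinearMap.comp_apply]
  induction hc generalizing k R with
  | unit =>
    rw [psi₂_unit₂, coδ_opM (apply_unit₂_mem hR), coδ_unit₂, primOp, primOp]
    simp [psi₂_unit₂]
  | opL hv _ ih =>
    have h := psi₂_mul_opL hR hv
    exact coder_step (coδ_opL hv) h (A' := 0) (by simp) h (Submodule.zero_mem _) (opN_sgnOp hv k)
      (ih hR) (ih (mem_homDeg_comp hR (opL_mem_homDeg hv)))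
  | opM hv _ ih =>
    have h := psi₂_mul_opM hR hv
    exact coder_step (coδ_opM hv) h (A' := 0) (by simp) h (Submodule.zero_mem _) (by simp)
      (ih hR) (ih (mem_homDeg_comp hR (opM_mem_homDeg hv)))

theorem psi_mul_opN (hR : R ∈ HomDeg (biGr 𝒱) 𝒱 k) (hv : v ∈ 𝒱 i) :
    (psi₁ R + psi₂ R) * opN 𝒱 v = (-1 : K) ^ (k * i) • (opN 𝒱 v * (psi₁ R + psi₂ R)) +
      (psi₁ (R ∘ₗ opN 𝒱 v) + psi₂ (R ∘ₗ opN 𝒱 v)) := by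
  have h : psi₂ (R ∘ₗ opN 𝒱 v) = psi₂ (R ∘ₗ opL 𝒱 v) + psi₂ (R ∘ₗ opM 𝒱 v) := by
    rw [opN_apply, LinearMap.comp_add, psi₂_add]
  rw [h, opN_apply, add_mul, mul_add, mul_add, psi₁_mul_opL hR hv, psi₁_mul_opM hR hv,
    psi₂_mul_opL hR hv, psi₂_mul_opM hR hv, opN_apply]
  simp only [add_mul, mul_add, smul_add]
  abel

theorem coδ_psi₁ (hR : R ∈ HomDeg (biGr 𝒱) 𝒱 k) (c : BiSym 𝒱) :
    coδ 𝒱 (psi₁ R c) = primOp k (psi₁ R + psi₂ R) (psi₁ R) (coδ 𝒱 c) := by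
  refine LinearMap.congr_fun (f := coδ 𝒱 ∘ₗ psi₁ R)
    (g := primOp k (psi₁ R + psi₂ R) (psi₁ R) ∘ₗ coδ 𝒱) (bi_ext fun d c hc => ?_) c
  simp only [LinearMap.comp_apply]
  induction hc generalizing k R with
  | unit =>
    rw [psi₁_unit₂, coδ_opL (apply_unit₂_mem hR), coδ_unit₂, primOp_unit₂, primOp]
    simp [psi₁_unit₂, psi₂_unit₂, opN_apply]
  | opL hv _ ih =>
    have h := psi₁_mul_opL hR hv
    exact coder_step (coδ_opL hv) h (psi_mul_opN hR hv) h
      (Submodule.add_mem _ (psi₁_mem_homDeg hR) (psi₂_mem_homDeg hR)) (opN_sgnOp hv k)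
      (ih hR) (ih (mem_homDeg_comp hR (opN_mem_homDeg hv)))
  | opM hv _ ih =>
    have h := (psi₁_mul_opM hR hv).trans (add_zero _).symm
    exact coder_step (coδ_opM hv) h (A' := 0) (by simp) h
      (Submodule.add_mem _ (psi₁_mem_homDeg hR) (psi₂_mem_homDeg hR)) (by simp)
      (ih hR) (by rw [primOp_zero]; simp)

/-- The map `Ψ` on all of `Sym(V) ⊗ Sym(V)`. -/
def psi (R : BiSym 𝒱 →ₗ[K] V) : Module.End K (BiSym 𝒱) := psi₁ R + psi₂ R

theorem psi_mem_homDeg (hR : R ∈ HomDeg (biGr 𝒱) 𝒱 k) :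
    psi R ∈ HomDeg (biGr 𝒱) (biGr 𝒱) k :=
  Submodule.add_mem _ (psi₁_mem_homDeg hR) (psi₂_mem_homDeg hR)

theorem coΔ_psi (hR : R ∈ HomDeg (biGr 𝒱) 𝒱 k) (c : BiSym 𝒱) :
    coΔ 𝒱 (psi R c) = primOp k (psi R) (psi R) (coΔ 𝒱 c) := by
  rw [psi, LinearMap.add_apply, map_add, coΔ_psi₁ hR, coΔ_psi₂ hR, ← LinearMap.add_apply]
  congr 1
  simp only [primOp, TensorProduct.map_add_left, TensorProduct.map_add_right]
  abel

theorem coδ_psi (hR : R ∈ HomDeg (biGr 𝒱) 𝒱 k) (c : BiSym 𝒱) :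
    coδ 𝒱 (psi R c) = primOp k (psi R) (psi R) (coδ 𝒱 c) := by
  rw [psi, LinearMap.add_apply, map_add, coδ_psi₁ hR, coδ_psi₂ hR, ← LinearMap.add_apply]
  congr 1
  simp only [primOp, TensorProduct.map_add_left, TensorProduct.map_add_right,
    TensorProduct.map_zero_left]
  abel

end

/-! ### Restriction to `Sym(V) ⊗ S̅ym(V)` -/

section

variable (𝒱 : ℤ → Submodule K V)

/-- The projection `Sym(V) ⊗ Sym(V) → Sym(V) ⊗ S̅ym(V)`. -/
def toTrias : BiSym 𝒱 →ₗ[K] Trias 𝒱 := (Sym.toBar 𝒱).lTensor (Sym 𝒱)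

/-- The inclusion `Sym(V) ⊗ S̅ym(V) → Sym(V) ⊗ Sym(V)`. -/
def ofTrias : Trias 𝒱 →ₗ[K] BiSym 𝒱 := (Sym.bar 𝒱).subtype.lTensor (Sym 𝒱)

/-- The idempotent `a ⊗ b ↦ ε(b) a ⊗ 1` with kernel `Sym(V) ⊗ S̅ym(V)`, where `ε` is the counit. -/
def zeroPart : Module.End K (BiSym 𝒱) :=
  (Algebra.linearMap K (Sym 𝒱) ∘ₗ (Sym.counit 𝒱).toLinearMap).lTensor (Sym 𝒱)

theorem toTrias_tmul (a b : Sym 𝒱) : toTrias 𝒱 (a ⊗ₜ b) = tm 𝒱 a b := rfl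

theorem zeroPart_tmul (a b : Sym 𝒱) :
    zeroPart 𝒱 (a ⊗ₜ b) = a ⊗ₜ algebraMap K (Sym 𝒱) (Sym.counit 𝒱 b) := rfl

variable {𝒱}

@[simp] theorem toTrias_ofTrias (t : Trias 𝒱) : toTrias 𝒱 (ofTrias 𝒱 t) = t := by
  induction t using TensorProduct.induction_on with
  | zero => simp
  | add t u ht hu => rw [map_add, map_add, ht, hu]
  | tmul a b => simp [toTrias, ofTrias]

theorem ofTrias_toTrias (c : BiSym 𝒱) : ofTrias 𝒱 (toTrias 𝒱 c) = c - zeroPart 𝒱 c := by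
  induction c using TensorProduct.induction_on with
  | zero => simp
  | add t u ht hu => rw [map_add, map_add, ht, hu, map_add]; abel
  | tmul a b =>
    rw [zeroPart_tmul, ← TensorProduct.tmul_sub, ← Sym.coe_toBar]; rfl

theorem ofTrias_tm {a b : Sym 𝒱} (hb : Sym.counit 𝒱 b = 0) : ofTrias 𝒱 (tm 𝒱 a b) = a ⊗ₜ b := by
  rw [← toTrias_tmul, ofTrias_toTrias, zeroPart_tmul, hb, map_zero, TensorProduct.tmul_zero,
    sub_zero]

theorem zeroPart_ofTrias (t : Trias 𝒱) : zeroPart 𝒱 (ofTrias 𝒱 t) = 0 := by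
  have h := ofTrias_toTrias (ofTrias 𝒱 t)
  rw [toTrias_ofTrias] at h
  exact sub_eq_self.1 h.symm

@[simp] theorem toTrias_zeroPart (c : BiSym 𝒱) : toTrias 𝒱 (zeroPart 𝒱 c) = 0 := by
  have h := congrArg (toTrias 𝒱) (ofTrias_toTrias c)
  rw [toTrias_ofTrias, map_sub] at h
  exact sub_eq_self.1 h.symm

@[simp] theorem zeroPart_unit₂ : zeroPart 𝒱 (unit₂ 𝒱) = unit₂ 𝒱 := by
  simp [unit₂, zeroPart_tmul]

theorem zeroPart_mul_opL (v : V) : zeroPart 𝒱 * opL 𝒱 v = opL 𝒱 v * zeroPart 𝒱 :=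
  TensorProduct.ext' fun _ _ => rfl

variable [DirectSum.Decomposition 𝒱]

theorem zeroPart_mul_opM (v : V) : zeroPart 𝒱 * opM 𝒱 v = 0 := by
  refine TensorProduct.ext' fun a b => ?_
  induction v using homogeneous_induction (𝒱 := 𝒱) with
  | h i v hv => simp [opM_tmul 𝒱 hv, zeroPart_tmul]
  | hadd v w hv hw =>
    rw [map_add, mul_add, LinearMap.add_apply, hv, hw, LinearMap.zero_apply, add_zero]

theorem zeroPart_mul_sgnOp (k : ℤ) : zeroPart 𝒱 * sgnOp 𝒱 k = sgnOp 𝒱 k * zeroPart 𝒱 := by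
  refine TensorProduct.ext' fun a b => ?_
  simp [zeroPart_tmul, Sym.counit_sign]

theorem toTrias_sgnOp (k : ℤ) (c : BiSym 𝒱) :
    toTrias 𝒱 (sgnOp 𝒱 k c) = triasSign 𝒱 k (toTrias 𝒱 c) := by
  induction c using TensorProduct.induction_on with
  | zero => simp
  | add t u ht hu => rw [map_add, map_add, ht, hu, map_add, map_add]
  | tmul a b =>
    rw [sgnOp_tmul]
    change _ ⊗ₜ[K] Sym.toBar 𝒱 (Sym.sign 𝒱 k b) = _ ⊗ₜ[K] Sym.signBar 𝒱 k (Sym.toBar 𝒱 b)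
    congr 1
    apply Subtype.ext
    change _ = Sym.sign 𝒱 k (Sym.toBar 𝒱 b)
    rw [Sym.coe_toBar, Sym.coe_toBar, Sym.counit_sign, map_sub, AlgHom.commutes]

theorem coδ_zeroPart (c : BiSym 𝒱) :
    coδ 𝒱 (zeroPart 𝒱 c) = TensorProduct.map 1 (zeroPart 𝒱) (coδ 𝒱 c) := by
  refine LinearMap.congr_fun (f := coδ 𝒱 ∘ₗ zeroPart 𝒱)
    (g := TensorProduct.map 1 (zeroPart 𝒱) ∘ₗ coδ 𝒱)
    (bi_ext' ?_ (fun i v hv c hc => ?_) (fun i v hv c hc => ?_)) c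
  · simp [coδ_unit₂]
  · simp only [LinearMap.comp_apply] at hc ⊢
    rw [← Module.End.mul_apply, zeroPart_mul_opL, Module.End.mul_apply, coδ_opL hv, coδ_opL hv, hc,
      ← Module.End.mul_apply, ← Module.End.mul_apply]
    simp only [primOp, add_mul, mul_add, ← TensorProduct.map_mul, zeroPart_mul_opL, one_mul,
      mul_one]
  · simp only [LinearMap.comp_apply] at hc ⊢
    rw [← Module.End.mul_apply, zeroPart_mul_opM, coδ_opM hv, ← Module.End.mul_apply]
    simp only [primOp, mul_add, ← TensorProduct.map_mul, zeroPart_mul_opM]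
    simp

theorem coΔ_zeroPart (c : BiSym 𝒱) :
    coΔ 𝒱 (zeroPart 𝒱 c) = TensorProduct.map (zeroPart 𝒱) (zeroPart 𝒱) (coΔ 𝒱 c) := by
  refine LinearMap.congr_fun (f := coΔ 𝒱 ∘ₗ zeroPart 𝒱)
    (g := TensorProduct.map (zeroPart 𝒱) (zeroPart 𝒱) ∘ₗ coΔ 𝒱)
    (bi_ext' ?_ (fun i v hv c hc => ?_) (fun i v hv c hc => ?_)) c
  · simp [coΔ_unit₂]
  · simp only [LinearMap.comp_apply] at hc ⊢
    rw [← Module.End.mul_apply, zeroPart_mul_opL, Module.End.mul_apply, coΔ_opL hv, coΔ_opL hv, hc,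
      ← Module.End.mul_apply, ← Module.End.mul_apply]
    simp only [primOp, add_mul, mul_add, ← TensorProduct.map_mul, zeroPart_mul_opL,
      zeroPart_mul_sgnOp, one_mul, mul_one]
  · simp only [LinearMap.comp_apply] at hc ⊢
    rw [← Module.End.mul_apply, zeroPart_mul_opM, coΔ_opM hv, ← Module.End.mul_apply]
    simp only [primOp, mul_add, ← TensorProduct.map_mul, zeroPart_mul_opM]
    simp

theorem psi₁_zeroPart (R : BiSym 𝒱 →ₗ[K] V) (c : BiSym 𝒱) :
    psi₁ R (zeroPart 𝒱 c) = zeroPart 𝒱 (psi₁ R c) := by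
  have h : TensorProduct.lift (opL 𝒱) ∘ₗ R.rTensor _ ∘ₗ TensorProduct.map 1 (zeroPart 𝒱) =
      zeroPart 𝒱 ∘ₗ TensorProduct.lift (opL 𝒱) ∘ₗ R.rTensor _ :=
    TensorProduct.ext' fun c c' =>
      (LinearMap.congr_fun (zeroPart_mul_opL (𝒱 := 𝒱) (R c)) c').symm
  have h' := LinearMap.congr_fun h (coδ 𝒱 c)
  simp only [LinearMap.comp_apply, ← coδ_zeroPart] at h'
  exact h'

theorem psi₂_zeroPart (R : Trias 𝒱 →ₗ[K] V) (c : BiSym 𝒱) :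
    psi₂ (R ∘ₗ toTrias 𝒱) (zeroPart 𝒱 c) = 0 := by
  have h : TensorProduct.lift (opM 𝒱) ∘ₗ (R ∘ₗ toTrias 𝒱).rTensor _ ∘ₗ
      TensorProduct.map (zeroPart 𝒱) (zeroPart 𝒱) = 0 :=
    TensorProduct.ext' fun c c' => by simp
  have h' := LinearMap.congr_fun h (coΔ 𝒱 c)
  simp only [LinearMap.comp_apply, ← coΔ_zeroPart] at h'
  exact h'

theorem zeroPart_psi₂ (R : BiSym 𝒱 →ₗ[K] V) (c : BiSym 𝒱) : zeroPart 𝒱 (psi₂ R c) = 0 := by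
  have h : zeroPart 𝒱 ∘ₗ TensorProduct.lift (opM 𝒱) = 0 :=
    TensorProduct.ext' fun w c => LinearMap.congr_fun (zeroPart_mul_opM (𝒱 := 𝒱) w) c
  exact LinearMap.congr_fun h _

variable (𝒱) in
/-- The coproduct `Δ` on `Sym(V) ⊗ S̅ym(V)`. -/
def triasΔ : Trias 𝒱 →ₗ[K] Trias 𝒱 ⊗[K] Trias 𝒱 :=
  TensorProduct.map (toTrias 𝒱) (toTrias 𝒱) ∘ₗ coΔ 𝒱 ∘ₗ ofTrias 𝒱

variable (𝒱) in
/-- The coproduct `δ` on `Sym(V) ⊗ S̅ym(V)`. -/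
def triasδ : Trias 𝒱 →ₗ[K] Trias 𝒱 ⊗[K] Trias 𝒱 :=
  TensorProduct.map (toTrias 𝒱) (toTrias 𝒱) ∘ₗ coδ 𝒱 ∘ₗ ofTrias 𝒱

/-- The map `Ψ`. -/
def hat (R : Trias 𝒱 →ₗ[K] V) : Trias 𝒱 →ₗ[K] Trias 𝒱 :=
  toTrias 𝒱 ∘ₗ psi (R ∘ₗ toTrias 𝒱) ∘ₗ ofTrias 𝒱

theorem hat_toTrias (R : Trias 𝒱 →ₗ[K] V) (c : BiSym 𝒱) :
    hat R (toTrias 𝒱 c) = toTrias 𝒱 (psi (R ∘ₗ toTrias 𝒱) c) := by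
  rw [hat, LinearMap.comp_apply, LinearMap.comp_apply, ofTrias_toTrias, map_sub, map_sub,
    sub_eq_self, psi, LinearMap.add_apply, psi₁_zeroPart, psi₂_zeroPart, add_zero,
    toTrias_zeroPart]

theorem ofTrias_hat (R : Trias 𝒱 →ₗ[K] V) (t : Trias 𝒱) :
    ofTrias 𝒱 (hat R t) = psi (R ∘ₗ toTrias 𝒱) (ofTrias 𝒱 t) := by
  rw [hat, LinearMap.comp_apply, LinearMap.comp_apply, ofTrias_toTrias, sub_eq_self, psi,
    LinearMap.add_apply, map_add, ← psi₁_zeroPart, zeroPart_psi₂, zeroPart_ofTrias, map_zero,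
    add_zero]

theorem hat_add (R S : Trias 𝒱 →ₗ[K] V) : hat (R + S) = hat R + hat S := by
  simp only [hat, psi, LinearMap.add_comp, LinearMap.comp_add, psi₁_add, psi₂_add]
  abel

theorem hat_smul (r : K) (R : Trias 𝒱 →ₗ[K] V) : hat (r • R) = r • hat R := by
  simp only [hat, psi, LinearMap.smul_comp, LinearMap.comp_smul, psi₁_smul, psi₂_smul, ← smul_add]

theorem leibniz_toTrias {k : ℤ} {R : Trias 𝒱 →ₗ[K] V} (t : BiSym 𝒱 ⊗[K] BiSym 𝒱) :
    leibniz 𝒱 k (hat R) (TensorProduct.map (toTrias 𝒱) (toTrias 𝒱) t) =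
      TensorProduct.map (toTrias 𝒱) (toTrias 𝒱)
        (primOp k (psi (R ∘ₗ toTrias 𝒱)) (psi (R ∘ₗ toTrias 𝒱)) t) := by
  induction t using TensorProduct.induction_on with
  | zero => simp
  | add t u ht hu => simp only [map_add, ht, hu]
  | tmul c c' => simp [leibniz, primOp, hat_toTrias, toTrias_sgnOp]

end

/-! ### Monomials in homogeneous elements -/

section

variable (𝒱 : ℤ → Submodule K V)

theorem Sym.block_full {n : ℕ} (x : Fin n → V) :
    Sym.block 𝒱 x 0 n = ((List.ofFn x).map (Sym.ι 𝒱)).prod := by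
  rw [Sym.block, List.drop_zero, List.take_of_length_le (by simp)]

@[simp] theorem Sym.block_zero (x : Fin 0 → V) : Sym.block 𝒱 x 0 0 = 1 := by
  simp [Sym.block]

theorem Sym.block_cons {n : ℕ} (v : V) (x : Fin n → V) :
    Sym.block 𝒱 (Fin.cons v x : Fin (n + 1) → V) 0 (n + 1) = Sym.ι 𝒱 v * Sym.block 𝒱 x 0 n := by
  rw [Sym.block_full, Sym.block_full, List.ofFn_succ]
  simp

theorem Sym.counit_block {m : ℕ} (hm : 1 ≤ m) (y : Fin m → V) :
    Sym.counit 𝒱 (Sym.block 𝒱 y 0 m) = 0 := by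
  obtain ⟨m, rfl⟩ := Nat.exists_eq_add_of_le' hm
  rw [← Fin.cons_self_tail y, Sym.block_cons, map_mul, Sym.counit_ι, zero_mul]

variable {𝒱}

theorem ofTrias_mono {n m : ℕ} (hm : 1 ≤ m) (x : Fin n → V) (y : Fin m → V) :
    ofTrias 𝒱 (mono 𝒱 x y) = Sym.block 𝒱 x 0 n ⊗ₜ Sym.block 𝒱 y 0 m :=
  ofTrias_tm (Sym.counit_block 𝒱 hm y)

variable [DirectSum.Decomposition 𝒱]

theorem Sym.sign_block {n : ℕ} {x : Fin n → V} {a : Fin n → ℤ} (hx : ∀ i, x i ∈ 𝒱 (a i)) (k : ℤ) :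
    Sym.sign 𝒱 k (Sym.block 𝒱 x 0 n) = (-1 : K) ^ (k * ∑ i, a i) • Sym.block 𝒱 x 0 n := by
  induction n with
  | zero => simp
  | succ n ih =>
    have h := ih (x := Fin.tail x) (a := Fin.tail a) fun i => hx i.succ
    rw [← Fin.cons_self_tail x, Sym.block_cons, map_mul, h, Sym.sign_ι 𝒱 k (hx 0),
      Fin.sum_univ_succ, mul_add, sgn_add, smul_mul_smul_comm]
    rfl

theorem word_block {n m : ℕ} {x : Fin n → V} {y : Fin m → V} {a : Fin n → ℤ} {b : Fin m → ℤ}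
    (hx : ∀ i, x i ∈ 𝒱 (a i)) (hy : ∀ i, y i ∈ 𝒱 (b i)) :
    Word 𝒱 (∑ i, a i + ∑ i, b i) (Sym.block 𝒱 x 0 n ⊗ₜ Sym.block 𝒱 y 0 m) := by
  induction n with
  | zero =>
    induction m with
    | zero => simpa [unit₂] using Word.unit (𝒱 := 𝒱)
    | succ m ih =>
      have h := ih (y := Fin.tail y) (b := Fin.tail b) fun i => hy i.succ
      rw [← Fin.cons_self_tail y, Sym.block_cons, Sym.block_zero, ← opM_one_tmul 𝒱,
        Fin.sum_univ_succ b, add_left_comm]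
      rw [Sym.block_zero] at h
      exact .opM (hy 0) h
  | succ n ih =>
    have h := ih (x := Fin.tail x) (a := Fin.tail a) fun i => hx i.succ
    rw [← Fin.cons_self_tail x, Sym.block_cons, ← opL_tmul, Fin.sum_univ_succ a, add_assoc]
    exact .opL (hx 0) h

/-- A word is, up to a scalar, a product of homogeneous elements in each of the two factors. -/
theorem Word.exists_block {d : ℤ} {c : BiSym 𝒱} (hc : Word 𝒱 d c) :
    ∃ (r : K) (n m : ℕ) (x : Fin n → V) (y : Fin m → V) (a : Fin n → ℤ) (b : Fin m → ℤ),
      (∀ i, x i ∈ 𝒱 (a i)) ∧ (∀ i, y i ∈ 𝒱 (b i)) ∧ ∑ i, a i + ∑ i, b i = d ∧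
        c = r • (Sym.block 𝒱 x 0 n ⊗ₜ Sym.block 𝒱 y 0 m) := by
  have hcons : ∀ {n : ℕ} {i : ℤ} {v : V} {x : Fin n → V} {a : Fin n → ℤ}, v ∈ 𝒱 i →
      (∀ j, x j ∈ 𝒱 (a j)) →
      ∀ j, (Fin.cons v x : Fin (n + 1) → V) j ∈ 𝒱 ((Fin.cons i a : Fin (n + 1) → ℤ) j) := by
    intro n i v x a hv hx j
    cases j using Fin.cases with
    | zero => exact hv
    | succ j => exact hx j
  induction hc with
  | unit =>
    refine ⟨1, 0, 0, 0, 0, 0, 0, fun i => i.elim0, fun i => i.elim0, by simp, ?_⟩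
    rw [Sym.block_zero, one_smul]; rfl
  | @opL i d v c hv _ ih =>
    obtain ⟨r, n, m, x, y, a, b, hx, hy, rfl, rfl⟩ := ih
    refine ⟨r, n + 1, m, Fin.cons v x, y, Fin.cons i a, b, hcons hv hx, hy, ?_, ?_⟩
    · rw [Fin.sum_cons, add_assoc]
    · rw [map_smul, opL_tmul, Sym.block_cons]
  | @opM i d v c hv _ ih =>
    obtain ⟨r, n, m, x, y, a, b, hx, hy, rfl, rfl⟩ := ih
    refine ⟨r * (-1) ^ (i * ∑ j, a j), n, m + 1, x, Fin.cons v y, a, Fin.cons i b, hx,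
      hcons hv hy, ?_, ?_⟩
    · rw [Fin.sum_cons, add_left_comm]
    · rw [map_smul, opM_tmul 𝒱 hv, Sym.sign_block hx, Sym.block_cons, mul_smul,
        ← TensorProduct.smul_tmul']

theorem toTrias_mem_triasGr {d : ℤ} {c : BiSym 𝒱} (hc : c ∈ biGr 𝒱 d) :
    toTrias 𝒱 c ∈ triasGr 𝒱 d := by
  have h : biGr 𝒱 d ≤ (triasGr 𝒱 d).comap (toTrias 𝒱) := by
    refine Submodule.span_le.2 fun c hc => ?_
    obtain ⟨r, n, m, x, y, a, b, hx, hy, hd, rfl⟩ := hc.exists_block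
    rw [SetLike.mem_coe, Submodule.mem_comap, map_smul]
    refine Submodule.smul_mem _ _ ?_
    rcases Nat.eq_zero_or_pos m with rfl | hm
    · rw [Sym.block_zero, toTrias_tmul, tm, Sym.toBar_one, TensorProduct.tmul_zero]
      exact Submodule.zero_mem _
    · exact Submodule.subset_span ⟨n, m, x, y, a, b, hm, hx, hy, hd, rfl⟩
  exact h hc

theorem ofTrias_mem_biGr {d : ℤ} {t : Trias 𝒱} (ht : t ∈ triasGr 𝒱 d) :
    ofTrias 𝒱 t ∈ biGr 𝒱 d := by
  have h : triasGr 𝒱 d ≤ (biGr 𝒱 d).comap (ofTrias 𝒱) := by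
    refine Submodule.span_le.2 ?_
    rintro _ ⟨n, m, x, y, a, b, hm, hx, hy, rfl, rfl⟩
    rw [SetLike.mem_coe, Submodule.mem_comap, ofTrias_mono hm]
    exact Submodule.subset_span (word_block hx hy)
  exact h ht

/-- A linear map on `Sym(V) ⊗ S̅ym(V)` is determined by its values on the monomials
`x₁ ⋯ xₙ ⊗ y₁ ⋯ yₘ`, `m ≥ 1`, in homogeneous elements. -/
theorem trias_ext {W : Type*} [AddCommGroup W] [Module K W] {f g : Trias 𝒱 →ₗ[K] W}
    (h : ForAllHomogeneous 𝒱 fun x y _ _ => f (mono 𝒱 x y) = g (mono 𝒱 x y)) : f = g := by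
  have h' : f ∘ₗ toTrias 𝒱 = g ∘ₗ toTrias 𝒱 := by
    apply bi_ext
    intro d c hc
    obtain ⟨r, n, m, x, y, a, b, hx, hy, hd, rfl⟩ := hc.exists_block
    rw [map_smul, map_smul, LinearMap.comp_apply, LinearMap.comp_apply, toTrias_tmul]
    rcases Nat.eq_zero_or_pos m with rfl | hm
    · rw [Sym.block_zero, tm, Sym.toBar_one, TensorProduct.tmul_zero, map_zero, map_zero]
    · exact congrArg (r • ·) (h n m x y a b hm hx hy)
  refine LinearMap.ext fun t => ?_
  have := LinearMap.congr_fun h' (ofTrias 𝒱 t)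
  simpa using this

theorem toTrias_homDeg : toTrias 𝒱 ∈ HomDeg (biGr 𝒱) (triasGr 𝒱) 0 := fun d c hc => by
  rw [add_zero]; exact toTrias_mem_triasGr hc

theorem ofTrias_homDeg : ofTrias 𝒱 ∈ HomDeg (triasGr 𝒱) (biGr 𝒱) 0 := fun d c hc => by
  rw [add_zero]; exact ofTrias_mem_biGr hc

theorem comp_toTrias_homDeg {k : ℤ} {R : Trias 𝒱 →ₗ[K] V} (hR : R ∈ PLHom 𝒱 k) :
    R ∘ₗ toTrias 𝒱 ∈ HomDeg (biGr 𝒱) 𝒱 k := by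
  have := mem_homDeg_comp hR toTrias_homDeg
  rwa [add_zero] at this

theorem hat_homDeg {k : ℤ} {R : Trias 𝒱 →ₗ[K] V} (hR : R ∈ PLHom 𝒱 k) :
    hat R ∈ HomDeg (triasGr 𝒱) (triasGr 𝒱) k := by
  have := mem_homDeg_comp toTrias_homDeg
    (mem_homDeg_comp (psi_mem_homDeg (comp_toTrias_homDeg hR)) ofTrias_homDeg)
  rwa [add_zero, zero_add] at this

/-- `Ψ(R)` is a coderivation. -/
theorem hat_mem_coDer {k : ℤ} {R : Trias 𝒱 →ₗ[K] V} (hR : R ∈ PLHom 𝒱 k) :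
    hat R ∈ coDer 𝒱 (triasΔ 𝒱) (triasδ 𝒱) k := by
  refine ⟨hat_homDeg hR, LinearMap.ext fun t => ?_, LinearMap.ext fun t => ?_⟩
  · simp only [LinearMap.comp_apply, triasΔ]
    rw [ofTrias_hat, coΔ_psi (comp_toTrias_homDeg hR), leibniz_toTrias]
  · simp only [LinearMap.comp_apply, triasδ]
    rw [ofTrias_hat, coδ_psi (comp_toTrias_homDeg hR), leibniz_toTrias]

end

/-! ### Shuffles and colourings -/

section Shuffles

variable {n r : ℕ}

/-- The shuffles attached to a monotone colouring `κ` of the positions: the permutations that are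
increasing on each of the blocks on which `κ` is constant. -/
def shufflesOf (κ : Fin n → Fin r) : Finset (Equiv.Perm (Fin n)) :=
  Finset.univ.filter fun σ => ∀ a b : Fin n, a < b → κ a = κ b → σ a < σ b

/-- Shuffles correspond to colourings `c` of the entries: `c` colours each entry by the block in
which the shuffle places it, and the shuffle is recovered as the stable sorting permutation
of `c`. -/
theorem sum_shufflesOf {M : Type*} [AddCommMonoid M] {κ : Fin n → Fin r} (hκ : Monotone κ)
    (F : Equiv.Perm (Fin n) → M) :
    ∑ σ ∈ shufflesOf κ, F σ =
      ∑ c ∈ Finset.univ.filter (fun c : Fin n → Fin r => c ∘ Tuple.sort c = κ),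
        F (Tuple.sort c) := by
  have key : ∀ σ ∈ shufflesOf κ, σ = Tuple.sort (κ ∘ σ.symm) := by
    intro σ hσ
    rw [Tuple.eq_sort_iff]
    have h : (κ ∘ σ.symm) ∘ σ = κ := by ext; simp
    rw [h]
    refine ⟨hκ, fun i j hij he => (Finset.mem_filter.1 hσ).2 i j hij ?_⟩
    simpa using he
  refine Finset.sum_bij' (fun σ _ => κ ∘ σ.symm) (fun c _ => Tuple.sort c) ?_ ?_ ?_ ?_ ?_
  · intro σ hσ
    rw [Finset.mem_filter, ← key σ hσ]
    exact ⟨Finset.mem_univ _, by ext; simp⟩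
  · intro c hc
    have hc := (Finset.mem_filter.1 hc).2
    have h := Tuple.eq_sort_iff.1 (rfl : Tuple.sort c = Tuple.sort c)
    refine Finset.mem_filter.2 ⟨Finset.mem_univ _, fun a b hab he => h.2 a b hab ?_⟩
    rw [← hc] at he
    exact he
  · intro σ hσ
    exact (key σ hσ).symm
  · intro c hc
    rw [← (Finset.mem_filter.1 hc).2]
    ext; simp
  · intro σ hσ
    rw [← key σ hσ]

/-- A sum over all shuffles of all shapes is a sum over all colourings. -/
theorem sum_shufflesOf_eq_sum {M ι : Type*} [AddCommMonoid M] {I : Finset ι}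
    {κ : ι → Fin n → Fin r} (hκ : ∀ i ∈ I, Monotone (κ i))
    (h : ∀ μ : Fin n → Fin r, Monotone μ → ∃! i, i ∈ I ∧ κ i = μ)
    {F : ι → Equiv.Perm (Fin n) → M} {G : (Fin n → Fin r) → M}
    (hFG : ∀ i ∈ I, ∀ c : Fin n → Fin r, c ∘ Tuple.sort c = κ i → F i (Tuple.sort c) = G c) :
    ∑ i ∈ I, ∑ σ ∈ shufflesOf (κ i), F i σ = ∑ c, G c := by
  classical
  have h1 : ∀ i ∈ I, ∑ σ ∈ shufflesOf (κ i), F i σ =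
      ∑ c : Fin n → Fin r, if c ∘ Tuple.sort c = κ i then G c else 0 := by
    intro i hi
    rw [sum_shufflesOf (hκ i hi), Finset.sum_filter]
    refine Finset.sum_congr rfl fun c _ => ?_
    split_ifs with hc
    · exact hFG i hi c hc
    · rfl
  rw [Finset.sum_congr rfl h1, Finset.sum_comm]
  refine Finset.sum_congr rfl fun c _ => ?_
  obtain ⟨i, ⟨hi, hci⟩, huniq⟩ := h _ (Tuple.monotone_sort c)
  rw [Finset.sum_eq_single_of_mem i hi, if_pos hci.symm]
  intro j hj hji
  rw [if_neg]
  exact fun hcj => hji (huniq j ⟨hj, hcj.symm⟩)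

/-- The colouring of the positions `1, …, n` by two consecutive blocks, the first of length `i`. -/
def blocks₂ (n i : ℕ) (a : Fin n) : Fin 2 := if (a : ℕ) < i then 0 else 1

/-- The colouring of the positions `1, …, n` by three consecutive blocks, the first two of lengths
`i` and `j`. -/
def blocks₃ (n i j : ℕ) (a : Fin n) : Fin 3 :=
  if (a : ℕ) < i then 0 else if (a : ℕ) < i + j then 1 else 2

theorem shuffles₂_eq (n i : ℕ) : shuffles₂ n i = shufflesOf (blocks₂ n i) := by
  ext σ
  simp only [shuffles₂, shufflesOf, Finset.mem_filter, Finset.mem_univ, true_and]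
  refine forall₃_congr fun a b hab => imp_congr ?_ Iff.rfl
  have : (a : ℕ) < b := hab
  unfold blocks₂
  split_ifs <;> simp <;> omega

theorem shuffles₃_eq (n i j : ℕ) : shuffles₃ n i j = shufflesOf (blocks₃ n i j) := by
  ext σ
  simp only [shuffles₃, shufflesOf, Finset.mem_filter, Finset.mem_univ, true_and]
  refine forall₃_congr fun a b hab => imp_congr ?_ Iff.rfl
  have : (a : ℕ) < b := hab
  unfold blocks₃
  split_ifs <;> simp <;> omega

theorem monotone_blocks₂ (n i : ℕ) : Monotone (blocks₂ n i) := by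
  intro a b hab
  have : (a : ℕ) ≤ b := hab
  unfold blocks₂
  split_ifs <;> omega

theorem monotone_blocks₃ (n i j : ℕ) : Monotone (blocks₃ n i j) := by
  intro a b hab
  have : (a : ℕ) ≤ b := hab
  unfold blocks₃
  split_ifs <;> omega

/-- Two initial segments of `Fin n` with the same elements have the same length. -/
theorem eq_of_forall_lt_iff {i j : ℕ} (hi : i ≤ n) (hj : j ≤ n)
    (h : ∀ a : Fin n, (a : ℕ) < i ↔ (a : ℕ) < j) : i = j := by
  rcases lt_trichotomy i j with hij | hij | hij
  · have := h ⟨i, by omega⟩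
    simp at this; omega
  · exact hij
  · have := h ⟨j, by omega⟩
    simp at this; omega

theorem blocks₂_eq_zero_iff (i : ℕ) (a : Fin n) : blocks₂ n i a = 0 ↔ (a : ℕ) < i := by
  unfold blocks₂; split_ifs <;> simp <;> omega

theorem blocks₂_eq_one_iff (i : ℕ) (a : Fin n) : blocks₂ n i a = 1 ↔ i ≤ (a : ℕ) := by
  unfold blocks₂; split_ifs <;> simp <;> omega

theorem blocks₃_eq_zero_iff (i j : ℕ) (a : Fin n) : blocks₃ n i j a = 0 ↔ (a : ℕ) < i := by
  unfold blocks₃; split_ifs <;> simp <;> omega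

theorem blocks₃_eq_one_iff (i j : ℕ) (a : Fin n) :
    blocks₃ n i j a = 1 ↔ i ≤ (a : ℕ) ∧ (a : ℕ) < i + j := by
  unfold blocks₃; split_ifs <;> simp <;> omega

theorem blocks₃_eq_two_iff (i j : ℕ) (a : Fin n) : blocks₃ n i j a = 2 ↔ i + j ≤ (a : ℕ) := by
  unfold blocks₃; split_ifs <;> simp <;> omega

theorem existsUnique_blocks₂ (μ : Fin n → Fin 2) (hμ : Monotone μ) :
    ∃! i, i ∈ Finset.range (n + 1) ∧ blocks₂ n i = μ := by
  refine ⟨(Finset.univ.filter fun a => μ a < 1).card, ⟨?_, ?_⟩, ?_⟩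
  · have := Finset.card_le_univ (Finset.univ.filter fun a => μ a < 1)
    rw [Fintype.card_fin] at this
    exact Finset.mem_range.2 (by omega)
  · ext a
    have h := Tuple.lt_card_lt_iff_apply_lt_of_monotone (j := a) (a := 1) hμ
    rw [blocks₂]
    split_ifs with h' <;> rw [h] at h' <;>
      simp only [Fin.lt_def, Fin.val_zero, Fin.val_one] at * <;>
      omega
  · rintro j ⟨hj, rfl⟩
    refine eq_of_forall_lt_iff (n := n) (Nat.lt_succ_iff.1 (Finset.mem_range.1 hj)) ?_ fun a => ?_
    · simpa using Finset.card_le_univ (Finset.univ.filter fun a => blocks₂ n j a < 1)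
    · rw [Tuple.lt_card_lt_iff_apply_lt_of_monotone hμ, Fin.lt_one_iff, blocks₂_eq_zero_iff]

theorem existsUnique_blocks₃ (μ : Fin n → Fin 3) (hμ : Monotone μ) :
    ∃! ij : Σ _ : ℕ, ℕ, ij ∈ (Finset.range (n + 1)).sigma (fun i => Finset.range (n - i + 1)) ∧
      blocks₃ n ij.1 ij.2 = μ := by
  have h1 := fun a => Tuple.lt_card_lt_iff_apply_lt_of_monotone (j := a) (a := 1) hμ
  have h2 := fun a => Tuple.lt_card_lt_iff_apply_lt_of_monotone (j := a) (a := 2) hμ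
  have hle1 : (Finset.univ.filter fun a => μ a < 1).card ≤ n := by
    simpa using Finset.card_le_univ (Finset.univ.filter fun a => μ a < 1)
  have hle2 : (Finset.univ.filter fun a => μ a < 2).card ≤ n := by
    simpa using Finset.card_le_univ (Finset.univ.filter fun a => μ a < 2)
  have hle : (Finset.univ.filter fun a => μ a < 1).card ≤
      (Finset.univ.filter fun a => μ a < 2).card :=
    Finset.card_le_card (Finset.monotone_filter_right _ fun a _ h => h.trans (by decide))
  set p := (Finset.univ.filter fun a => μ a < 1).card
  set q := (Finset.univ.filter fun a => μ a < 2).card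
  refine ⟨⟨p, q - p⟩, ⟨?_, ?_⟩, ?_⟩
  · simp only [Finset.mem_sigma, Finset.mem_range]; omega
  · ext a
    have h1 := h1 a
    have h2 := h2 a
    dsimp only
    rw [blocks₃, Nat.add_sub_cancel' hle]
    split_ifs with h h' <;> simp only [Fin.lt_def] at * <;>
      simp only [Fin.val_zero, Fin.val_one, Fin.val_two] at * <;> omega
  · rintro ⟨i, j⟩ ⟨hij, rfl⟩
    simp only [Finset.mem_sigma, Finset.mem_range] at hij
    have e1 : i = p := eq_of_forall_lt_iff (n := n) (by omega) hle1 fun a => by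
      rw [h1, ← blocks₃_eq_zero_iff i j]
      simp only [Fin.lt_def, Fin.ext_iff, Fin.val_zero, Fin.val_one]; omega
    have e2 : i + j = q := eq_of_forall_lt_iff (n := n) (by omega) hle2 fun a => by
      have := blocks₃_eq_two_iff i j a
      rw [h2]
      simp only [Fin.lt_def, Fin.ext_iff, Fin.val_two] at *; omega
    have e3 : j = q - p := by omega
    exact Sigma.ext e1 (heq_of_eq e3)

theorem sum_shuffles₂ {M : Type*} [AddCommMonoid M] {F : ℕ → Equiv.Perm (Fin n) → M}
    {G : (Fin n → Fin 2) → M}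
    (hFG : ∀ i ≤ n, ∀ c : Fin n → Fin 2, c ∘ Tuple.sort c = blocks₂ n i →
      F i (Tuple.sort c) = G c) :
    ∑ i ∈ Finset.range (n + 1), ∑ σ ∈ shuffles₂ n i, F i σ = ∑ c, G c := by
  simp only [shuffles₂_eq]
  exact sum_shufflesOf_eq_sum (fun i _ => monotone_blocks₂ n i) existsUnique_blocks₂
    fun i hi => hFG i (Nat.lt_succ_iff.1 (Finset.mem_range.1 hi))

theorem sum_shuffles₃ {M : Type*} [AddCommMonoid M] {F : ℕ → ℕ → Equiv.Perm (Fin n) → M}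
    {G : (Fin n → Fin 3) → M}
    (hFG : ∀ i j, i + j ≤ n → ∀ c : Fin n → Fin 3, c ∘ Tuple.sort c = blocks₃ n i j →
      F i j (Tuple.sort c) = G c) :
    ∑ i ∈ Finset.range (n + 1), ∑ j ∈ Finset.range (n - i + 1), ∑ σ ∈ shuffles₃ n i j, F i j σ =
      ∑ c, G c := by
  simp only [shuffles₃_eq]
  rw [Finset.sum_sigma']
  refine sum_shufflesOf_eq_sum (κ := fun ij : Σ _ : ℕ, ℕ => blocks₃ n ij.1 ij.2)
    (F := fun ij : Σ _ : ℕ, ℕ => F ij.1 ij.2) (fun ij _ => monotone_blocks₃ n _ _)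
    existsUnique_blocks₃
    fun ij hij => hFG ij.1 ij.2 ?_
  simp only [Finset.mem_sigma, Finset.mem_range] at hij
  omega

/-- The sum over all colourings of `n + 1` entries, organised by the colour of the first one. -/
theorem sum_colourings_succ {M : Type*} [AddCommMonoid M] (G : (Fin (n + 1) → Fin r) → M) :
    ∑ c, G c = ∑ j, ∑ c : Fin n → Fin r, G (Fin.cons j c) := by
  rw [← Fintype.sum_prod_type', ← (Fin.consEquiv fun _ : Fin (n + 1) => Fin r).sum_comp]
  rfl

/-- The Koszul sign of the stable sorting of `n` entries of degrees `d₁, …, dₙ` by their colours. -/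
def colourSign (K : Type*) [Field K] (d : Fin n → ℤ) (c : Fin n → Fin r) : K :=
  ∏ a, ∏ b, if a < b ∧ c b < c a then (-1 : K) ^ (d a * d b) else 1

/-- The total degree of the entries of colour `j`. -/
def colourDeg (d : Fin n → ℤ) (c : Fin n → Fin r) (j : Fin r) : ℤ :=
  ∑ a, if c a = j then d a else 0

theorem colourSign_cons (d₀ : ℤ) (d : Fin n → ℤ) (j : Fin r) (c : Fin n → Fin r) :
    colourSign K (Fin.cons d₀ d : Fin (n + 1) → ℤ) (Fin.cons j c : Fin (n + 1) → Fin r) =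
      (-1 : K) ^ (d₀ * ∑ b, if c b < j then d b else 0) * colourSign K d c := by
  have h : (-1 : K) ^ (d₀ * ∑ b, if c b < j then d b else 0) =
      ∏ b, if c b < j then (-1 : K) ^ (d₀ * d b) else 1 := by
    rw [Finset.mul_sum]
    induction (Finset.univ : Finset (Fin n)) using Finset.induction_on with
    | empty => simp
    | insert a s ha ih =>
      rw [Finset.sum_insert ha, Finset.prod_insert ha, sgn_add, ih]
      split_ifs <;> simp
  rw [h]
  simp [colourSign, Fin.prod_univ_succ, Fin.succ_pos]

theorem colourDeg_cons (d₀ : ℤ) (d : Fin n → ℤ) (j : Fin r) (c : Fin n → Fin r) (k : Fin r) :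
    colourDeg (Fin.cons d₀ d : Fin (n + 1) → ℤ) (Fin.cons j c : Fin (n + 1) → Fin r) k =
      (if j = k then d₀ else 0) + colourDeg d c k := by
  simp [colourDeg, Fin.sum_univ_succ]

theorem koszulSign_sort (d : Fin n → ℤ) (c : Fin n → Fin r) :
    koszulSign K d (Tuple.sort c) = colourSign K d c := by
  have h := Tuple.eq_sort_iff.1 (rfl : Tuple.sort c = Tuple.sort c)
  set σ := Tuple.sort c
  rw [colourSign, ← Fintype.prod_prod_type', ← Finset.prod_filter, koszulSign]
  refine Finset.prod_bij' (fun ab _ => (σ ab.2, σ ab.1)) (fun ab _ => (σ.symm ab.2, σ.symm ab.1))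
    ?_ ?_ ?_ ?_ ?_
  · rintro ⟨a, b⟩ hab
    simp only [Finset.mem_filter, Finset.mem_univ, true_and] at hab ⊢
    refine ⟨hab.2, lt_of_le_of_ne (h.1 hab.1.le) fun he => ?_⟩
    exact (h.2 a b hab.1 he).not_gt hab.2
  · rintro ⟨a, b⟩ hab
    simp only [Finset.mem_filter, Finset.mem_univ, true_and, Equiv.apply_symm_apply] at hab ⊢
    refine ⟨lt_of_not_ge fun hle => ?_, hab.1⟩
    have := h.1 hle
    simp only [Function.comp_apply, Equiv.apply_symm_apply] at this
    exact this.not_gt hab.2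
  · rintro ⟨a, b⟩ _; simp
  · rintro ⟨a, b⟩ _; simp
  · rintro ⟨a, b⟩ _; rw [mul_comm]

theorem degSum_sort (d : Fin n → ℤ) {c κ : Fin n → Fin r} (hc : c ∘ Tuple.sort c = κ) {s t : ℕ}
    {j : Fin r} (hj : ∀ a, κ a = j ↔ s ≤ (a : ℕ) ∧ (a : ℕ) < t) :
    degSum (d ∘ Tuple.sort c) s t = colourDeg d c j := by
  rw [colourDeg, ← Equiv.sum_comp (Tuple.sort c), degSum, Finset.sum_filter]
  refine Finset.sum_congr rfl fun a _ => ?_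
  have : c (Tuple.sort c a) = κ a := congrFun hc a
  rw [this]
  simp only [hj, Function.comp_apply]

theorem mem_drop_take_finRange {s t : ℕ} {a : Fin n} :
    a ∈ ((List.finRange n).take t).drop s ↔ s ≤ (a : ℕ) ∧ (a : ℕ) < t := by
  rw [List.mem_drop_iff_getElem]
  constructor
  · rintro ⟨i, hi, rfl⟩
    simp at hi ⊢
    omega
  · rintro ⟨h1, h2⟩
    refine ⟨a - s, ?_, ?_⟩
    · simp; omega
    · ext; simp; omega

theorem map_sort_drop_take_finRange {c κ : Fin n → Fin r} (hc : c ∘ Tuple.sort c = κ) {s t : ℕ}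
    {j : Fin r} (hj : ∀ a, κ a = j ↔ s ≤ (a : ℕ) ∧ (a : ℕ) < t) :
    (((List.finRange n).take t).drop s).map (Tuple.sort c) =
      (List.finRange n).filter fun a => c a = j := by
  have h := Tuple.eq_sort_iff.1 (rfl : Tuple.sort c = Tuple.sort c)
  have hκ : ∀ a, c (Tuple.sort c a) = κ a := fun a => congrFun hc a
  have hs : (((List.finRange n).take t).drop s).Pairwise (· < ·) :=
    ((List.pairwise_lt_finRange n).sublist (List.take_sublist _ _)).sublist (List.drop_sublist _ _)
  have hs' : ((((List.finRange n).take t).drop s).map (Tuple.sort c)).Pairwise (· < ·) := by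
    rw [List.pairwise_map]
    refine hs.imp_of_mem fun {a b} ha hb hab => h.2 a b hab ?_
    rw [hκ, hκ, (hj a).2 (mem_drop_take_finRange.1 ha), (hj b).2 (mem_drop_take_finRange.1 hb)]
  have hf : ((List.finRange n).filter fun a => c a = j).Pairwise (· < ·) :=
    (List.pairwise_lt_finRange n).filter _
  refine List.Perm.eq_of_pairwise (le := (· < ·)) (fun a b _ _ h h' => absurd h' h.not_gt) hs' hf ?_
  rw [List.perm_ext_iff_of_nodup (hs'.imp fun h => h.ne) (hf.imp fun h => h.ne)]
  intro a
  rw [List.mem_map, List.mem_filter]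
  simp only [mem_drop_take_finRange, ← hj, ← hκ]
  constructor
  · rintro ⟨b, hb, rfl⟩
    simpa using hb
  · rintro ⟨-, ha⟩
    exact ⟨(Tuple.sort c).symm a, by simpa using ha, by simp⟩

end Shuffles

namespace Sym

variable (𝒱 : ℤ → Submodule K V) {n r : ℕ}

/-- The product, in increasing order, of the entries of colour `j`. -/
def part (x : Fin n → V) (c : Fin n → Fin r) (j : Fin r) : Sym 𝒱 :=
  (((List.finRange n).filter fun a => c a = j).map fun a => ι 𝒱 (x a)).prod

theorem block_sort (x : Fin n → V) {c κ : Fin n → Fin r} (hc : c ∘ Tuple.sort c = κ) {s t : ℕ}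
    {j : Fin r} (hj : ∀ a, κ a = j ↔ s ≤ (a : ℕ) ∧ (a : ℕ) < t) :
    block 𝒱 (x ∘ Tuple.sort c) s t = part 𝒱 x c j := by
  rw [part, ← map_sort_drop_take_finRange hc hj, block, List.ofFn_eq_map, ← List.map_take,
    ← List.map_drop, List.map_map, List.map_map]
  rfl

theorem part_zero (x : Fin 0 → V) (c : Fin 0 → Fin r) (j : Fin r) : part 𝒱 x c j = 1 := rfl

theorem part_cons (v : V) (x : Fin n → V) (i : Fin r) (c : Fin n → Fin r) (j : Fin r) :
    part 𝒱 (Fin.cons v x : Fin (n + 1) → V) (Fin.cons i c : Fin (n + 1) → Fin r) j =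
      if i = j then ι 𝒱 v * part 𝒱 x c j else part 𝒱 x c j := by
  simp only [part, List.finRange_succ, List.filter_cons, Fin.cons_zero, List.filter_map,
    decide_eq_true_eq]
  split_ifs <;> simp [Function.comp_def]

end Sym

/-! ### The explicit formulas -/

section

variable {𝒱 : ℤ → Submodule K V} {n m r : ℕ}

theorem sum_lt_one_eq_colourDeg (a : Fin n → ℤ) (c : Fin n → Fin (r + 2)) :
    (∑ i, if c i < 1 then a i else 0) = colourDeg a c 0 := by
  simp only [Fin.lt_one_iff, colourDeg]

theorem sum_lt_two_eq_colourDeg (a : Fin n → ℤ) (c : Fin n → Fin 3) :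
    (∑ i, if c i < 2 then a i else 0) = colourDeg a c 0 + colourDeg a c 1 := by
  rw [colourDeg, colourDeg, ← Finset.sum_add_distrib]
  refine Finset.sum_congr rfl fun i _ => ?_
  generalize c i = j
  fin_cases j <;> simp

theorem colourSign_cons_zero (d₀ : ℤ) (d : Fin n → ℤ) (c : Fin n → Fin (r + 1)) :
    colourSign K (Fin.cons d₀ d : Fin (n + 1) → ℤ) (Fin.cons 0 c : Fin (n + 1) → Fin (r + 1)) =
      colourSign K d c := by
  simp [colourSign_cons]

theorem colourSign_cons_one (d₀ : ℤ) (d : Fin n → ℤ) (c : Fin n → Fin (r + 2)) :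
    colourSign K (Fin.cons d₀ d : Fin (n + 1) → ℤ) (Fin.cons 1 c : Fin (n + 1) → Fin (r + 2)) =
      (-1 : K) ^ (d₀ * colourDeg d c 0) * colourSign K d c := by
  rw [colourSign_cons, sum_lt_one_eq_colourDeg]

theorem colourSign_cons_two (d₀ : ℤ) (d : Fin n → ℤ) (c : Fin n → Fin 3) :
    colourSign K (Fin.cons d₀ d : Fin (n + 1) → ℤ) (Fin.cons 2 c : Fin (n + 1) → Fin 3) =
      (-1 : K) ^ (d₀ * (colourDeg d c 0 + colourDeg d c 1)) * colourSign K d c := by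
  rw [colourSign_cons, sum_lt_two_eq_colourDeg]

theorem tm_one (u : Sym 𝒱) : tm 𝒱 u 1 = 0 := by
  rw [tm, Sym.toBar_one, TensorProduct.tmul_zero]

theorem Sym.block_self (x : Fin n → V) (s : ℕ) : Sym.block 𝒱 x s s = 1 := by
  rw [Sym.block, List.drop_eq_nil_of_le (by simp)]; rfl

/-- Reading off blocks of a sequence that has been sorted by its colours. -/
theorem blocks₂_spec {i : ℕ} {c : Fin n → Fin 2} (hc : c ∘ Tuple.sort c = blocks₂ n i)
    (x : Fin n → V) (a : Fin n → ℤ) :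
    Sym.block 𝒱 (x ∘ Tuple.sort c) 0 i = Sym.part 𝒱 x c 0 ∧
    Sym.block 𝒱 (x ∘ Tuple.sort c) i n = Sym.part 𝒱 x c 1 ∧
    degSum (a ∘ Tuple.sort c) 0 i = colourDeg a c 0 ∧
    degSum (a ∘ Tuple.sort c) i n = colourDeg a c 1 := by
  have h0 : ∀ a : Fin n, blocks₂ n i a = 0 ↔ 0 ≤ (a : ℕ) ∧ (a : ℕ) < i := fun a => by
    rw [blocks₂_eq_zero_iff]; omega
  have h1 : ∀ a : Fin n, blocks₂ n i a = 1 ↔ i ≤ (a : ℕ) ∧ (a : ℕ) < n := fun a => by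
    rw [blocks₂_eq_one_iff]; omega
  exact ⟨Sym.block_sort 𝒱 x hc h0, Sym.block_sort 𝒱 x hc h1, degSum_sort a hc h0,
    degSum_sort a hc h1⟩

theorem blocks₃_spec {i j : ℕ} {c : Fin n → Fin 3} (hc : c ∘ Tuple.sort c = blocks₃ n i j)
    (x : Fin n → V) :
    Sym.block 𝒱 (x ∘ Tuple.sort c) 0 i = Sym.part 𝒱 x c 0 ∧
    Sym.block 𝒱 (x ∘ Tuple.sort c) i (i + j) = Sym.part 𝒱 x c 1 ∧
    Sym.block 𝒱 (x ∘ Tuple.sort c) (i + j) n = Sym.part 𝒱 x c 2 := by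
  refine ⟨Sym.block_sort 𝒱 x hc fun a => ?_, Sym.block_sort 𝒱 x hc fun a => ?_,
    Sym.block_sort 𝒱 x hc fun a => ?_⟩
  · rw [blocks₃_eq_zero_iff]; omega
  · rw [blocks₃_eq_one_iff]
  · rw [blocks₃_eq_two_iff]; omega

/-- A sum over shuffles with three blocks, the second of which is not empty, may be extended to all
shuffles with three blocks if the additional terms vanish. -/
theorem sum_shuffles₃_of_pos {M : Type*} [AddCommMonoid M] {F : ℕ → ℕ → Equiv.Perm (Fin n) → M}
    {G : (Fin n → Fin 3) → M} (h0 : ∀ i σ, F i 0 σ = 0)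
    (hFG : ∀ i j, i + j ≤ n → ∀ c : Fin n → Fin 3, c ∘ Tuple.sort c = blocks₃ n i j →
      F i j (Tuple.sort c) = G c) :
    ∑ i ∈ Finset.range n, ∑ j ∈ Finset.Icc 1 (n - i), ∑ σ ∈ shuffles₃ n i j, F i j σ =
      ∑ c, G c := by
  rw [← sum_shuffles₃ hFG, Finset.sum_range_succ, Nat.sub_self, zero_add, Finset.sum_range_one]
  simp only [h0, Finset.sum_const_zero, add_zero]
  refine Finset.sum_congr rfl fun i _ => Finset.sum_subset (fun j hj => ?_) fun j hj hj' => ?_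
  · simp only [Finset.mem_Icc, Finset.mem_range] at *; omega
  · simp only [Finset.mem_Icc, Finset.mem_range] at *
    obtain rfl : j = 0 := by omega
    simp [h0]

/-- Exchange of the two colours. -/
def swapColours (c : Fin n → Fin 2) : Fin n → Fin 2 := fun i => Fin.rev (c i)

theorem swapColours_cons (j : Fin 2) (c : Fin n → Fin 2) :
    swapColours (Fin.cons j c : Fin (n + 1) → Fin 2) = Fin.cons (Fin.rev j) (swapColours c) := by
  ext i
  cases i using Fin.cases <;> rfl

theorem swapColours_eq_iff (c : Fin n → Fin 2) (i : Fin n) (j : Fin 2) :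
    swapColours c i = j ↔ c i = Fin.rev j := by
  rw [swapColours, Fin.rev_eq_iff]

theorem part_swapColours (x : Fin n → V) (c : Fin n → Fin 2) (j : Fin 2) :
    Sym.part 𝒱 x (swapColours c) j = Sym.part 𝒱 x c (Fin.rev j) := by
  simp only [Sym.part, swapColours_eq_iff]

theorem colourDeg_swapColours (a : Fin n → ℤ) (c : Fin n → Fin 2) (j : Fin 2) :
    colourDeg a (swapColours c) j = colourDeg a c (Fin.rev j) := by
  simp only [colourDeg, swapColours_eq_iff]

theorem colourSign_swapColours (a : Fin n → ℤ) (c : Fin n → Fin 2) :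
    colourSign K a (swapColours c) =
      (-1 : K) ^ (colourDeg a c 0 * colourDeg a c 1) * colourSign K a c := by
  induction n with
  | zero => simp [colourSign, colourDeg]
  | succ n ih =>
    rw [← Fin.cons_self_tail a, ← Fin.cons_self_tail c, swapColours_cons]
    generalize c 0 = j
    have h0 : Fin.rev (0 : Fin 2) = 1 := rfl
    have h1 : Fin.rev (1 : Fin 2) = 0 := rfl
    fin_cases j
    · simp only [Fin.zero_eta, h0, colourSign_cons_one, colourSign_cons_zero, ih, colourDeg_cons,
        colourDeg_swapColours, if_true, zero_ne_one, if_false, zero_add, add_mul, sgn_add]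
      ring
    · simp only [Fin.mk_one, h1, colourSign_cons_one, colourSign_cons_zero, ih, colourDeg_cons,
        if_true, one_ne_zero, if_false, zero_add, mul_add, sgn_add]
      have := sgn_mul_self (K := K) (a 0 * colourDeg (Fin.tail a) (Fin.tail c) 0)
      rw [mul_comm (colourDeg _ _ 0) (a 0)]
      linear_combination -(-1 : K) ^ (colourDeg (Fin.tail a) (Fin.tail c) 0 *
        colourDeg (Fin.tail a) (Fin.tail c) 1) * colourSign K (Fin.tail a) (Fin.tail c) * this

variable [DirectSum.Decomposition 𝒱]

theorem Sym.sign_part {x : Fin n → V} {a : Fin n → ℤ} (hx : ∀ i, x i ∈ 𝒱 (a i)) (c : Fin n → Fin r)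
    (j : Fin r) (k : ℤ) :
    Sym.sign 𝒱 k (Sym.part 𝒱 x c j) = (-1 : K) ^ (k * colourDeg a c j) • Sym.part 𝒱 x c j := by
  induction n with
  | zero => simp [Sym.part_zero, colourDeg]
  | succ n ih =>
    have h := ih (x := Fin.tail x) (a := Fin.tail a) (fun i => hx i.succ) (Fin.tail c)
    rw [← Fin.cons_self_tail x, ← Fin.cons_self_tail a, ← Fin.cons_self_tail c, Sym.part_cons,
      colourDeg_cons, mul_add, sgn_add]
    split_ifs
    · rw [map_mul, h, Sym.sign_ι 𝒱 k (hx 0), smul_mul_smul_comm]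
    · rw [h, mul_zero, zpow_zero, one_mul]

theorem Word.part_mul_tmul {x : Fin n → V} {a : Fin n → ℤ} (hx : ∀ i, x i ∈ 𝒱 (a i))
    (c : Fin n → Fin r) (j : Fin r) {d : ℤ} {u w : Sym 𝒱} (h : Word 𝒱 d (u ⊗ₜ w)) :
    Word 𝒱 (colourDeg a c j + d) ((Sym.part 𝒱 x c j * u) ⊗ₜ w) := by
  induction n with
  | zero => simpa [Sym.part_zero, colourDeg] using h
  | succ n ih =>
    have h := ih (x := Fin.tail x) (a := Fin.tail a) (fun i => hx i.succ) (Fin.tail c)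
    rw [← Fin.cons_self_tail x, ← Fin.cons_self_tail a, ← Fin.cons_self_tail c, Sym.part_cons,
      colourDeg_cons]
    split_ifs
    · rw [mul_assoc, add_assoc, ← opL_tmul]
      exact .opL (hx 0) h
    · rwa [zero_add]

theorem Word.tmul_part_mul {x : Fin n → V} {a : Fin n → ℤ} (hx : ∀ i, x i ∈ 𝒱 (a i))
    (c : Fin n → Fin r) (j : Fin r) {d : ℤ} {w : Sym 𝒱} (h : Word 𝒱 d (1 ⊗ₜ w)) :
    Word 𝒱 (colourDeg a c j + d) (1 ⊗ₜ (Sym.part 𝒱 x c j * w)) := by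
  induction n with
  | zero => simpa [Sym.part_zero, colourDeg] using h
  | succ n ih =>
    have h := ih (x := Fin.tail x) (a := Fin.tail a) (fun i => hx i.succ) (Fin.tail c)
    rw [← Fin.cons_self_tail x, ← Fin.cons_self_tail a, ← Fin.cons_self_tail c, Sym.part_cons,
      colourDeg_cons]
    split_ifs
    · rw [mul_assoc, add_assoc, ← opM_one_tmul 𝒱]
      exact .opM (hx 0) h
    · rwa [zero_add]

theorem word_part_tmul_part {x : Fin n → V} {y : Fin m → V} {a : Fin n → ℤ} {b : Fin m → ℤ}
    (hx : ∀ i, x i ∈ 𝒱 (a i)) (hy : ∀ i, y i ∈ 𝒱 (b i)) {s : ℕ} (c : Fin n → Fin r) (j : Fin r)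
    (e : Fin m → Fin s) (k : Fin s) :
    Word 𝒱 (colourDeg a c j + colourDeg b e k) (Sym.part 𝒱 x c j ⊗ₜ Sym.part 𝒱 y e k) := by
  have h := Word.part_mul_tmul hx c j (Word.tmul_part_mul hy e k (Word.unit (𝒱 := 𝒱)))
  rwa [mul_one, mul_one, add_zero] at h

theorem primOp_tmul (k : ℤ) (X Y : Module.End K (BiSym 𝒱)) (c c' : BiSym 𝒱) :
    primOp k X Y (c ⊗ₜ c') = X c ⊗ₜ c' + sgnOp 𝒱 k c ⊗ₜ Y c' := rfl

theorem coΔ_one_tmul_block {y : Fin m → V} {b : Fin m → ℤ} (hy : ∀ i, y i ∈ 𝒱 (b i)) :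
    coΔ 𝒱 (1 ⊗ₜ Sym.block 𝒱 y 0 m) =
      ∑ e : Fin m → Fin 2, colourSign K b e •
        ((1 ⊗ₜ Sym.part 𝒱 y e 0) ⊗ₜ (1 ⊗ₜ Sym.part 𝒱 y e 1)) := by
  induction m with
  | zero =>
    rw [Sym.block_zero]
    exact coΔ_unit₂.trans (by simp [colourSign, Sym.part_zero, unit₂])
  | succ m ih =>
    have hy' : ∀ i, Fin.tail y i ∈ 𝒱 (Fin.tail b i) := fun i => hy i.succ
    have h := ih hy'
    rw [← Fin.cons_self_tail y, ← Fin.cons_self_tail b, Sym.block_cons, ← opM_one_tmul 𝒱,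
      coΔ_opM (hy 0), h, sum_colourings_succ, Fin.sum_univ_two, map_sum, ← Finset.sum_add_distrib]
    refine Finset.sum_congr rfl fun e _ => ?_
    rw [map_smul, primOp_tmul, colourSign_cons_zero, colourSign_cons_one, smul_add]
    simp only [Sym.part_cons, opM_one_tmul, sgnOp_tmul, map_one, if_true, one_ne_zero, zero_ne_one,
      if_false, Sym.sign_part hy', TensorProduct.tmul_smul, ← TensorProduct.smul_tmul', smul_smul]
    rw [mul_comm (colourSign K _ _)]

theorem coΔ_block {x : Fin n → V} {y : Fin m → V} {a : Fin n → ℤ} {b : Fin m → ℤ}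
    (hx : ∀ i, x i ∈ 𝒱 (a i)) (hy : ∀ i, y i ∈ 𝒱 (b i)) :
    coΔ 𝒱 (Sym.block 𝒱 x 0 n ⊗ₜ Sym.block 𝒱 y 0 m) =
      ∑ c : Fin n → Fin 2, ∑ e : Fin m → Fin 2,
        (colourSign K a c * colourSign K b e * (-1 : K) ^ (colourDeg a c 1 * colourDeg b e 0)) •
          ((Sym.part 𝒱 x c 0 ⊗ₜ Sym.part 𝒱 y e 0) ⊗ₜ (Sym.part 𝒱 x c 1 ⊗ₜ Sym.part 𝒱 y e 1)) := by
  induction n with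
  | zero =>
    rw [Sym.block_zero, coΔ_one_tmul_block hy]
    simp [colourSign, colourDeg, Sym.part_zero]
  | succ n ih =>
    have h := ih (x := Fin.tail x) (a := Fin.tail a) fun i => hx i.succ
    have hx' : ∀ i, Fin.tail x i ∈ 𝒱 (Fin.tail a i) := fun i => hx i.succ
    rw [← Fin.cons_self_tail x, ← Fin.cons_self_tail a, Sym.block_cons, ← opL_tmul,
      coΔ_opL (hx 0), h, sum_colourings_succ, Fin.sum_univ_two, map_sum, ← Finset.sum_add_distrib]
    refine Finset.sum_congr rfl fun c _ => ?_
    rw [map_sum, ← Finset.sum_add_distrib]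
    refine Finset.sum_congr rfl fun e _ => ?_
    rw [map_smul, primOp_tmul, colourSign_cons_zero, colourSign_cons_one, smul_add]
    simp only [Sym.part_cons, opL_tmul, if_true, one_ne_zero, zero_ne_one, if_false,
      sgnOp_word (word_part_tmul_part hx' hy c 0 e 0), ← TensorProduct.smul_tmul', smul_smul,
      colourDeg_cons, zero_add]
    congr 2
    rw [add_mul, mul_add, sgn_add, sgn_add]
    ring

theorem coδ_one_tmul_block {y : Fin m → V} {b : Fin m → ℤ} (hy : ∀ i, y i ∈ 𝒱 (b i)) :
    coδ 𝒱 (1 ⊗ₜ Sym.block 𝒱 y 0 m) = (1 ⊗ₜ 1) ⊗ₜ (1 ⊗ₜ Sym.block 𝒱 y 0 m) := by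
  induction m with
  | zero =>
    rw [Sym.block_zero]
    exact coδ_unit₂
  | succ m ih =>
    have h := ih (y := Fin.tail y) (b := Fin.tail b) fun i => hy i.succ
    rw [← Fin.cons_self_tail y, Sym.block_cons, ← opM_one_tmul 𝒱, coδ_opM (hy 0), h, primOp_tmul]
    simp

theorem coδ_block {x : Fin n → V} {y : Fin m → V} {a : Fin n → ℤ} {b : Fin m → ℤ}
    (hx : ∀ i, x i ∈ 𝒱 (a i)) (hy : ∀ i, y i ∈ 𝒱 (b i)) :
    coδ 𝒱 (Sym.block 𝒱 x 0 n ⊗ₜ Sym.block 𝒱 y 0 m) =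
      ∑ c : Fin n → Fin 3, colourSign K a c •
        ((Sym.part 𝒱 x c 0 ⊗ₜ Sym.part 𝒱 x c 1) ⊗ₜ
          (Sym.part 𝒱 x c 2 ⊗ₜ Sym.block 𝒱 y 0 m)) := by
  induction n with
  | zero =>
    rw [Sym.block_zero, coδ_one_tmul_block hy]
    simp [colourSign, Sym.part_zero]
  | succ n ih =>
    have h := ih (x := Fin.tail x) (a := Fin.tail a) fun i => hx i.succ
    have hx' : ∀ i, Fin.tail x i ∈ 𝒱 (Fin.tail a i) := fun i => hx i.succ
    rw [← Fin.cons_self_tail x, ← Fin.cons_self_tail a, Sym.block_cons, ← opL_tmul,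
      coδ_opL (hx 0), h, sum_colourings_succ, Fin.sum_univ_three, map_sum,
      ← Finset.sum_add_distrib, ← Finset.sum_add_distrib]
    refine Finset.sum_congr rfl fun c _ => ?_
    have h01 : (0 : Fin 3) ≠ 1 := by decide
    have h02 : (0 : Fin 3) ≠ 2 := by decide
    have h12 : (1 : Fin 3) ≠ 2 := by decide
    rw [map_smul, primOp_tmul, colourSign_cons_zero, colourSign_cons_one, colourSign_cons_two,
      smul_add, opN_apply, LinearMap.add_apply, TensorProduct.add_tmul, smul_add]
    simp only [Sym.part_cons, opL_tmul, opM_tmul 𝒱 (hx 0), if_true, h01, h02, h12, h01.symm,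
      h02.symm, h12.symm, if_false, Sym.sign_part hx',
      sgnOp_word (word_part_tmul_part hx' hx' c 0 c 1), ← TensorProduct.smul_tmul', smul_smul]
    rw [mul_comm (colourSign K _ _), mul_comm (colourSign K _ _)]

theorem isCoproductΔ_triasΔ : IsCoproductΔ 𝒱 (triasΔ 𝒱) := by
  intro n m x y a b hm hx hy
  rw [triasΔ, LinearMap.comp_apply, LinearMap.comp_apply, ofTrias_mono hm, coΔ_block hx hy]
  simp only [map_sum, map_smul, TensorProduct.map_tmul, toTrias_tmul]
  -- the terms with `j = 0` and `j = m` vanish, because `S̅ym(V)` has no part of weight `0`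
  have hj : ∀ (f : ℕ → Trias 𝒱 ⊗[K] Trias 𝒱), f 0 = 0 → f m = 0 →
      ∑ j ∈ Finset.Ico 1 m, f j = ∑ j ∈ Finset.range (m + 1), f j := by
    intro f h0 h1
    refine Finset.sum_subset (fun j hj => ?_) fun j hj hj' => ?_
    · simp only [Finset.mem_Ico, Finset.mem_range] at *; omega
    · simp only [Finset.mem_Ico, Finset.mem_range] at *
      obtain rfl | rfl : j = 0 ∨ j = m := by omega
      · exact h0
      · exact h1
  symm
  calc _ = ∑ i ∈ Finset.range (n + 1), ∑ σ ∈ shuffles₂ n i, ∑ j ∈ Finset.range (m + 1),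
        ∑ τ ∈ shuffles₂ m j, (koszulSign K a σ * koszulSign K b τ *
              (-1 : K) ^ (degSum (a ∘ σ) i n * degSum (b ∘ τ) 0 j)) •
            (tm 𝒱 (Sym.block 𝒱 (x ∘ σ) 0 i) (Sym.block 𝒱 (y ∘ τ) 0 j) ⊗ₜ[K]
              tm 𝒱 (Sym.block 𝒱 (x ∘ σ) i n) (Sym.block 𝒱 (y ∘ τ) j m)) := by
        refine Finset.sum_congr rfl fun i _ => ?_
        rw [Finset.sum_comm' (t' := shuffles₂ n i) (s' := fun _ => Finset.Ico 1 m)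
          (fun _ _ => Iff.rfl)]
        refine Finset.sum_congr rfl fun σ _ => hj _ ?_ ?_
        · simp [Sym.block_self, tm_one]
        · simp [Sym.block_self, tm_one]
    _ = _ := sum_shuffles₂ fun i _ c hc => ?_
  obtain ⟨e1, e2, -, e4⟩ := blocks₂_spec (𝒱 := 𝒱) hc x a
  refine sum_shuffles₂ fun j _ e he => ?_
  obtain ⟨f1, f2, f3, -⟩ := blocks₂_spec (𝒱 := 𝒱) he y b
  rw [e1, e2, e4, f1, f2, f3, koszulSign_sort, koszulSign_sort]

theorem isCoproductδ_triasδ : IsCoproductδ 𝒱 (triasδ 𝒱) := by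
  intro n m x y a b hm hx hy
  rw [triasδ, LinearMap.comp_apply, LinearMap.comp_apply, ofTrias_mono hm, coδ_block hx hy]
  simp only [map_sum, map_smul, TensorProduct.map_tmul, toTrias_tmul]
  symm
  refine sum_shuffles₃_of_pos (fun i σ => ?_) fun i j _ c hc => ?_
  · simp [Sym.block_self, tm_one]
  · obtain ⟨e1, e2, e3⟩ := blocks₃_spec (𝒱 := 𝒱) hc x
    rw [e1, e2, e3, koszulSign_sort]

theorem psi₁_block (R : BiSym 𝒱 →ₗ[K] V) {x : Fin n → V} {y : Fin m → V} {a : Fin n → ℤ}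
    {b : Fin m → ℤ} (hx : ∀ i, x i ∈ 𝒱 (a i)) (hy : ∀ i, y i ∈ 𝒱 (b i)) :
    psi₁ R (Sym.block 𝒱 x 0 n ⊗ₜ Sym.block 𝒱 y 0 m) =
      ∑ c : Fin n → Fin 3, colourSign K a c •
        ((Sym.ι 𝒱 (R (Sym.part 𝒱 x c 0 ⊗ₜ Sym.part 𝒱 x c 1)) * Sym.part 𝒱 x c 2) ⊗ₜ
          Sym.block 𝒱 y 0 m) := by
  rw [psi₁, LinearMap.comp_apply, LinearMap.comp_apply, coδ_block hx hy]
  simp only [map_sum, map_smul, LinearMap.rTensor_tmul, TensorProduct.lift.tmul, opL_tmul]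

theorem psi₂_block {k : ℤ} {R : BiSym 𝒱 →ₗ[K] V} (hR : R ∈ HomDeg (biGr 𝒱) 𝒱 k) {x : Fin n → V}
    {y : Fin m → V} {a : Fin n → ℤ} {b : Fin m → ℤ} (hx : ∀ i, x i ∈ 𝒱 (a i))
    (hy : ∀ i, y i ∈ 𝒱 (b i)) :
    psi₂ R (Sym.block 𝒱 x 0 n ⊗ₜ Sym.block 𝒱 y 0 m) =
      ∑ c : Fin n → Fin 2, ∑ e : Fin m → Fin 2,
        (colourSign K a c * colourSign K b e * (-1 : K) ^ (k * colourDeg a c 0)) •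
          (Sym.part 𝒱 x c 0 ⊗ₜ
            (Sym.ι 𝒱 (R (Sym.part 𝒱 x c 1 ⊗ₜ Sym.part 𝒱 y e 0)) * Sym.part 𝒱 y e 1)) := by
  rw [psi₂, LinearMap.comp_apply, LinearMap.comp_apply, coΔ_block hx hy]
  have hs : Function.Involutive (swapColours (n := n)) := fun c => by
    ext i; simp [swapColours]
  -- `Δ` puts the argument of `R` first, the formula puts it second: exchange the two colours
  rw [← Equiv.sum_comp hs.toPerm]
  simp only [map_sum, map_smul, LinearMap.rTensor_tmul, TensorProduct.lift.tmul]
  refine Finset.sum_congr rfl fun c _ => Finset.sum_congr rfl fun e _ => ?_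
  have h0 : Fin.rev (0 : Fin 2) = 1 := rfl
  have h1 : Fin.rev (1 : Fin 2) = 0 := rfl
  have hw := hR _ _ (Submodule.subset_span (word_part_tmul_part hx hy c 1 e 0))
  change (colourSign K a (swapColours c) * _ * (-1 : K) ^ (colourDeg a (swapColours c) 1 * _)) •
    opM 𝒱 (R (Sym.part 𝒱 x (swapColours c) 0 ⊗ₜ _)) (Sym.part 𝒱 x (swapColours c) 1 ⊗ₜ _) = _
  rw [part_swapColours, part_swapColours, h0, h1, colourSign_swapColours, colourDeg_swapColours, h1,
    opM_tmul 𝒱 hw, Sym.sign_part hx, ← TensorProduct.smul_tmul', smul_smul]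
  congr 1
  simp only [add_mul, sgn_add]
  rw [mul_comm (colourDeg a c 1) (colourDeg a c 0), mul_comm (colourDeg b e 0) (colourDeg a c 0)]
  have s1 := sgn_mul_self (K := K) (colourDeg a c 0 * colourDeg a c 1)
  have s2 := sgn_mul_self (K := K) (colourDeg a c 0 * colourDeg b e 0)
  generalize (-1 : K) ^ (colourDeg a c 0 * colourDeg a c 1) = p at *
  generalize (-1 : K) ^ (colourDeg a c 0 * colourDeg b e 0) = q at *
  linear_combination colourSign K a c * colourSign K b e * (-1 : K) ^ (k * colourDeg a c 0) *
    (q * q * s1 + s2)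

theorem isHat_hat {k : ℤ} {R : Trias 𝒱 →ₗ[K] V} (hR : R ∈ PLHom 𝒱 k) : IsHat 𝒱 k R (hat R) := by
  intro n m x y a b hm hx hy
  have hmono : mono 𝒱 x y = toTrias 𝒱 (Sym.block 𝒱 x 0 n ⊗ₜ Sym.block 𝒱 y 0 m) := rfl
  rw [hmono, hat_toTrias, psi, LinearMap.add_apply, psi₁_block _ hx hy,
    psi₂_block (comp_toTrias_homDeg hR) hx hy]
  simp only [map_add, map_sum, map_smul, toTrias_tmul, LinearMap.comp_apply]
  congr 1
  · symm
    refine sum_shuffles₃_of_pos (fun i σ => ?_) fun i j _ c hc => ?_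
    · rw [add_zero, Sym.block_self, tm_one, map_zero, map_zero, zero_mul, tm,
        TensorProduct.zero_tmul, smul_zero]
    · obtain ⟨e1, e2, e3⟩ := blocks₃_spec (𝒱 := 𝒱) hc x
      rw [e1, e2, e3, koszulSign_sort]
  · -- the additional terms with `q = 0` vanish, because `R` vanishes on `Sym(V) ⊗ Sym⁰(V)`
    have hq : ∀ (f : ℕ → Trias 𝒱), f 0 = 0 →
        ∑ q ∈ Finset.Icc 1 m, f q = ∑ q ∈ Finset.range (m + 1), f q := by
      intro f h0
      refine Finset.sum_subset (fun j hj => ?_) fun j hj hj' => ?_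
      · simp only [Finset.mem_Icc, Finset.mem_range] at *; omega
      · simp only [Finset.mem_Icc, Finset.mem_range] at *
        obtain rfl : j = 0 := by omega
        exact h0
    symm
    calc _ = ∑ p ∈ Finset.range (n + 1), ∑ σ ∈ shuffles₂ n (n - p), ∑ q ∈ Finset.range (m + 1),
        ∑ τ ∈ shuffles₂ m q,
          (koszulSign K a σ * koszulSign K b τ * (-1 : K) ^ (k * degSum (a ∘ σ) 0 (n - p))) •
            tm 𝒱
              (Sym.block 𝒱 (x ∘ σ) 0 (n - p))
              (Sym.ι 𝒱 (R (tm 𝒱 (Sym.block 𝒱 (x ∘ σ) (n - p) n) (Sym.block 𝒱 (y ∘ τ) 0 q))) *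
                Sym.block 𝒱 (y ∘ τ) q m) := by
          refine Finset.sum_congr rfl fun i _ => ?_
          rw [Finset.sum_comm' (t' := shuffles₂ n (n - i)) (s' := fun _ => Finset.Icc 1 m)
            (fun _ _ => Iff.rfl)]
          refine Finset.sum_congr rfl fun σ _ => hq _ ?_
          simp [Sym.block_self, tm]
      _ = ∑ p ∈ Finset.range (n + 1), ∑ σ ∈ shuffles₂ n p, ∑ q ∈ Finset.range (m + 1),
        ∑ τ ∈ shuffles₂ m q,
          (koszulSign K a σ * koszulSign K b τ * (-1 : K) ^ (k * degSum (a ∘ σ) 0 p)) •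
            tm 𝒱
              (Sym.block 𝒱 (x ∘ σ) 0 p)
              (Sym.ι 𝒱 (R (tm 𝒱 (Sym.block 𝒱 (x ∘ σ) p n) (Sym.block 𝒱 (y ∘ τ) 0 q))) *
                Sym.block 𝒱 (y ∘ τ) q m) := Finset.sum_flip fun p =>
          ∑ σ ∈ shuffles₂ n p, ∑ q ∈ Finset.range (m + 1), ∑ τ ∈ shuffles₂ m q,
          (koszulSign K a σ * koszulSign K b τ * (-1 : K) ^ (k * degSum (a ∘ σ) 0 p)) •
            tm 𝒱
              (Sym.block 𝒱 (x ∘ σ) 0 p)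
              (Sym.ι 𝒱 (R (tm 𝒱 (Sym.block 𝒱 (x ∘ σ) p n) (Sym.block 𝒱 (y ∘ τ) 0 q))) *
                Sym.block 𝒱 (y ∘ τ) q m)
      _ = _ := sum_shuffles₂ fun i _ c hc => ?_
    obtain ⟨e1, e2, e3, -⟩ := blocks₂_spec (𝒱 := 𝒱) hc x a
    refine sum_shuffles₂ fun j _ e he => ?_
    obtain ⟨f1, f2, -, -⟩ := blocks₂_spec (𝒱 := 𝒱) he y b
    rw [e1, e2, e3, f1, f2, koszulSign_sort, koszulSign_sort]

end

/-! ### The projection to `V` and the counits -/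

section

variable (𝒱 : ℤ → Submodule K V)

/-- The map `a ⊗ b ↦ ε(a) b`. -/
def leftCounit : BiSym 𝒱 →ₗ[K] Sym 𝒱 :=
  (TensorProduct.lid K (Sym 𝒱)).toLinearMap ∘ₗ (Sym.counit 𝒱).toLinearMap.rTensor (Sym 𝒱)

/-- The map `a ⊗ b ↦ ε(a) ε(b)`. -/
def counit₂ : BiSym 𝒱 →ₗ[K] K := (Sym.counit 𝒱).toLinearMap ∘ₗ leftCounit 𝒱

variable {𝒱}

theorem leftCounit_tmul (a b : Sym 𝒱) : leftCounit 𝒱 (a ⊗ₜ b) = Sym.counit 𝒱 a • b := by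
  simp [leftCounit]

theorem leftCounit_unit₂ : leftCounit 𝒱 (unit₂ 𝒱) = 1 := by
  rw [unit₂, leftCounit_tmul, map_one, one_smul]

theorem counit₂_unit₂ : counit₂ 𝒱 (unit₂ 𝒱) = 1 := by
  rw [counit₂, LinearMap.comp_apply, leftCounit_unit₂]; exact map_one (Sym.counit 𝒱)

theorem leftCounit_opL (v : V) (c : BiSym 𝒱) : leftCounit 𝒱 (opL 𝒱 v c) = 0 := by
  induction c using TensorProduct.induction_on with
  | zero => simp
  | add c d hc hd => rw [map_add, map_add, hc, hd, add_zero]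
  | tmul a b => simp [leftCounit_tmul]

theorem counit₂_opL (v : V) (c : BiSym 𝒱) : counit₂ 𝒱 (opL 𝒱 v c) = 0 := by
  rw [counit₂, LinearMap.comp_apply, leftCounit_opL, map_zero]

/-- The operators `λ_v = 0` and `μ_v (r, w) = (0, r v)` on `K × V`. -/
def actProj (𝒱 : ℤ → Submodule K V) : GradedAction 𝒱 (K × V) where
  lam := 0
  mu := LinearMap.mk₂ K (fun v p => ((0 : K), p.1 • v))
    (fun _ _ _ => by simp) (fun _ _ _ => by rw [Prod.smul_mk, smul_zero, smul_comm])
    (fun _ _ _ => by simp [add_smul])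
    (fun _ _ _ => by simp [mul_smul])
  lam_lam _ _ := by simp [GComm]
  mu_mu {i j v w} _ _ := by
    refine LinearMap.ext fun p => ?_
    change ((0 : K), (0 : K) • v) = (-1 : K) ^ (i * j) • ((0 : K), (0 : K) • w)
    simp
  lam_mu _ _ := by simp [GComm]

variable (𝒱) in
/-- The projection `Sym(V) ⊗ Sym(V) → Sym⁰(V) ⊗ Sym¹(V) = V`. -/
def projV : BiSym 𝒱 →ₗ[K] V := LinearMap.snd K K V ∘ₗ (actProj 𝒱).orbit (1, 0)

theorem projV_unit₂ : projV 𝒱 (unit₂ 𝒱) = 0 := by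
  rw [projV, LinearMap.comp_apply, GradedAction.orbit_unit₂]; rfl

theorem projV_opL (v : V) (c : BiSym 𝒱) : projV 𝒱 (opL 𝒱 v c) = 0 := by
  rw [projV, LinearMap.comp_apply, GradedAction.orbit_opL]; rfl

variable (𝒱) in
/-- The map `a ⊗ b ↦ ε(a) b` on `Sym(V) ⊗ S̅ym(V)`. -/
def leftCounitBar : Trias 𝒱 →ₗ[K] Sym.bar 𝒱 :=
  (TensorProduct.lid K (Sym.bar 𝒱)).toLinearMap ∘ₗ
    (Sym.counit 𝒱).toLinearMap.rTensor (Sym.bar 𝒱)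

theorem leftCounitBar_toTrias (c : BiSym 𝒱) :
    leftCounitBar 𝒱 (toTrias 𝒱 c) = Sym.toBar 𝒱 (leftCounit 𝒱 c) := by
  induction c using TensorProduct.induction_on with
  | zero => simp
  | add c d hc hd => simp only [map_add, hc, hd]
  | tmul a b => simp [leftCounitBar, toTrias, leftCounit_tmul]

variable [DirectSum.Decomposition 𝒱]

theorem leftCounit_opM (v : V) (c : BiSym 𝒱) :
    leftCounit 𝒱 (opM 𝒱 v c) = Sym.ι 𝒱 v * leftCounit 𝒱 c := by
  induction v using homogeneous_induction (𝒱 := 𝒱) with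
  | hadd v w hv hw => simp only [map_add, LinearMap.add_apply, hv, hw, add_mul]
  | h i v hv =>
    induction c using TensorProduct.induction_on with
    | zero => simp
    | add c d hc hd => rw [map_add, map_add, hc, hd, map_add, mul_add]
    | tmul a b => simp [opM_tmul 𝒱 hv, leftCounit_tmul, Sym.counit_sign]

theorem leftCounit_sgnOp (k : ℤ) (c : BiSym 𝒱) :
    leftCounit 𝒱 (sgnOp 𝒱 k c) = Sym.sign 𝒱 k (leftCounit 𝒱 c) := by
  induction c using TensorProduct.induction_on with
  | zero => simp
  | add c d hc hd => rw [map_add, map_add, hc, hd, map_add, map_add]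
  | tmul a b => simp [leftCounit_tmul, Sym.counit_sign]

theorem counit₂_sgnOp (k : ℤ) (c : BiSym 𝒱) : counit₂ 𝒱 (sgnOp 𝒱 k c) = counit₂ 𝒱 c := by
  rw [counit₂, LinearMap.comp_apply, leftCounit_sgnOp]
  exact Sym.counit_sign 𝒱 k _

theorem counit₂_opM (v : V) (c : BiSym 𝒱) : counit₂ 𝒱 (opM 𝒱 v c) = 0 := by
  rw [counit₂, LinearMap.comp_apply, leftCounit_opM]; simp

theorem projV_opM (v : V) (c : BiSym 𝒱) : projV 𝒱 (opM 𝒱 v c) = counit₂ 𝒱 c • v := by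
  have h : LinearMap.fst K K V ∘ₗ (actProj 𝒱).orbit (1, 0) = counit₂ 𝒱 := by
    refine bi_ext' ?_ (fun i v hv c hc => ?_) (fun i v hv c hc => ?_)
    · rw [LinearMap.comp_apply, GradedAction.orbit_unit₂, counit₂_unit₂]; rfl
    · rw [LinearMap.comp_apply, GradedAction.orbit_opL, counit₂_opL]; rfl
    · rw [LinearMap.comp_apply, GradedAction.orbit_opM, counit₂_opM]; rfl
  rw [projV, LinearMap.comp_apply, GradedAction.orbit_opM, ← h]; rfl

theorem projV_homDeg : projV 𝒱 ∈ HomDeg (biGr 𝒱) 𝒱 0 := by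
  have h : ∀ d c, Word 𝒱 d c → counit₂ 𝒱 c = 0 ∨ d = 0 := by
    intro d c hc
    cases hc with
    | unit => exact .inr rfl
    | opL hv _ => exact .inl (counit₂_opL _ _)
    | opM hv _ => exact .inl (counit₂_opM _ _)
  refine homDeg_biGr fun d c hc => ?_
  cases hc with
  | unit => rw [projV_unit₂]; exact Submodule.zero_mem _
  | opL hv _ => rw [projV_opL]; exact Submodule.zero_mem _
  | opM hv hc =>
    rw [projV_opM, add_zero]
    obtain h | rfl := h _ _ hc
    · rw [h, zero_smul]; exact Submodule.zero_mem _
    · rw [add_zero]; exact Submodule.smul_mem _ _ hv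

theorem projV_zeroPart (c : BiSym 𝒱) : projV 𝒱 (zeroPart 𝒱 c) = 0 := by
  refine LinearMap.congr_fun (f := projV 𝒱 ∘ₗ zeroPart 𝒱) (g := 0)
    (bi_ext' ?_ (fun i v hv c hc => ?_) (fun i v hv c hc => ?_)) c
  · rw [LinearMap.comp_apply, zeroPart_unit₂, projV_unit₂]; rfl
  · rw [LinearMap.comp_apply, ← Module.End.mul_apply, zeroPart_mul_opL, Module.End.mul_apply,
      projV_opL]; rfl
  · rw [LinearMap.comp_apply, ← Module.End.mul_apply, zeroPart_mul_opM, LinearMap.zero_apply,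
      map_zero]; rfl

theorem projV_sgnOp (k : ℤ) (c : BiSym 𝒱) : projV 𝒱 (sgnOp 𝒱 k c) = Sym.signV 𝒱 k (projV 𝒱 c) := by
  refine LinearMap.congr_fun (f := projV 𝒱 ∘ₗ sgnOp 𝒱 k) (g := Sym.signV 𝒱 k ∘ₗ projV 𝒱)
    (bi_ext fun d c hc => ?_) c
  have := projV_homDeg d c (Submodule.subset_span hc)
  rw [add_zero] at this
  rw [LinearMap.comp_apply, LinearMap.comp_apply, sgnOp_word hc, map_smul,
    Sym.signV_of_mem 𝒱 k this]

/-- `Δ` is counital on the right. -/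
theorem rid_lTensor_coΔ (c : BiSym 𝒱) :
    TensorProduct.rid K _ ((counit₂ 𝒱).lTensor _ (coΔ 𝒱 c)) = c := by
  have key : ∀ (i : ℤ) (X Y : Module.End K (BiSym 𝒱)), (∀ c, counit₂ 𝒱 (Y c) = 0) →
      ∀ t, TensorProduct.rid K _ ((counit₂ 𝒱).lTensor _ (primOp i X Y t)) =
        X (TensorProduct.rid K _ ((counit₂ 𝒱).lTensor _ t)) := by
    intro i X Y hY t
    induction t using TensorProduct.induction_on with
    | zero => simp
    | add t u ht hu => simp only [map_add, ht, hu]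
    | tmul c d => rw [primOp_tmul]; simp [hY]
  refine LinearMap.congr_fun (f := (TensorProduct.rid K (BiSym 𝒱)).toLinearMap ∘ₗ
    (counit₂ 𝒱).lTensor _ ∘ₗ coΔ 𝒱) (g := LinearMap.id)
    (bi_ext' ?_ (fun i v hv c hc => ?_) (fun i v hv c hc => ?_)) c
  · simp [coΔ_unit₂, counit₂_unit₂]
  · simp only [LinearMap.comp_apply, LinearEquiv.coe_coe, LinearMap.id_apply] at hc ⊢
    rw [coΔ_opL hv, key _ _ _ (counit₂_opL v), hc]
  · simp only [LinearMap.comp_apply, LinearEquiv.coe_coe, LinearMap.id_apply] at hc ⊢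
    rw [coΔ_opM hv, key _ _ _ (counit₂_opM v), hc]

/-- `Δ` is counital on the left. -/
theorem lid_rTensor_coΔ (c : BiSym 𝒱) :
    TensorProduct.lid K _ ((counit₂ 𝒱).rTensor _ (coΔ 𝒱 c)) = c := by
  have key : ∀ (i : ℤ) (X Y : Module.End K (BiSym 𝒱)), (∀ c, counit₂ 𝒱 (X c) = 0) →
      ∀ t, TensorProduct.lid K _ ((counit₂ 𝒱).rTensor _ (primOp i X Y t)) =
        Y (TensorProduct.lid K _ ((counit₂ 𝒱).rTensor _ t)) := by
    intro i X Y hX t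
    induction t using TensorProduct.induction_on with
    | zero => simp
    | add t u ht hu => simp only [map_add, ht, hu]
    | tmul c d => rw [primOp_tmul]; simp [hX, counit₂_sgnOp]
  refine LinearMap.congr_fun (f := (TensorProduct.lid K (BiSym 𝒱)).toLinearMap ∘ₗ
    (counit₂ 𝒱).rTensor _ ∘ₗ coΔ 𝒱) (g := LinearMap.id)
    (bi_ext' ?_ (fun i v hv c hc => ?_) (fun i v hv c hc => ?_)) c
  · simp [coΔ_unit₂, counit₂_unit₂]
  · simp only [LinearMap.comp_apply, LinearEquiv.coe_coe, LinearMap.id_apply] at hc ⊢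
    rw [coΔ_opL hv, key _ _ _ (counit₂_opL v), hc]
  · simp only [LinearMap.comp_apply, LinearEquiv.coe_coe, LinearMap.id_apply] at hc ⊢
    rw [coΔ_opM hv, key _ _ _ (counit₂_opM v), hc]

theorem projV_psi (R : BiSym 𝒱 →ₗ[K] V) (c : BiSym 𝒱) : projV 𝒱 (psi R c) = R c := by
  have h1 : projV 𝒱 ∘ₗ TensorProduct.lift (opL 𝒱) = 0 :=
    TensorProduct.ext' fun v c => projV_opL v c
  have h2 : projV 𝒱 ∘ₗ TensorProduct.lift (opM 𝒱) ∘ₗ R.rTensor _ =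
      R ∘ₗ (TensorProduct.rid K _).toLinearMap ∘ₗ (counit₂ 𝒱).lTensor _ :=
    TensorProduct.ext' fun c d => by simp [projV_opM]
  have h3 := LinearMap.congr_fun h1 (R.rTensor _ (coδ 𝒱 c))
  have h4 := LinearMap.congr_fun h2 (coΔ 𝒱 c)
  simp only [LinearMap.comp_apply, LinearEquiv.coe_coe, LinearMap.zero_apply,
    rid_lTensor_coΔ] at h3 h4
  rw [psi, LinearMap.add_apply, map_add, psi₁, psi₂]
  simp only [LinearMap.comp_apply, h3, h4, zero_add]

variable (𝒱) in
/-- The projection `Sym(V) ⊗ S̅ym(V) → Sym⁰(V) ⊗ Sym¹(V) = V`. -/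
def triasProj : Trias 𝒱 →ₗ[K] V := projV 𝒱 ∘ₗ ofTrias 𝒱

theorem triasProj_homDeg : triasProj 𝒱 ∈ PLHom 𝒱 0 := mem_homDeg_comp projV_homDeg ofTrias_homDeg

theorem triasProj_toTrias (c : BiSym 𝒱) : triasProj 𝒱 (toTrias 𝒱 c) = projV 𝒱 c := by
  rw [triasProj, LinearMap.comp_apply, ofTrias_toTrias, map_sub, projV_zeroPart, sub_zero]

/-- `R` is recovered from `Ψ(R)` by projecting to `V`. -/
theorem triasProj_comp_hat (R : Trias 𝒱 →ₗ[K] V) : triasProj 𝒱 ∘ₗ hat R = R := by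
  refine LinearMap.ext fun t => ?_
  rw [triasProj, LinearMap.comp_apply, LinearMap.comp_apply, ofTrias_hat, projV_psi,
    LinearMap.comp_apply, toTrias_ofTrias]

/-! ### Primitive elements -/

/-- `δ` is inverted by the counits of the left factors: `a ⊗ b` is the component of `δ(a ⊗ b)` in
`(1 ⊗ Sym(V)) ⊗ (1 ⊗ Sym(V))`. -/
theorem map_leftCounit_coδ (c : BiSym 𝒱) :
    TensorProduct.map (leftCounit 𝒱) (leftCounit 𝒱) (coδ 𝒱 c) = c := by
  refine LinearMap.congr_fun (f := TensorProduct.map (leftCounit 𝒱) (leftCounit 𝒱) ∘ₗ coδ 𝒱)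
    (g := LinearMap.id) (bi_ext' ?_ (fun i v hv c hc => ?_) (fun i v hv c hc => ?_)) c
  · simp only [LinearMap.comp_apply, coδ_unit₂, TensorProduct.map_tmul, leftCounit_unit₂]
    rfl
  · have h : TensorProduct.map (leftCounit 𝒱) (leftCounit 𝒱) ∘ₗ primOp i (opN 𝒱 v) (opL 𝒱 v) =
        opL 𝒱 v ∘ₗ TensorProduct.map (leftCounit 𝒱) (leftCounit 𝒱) :=
      TensorProduct.ext' fun c d => by
        simp [primOp_tmul, opN_apply, leftCounit_opL, leftCounit_opM]
    simp only [LinearMap.comp_apply, LinearMap.id_apply] at hc ⊢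
    rw [coδ_opL hv, ← LinearMap.comp_apply, h, LinearMap.comp_apply, hc]
  · have h : TensorProduct.map (leftCounit 𝒱) (leftCounit 𝒱) ∘ₗ primOp i 0 (opM 𝒱 v) =
        opM 𝒱 v ∘ₗ TensorProduct.map (leftCounit 𝒱) (leftCounit 𝒱) :=
      TensorProduct.ext' fun c d => by
        simp [primOp_tmul, opM_tmul 𝒱 hv, leftCounit_sgnOp, leftCounit_opM]
    simp only [LinearMap.comp_apply, LinearMap.id_apply] at hc ⊢
    rw [coδ_opM hv, ← LinearMap.comp_apply, h, LinearMap.comp_apply, hc]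

/-- An element that `δ` annihilates lies in `1 ⊗ S̅ym(V)`. -/
theorem eq_one_tmul_of_triasδ_eq_zero {t : Trias 𝒱} (ht : triasδ 𝒱 t = 0) :
    t = 1 ⊗ₜ leftCounitBar 𝒱 t := by
  have h1 : TensorProduct.map (leftCounitBar 𝒱) (leftCounitBar 𝒱) (triasδ 𝒱 t) =
      TensorProduct.map (Sym.toBar 𝒱) (Sym.toBar 𝒱) (ofTrias 𝒱 t) := by
    have h : TensorProduct.map (leftCounitBar 𝒱) (leftCounitBar 𝒱) ∘ₗ
        TensorProduct.map (toTrias 𝒱) (toTrias 𝒱) =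
        TensorProduct.map (Sym.toBar 𝒱) (Sym.toBar 𝒱) ∘ₗ
          TensorProduct.map (leftCounit 𝒱) (leftCounit 𝒱) :=
      TensorProduct.ext' fun c d => by simp [leftCounitBar_toTrias]
    rw [triasδ, LinearMap.comp_apply, ← LinearMap.comp_apply, h, LinearMap.comp_apply,
      LinearMap.comp_apply, map_leftCounit_coδ]
  have h2 : (Sym.bar 𝒱).subtype.rTensor _ ∘ₗ TensorProduct.map (Sym.toBar 𝒱) (Sym.toBar 𝒱) ∘ₗ
      ofTrias 𝒱 = LinearMap.id - TensorProduct.mk K (Sym 𝒱) (Sym.bar 𝒱) 1 ∘ₗ leftCounitBar 𝒱 :=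
    TensorProduct.ext' fun a b => by
      simp [ofTrias, leftCounitBar, Sym.coe_toBar, TensorProduct.sub_tmul,
        Algebra.algebraMap_eq_smul_one, TensorProduct.smul_tmul]
  have h3 := LinearMap.congr_fun h2 t
  rw [LinearMap.comp_apply, LinearMap.comp_apply, ← h1, ht, map_zero, map_zero] at h3
  exact sub_eq_zero.1 h3.symm

end

namespace Sym

variable (𝒱 : ℤ → Submodule K V)

/-- The algebra map `Sym(V) → Sym(V)[X]` that sends an element `a` of weight `n` to `a Xⁿ`. -/
def weight : Sym 𝒱 →ₐ[K] Polynomial (Sym 𝒱) :=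
  lift 𝒱 (LinearMap.mulRight K Polynomial.X ∘ₗ
      (Polynomial.CAlgHom (R := K) (A := Sym 𝒱)).toLinearMap ∘ₗ ι 𝒱) (by
    intro i j x y hx hy
    have h : ∀ a b : Sym 𝒱, Polynomial.C a * Polynomial.X * (Polynomial.C b * Polynomial.X) =
        Polynomial.C (a * b) * (Polynomial.X * Polynomial.X) := fun a b => by
      rw [mul_assoc, ← mul_assoc Polynomial.X, Polynomial.X_mul_C, Polynomial.C_mul, mul_assoc,
        mul_assoc]
    simp only [LinearMap.comp_apply, LinearMap.mulRight_apply, AlgHom.toLinearMap_apply,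
      Polynomial.CAlgHom_apply, h]
    rw [ι_mul_ι 𝒱 hx hy, ← Polynomial.smul_C, smul_mul_assoc])

variable {𝒱}

theorem weight_ι (v : V) : weight 𝒱 (ι 𝒱 v) = Polynomial.C (ι 𝒱 v) * Polynomial.X :=
  lift_ι 𝒱 _ _ v

theorem coeff_zero_weight (a : Sym 𝒱) :
    (weight 𝒱 a).coeff 0 = algebraMap K (Sym 𝒱) (counit 𝒱 a) := by
  induction a using induction with
  | hr r => simp [Polynomial.algebraMap_apply]
  | hι v => simp [weight_ι]
  | hmul a b ha hb => rw [map_mul, Polynomial.mul_coeff_zero, ha, hb, map_mul, map_mul]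
  | hadd a b ha hb => rw [map_add, Polynomial.coeff_add, ha, hb, map_add, map_add]

theorem eval_one_weight (a : Sym 𝒱) : (weight 𝒱 a).eval 1 = a := by
  induction a using induction with
  | hr r => simp [Polynomial.algebraMap_apply]
  | hι v => rw [weight_ι, Polynomial.eval_C_mul]; simp
  | hmul a b ha hb =>
    rw [map_mul, Polynomial.eval, Polynomial.eval₂_mul_noncomm _ _ fun k => Commute.one_right _]
    exact congrArg₂ _ ha hb
  | hadd a b ha hb => rw [map_add, Polynomial.eval_add, ha, hb]

end Sym

section

variable {𝒱 : ℤ → Submodule K V} [DirectSum.Decomposition 𝒱]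

variable (𝒱) in
/-- The map `c ↦ π(c₍₁₎) (ε ⊗ Id)(c₍₂₎)`, where `Δ c = c₍₁₎ ⊗ c₍₂₎` and `π` is the projection
to `V`. On `1 ⊗ Sym(V)` it is the Euler operator, which multiplies `1 ⊗ b` by the weight
of `b`. -/
def euler : BiSym 𝒱 →ₗ[K] Sym 𝒱 :=
  LinearMap.mul' K (Sym 𝒱) ∘ₗ TensorProduct.map (Sym.ι 𝒱 ∘ₗ projV 𝒱) (leftCounit 𝒱) ∘ₗ coΔ 𝒱

theorem euler_unit₂ : euler 𝒱 (unit₂ 𝒱) = 0 := by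
  simp [euler, coΔ_unit₂, projV_unit₂]

theorem euler_opM (v : V) (c : BiSym 𝒱) :
    euler 𝒱 (opM 𝒱 v c) = Sym.ι 𝒱 v * (leftCounit 𝒱 c + euler 𝒱 c) := by
  induction v using homogeneous_induction (𝒱 := 𝒱) with
  | hadd v w hv hw => simp only [map_add, LinearMap.add_apply, hv, hw, add_mul]
  | h i v hv =>
    have hsgn : ∀ w : V, Sym.ι 𝒱 (Sym.signV 𝒱 i w) * Sym.ι 𝒱 v = Sym.ι 𝒱 v * Sym.ι 𝒱 w := by
      intro w
      induction w using homogeneous_induction (𝒱 := 𝒱) with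
      | hadd w w' hw hw' => simp only [map_add, add_mul, mul_add, hw, hw']
      | h j w hw =>
        rw [Sym.signV_of_mem 𝒱 i hw, map_smul, smul_mul_assoc, ← Sym.ι_mul_ι 𝒱 hv hw]
    have h : LinearMap.mul' K (Sym 𝒱) ∘ₗ TensorProduct.map (Sym.ι 𝒱 ∘ₗ projV 𝒱) (leftCounit 𝒱) ∘ₗ
        primOp i (opM 𝒱 v) (opM 𝒱 v) =
        LinearMap.mulLeft K (Sym.ι 𝒱 v) ∘ₗ (leftCounit 𝒱 ∘ₗ (TensorProduct.lid K _).toLinearMap ∘ₗ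
          (counit₂ 𝒱).rTensor _ + LinearMap.mul' K (Sym 𝒱) ∘ₗ
            TensorProduct.map (Sym.ι 𝒱 ∘ₗ projV 𝒱) (leftCounit 𝒱)) := by
      refine TensorProduct.ext' fun c d => ?_
      simp only [LinearMap.comp_apply, LinearMap.add_apply, primOp_tmul, map_add,
        TensorProduct.map_tmul, LinearMap.mul'_apply, projV_opM, projV_sgnOp, leftCounit_opM,
        LinearMap.mulLeft_apply, LinearMap.rTensor_tmul, LinearEquiv.coe_coe,
        TensorProduct.lid_tmul, map_smul, smul_mul_assoc]
      rw [← mul_assoc (Sym.ι 𝒱 (Sym.signV 𝒱 i _)), hsgn, mul_assoc]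
    have h' := LinearMap.congr_fun h (coΔ 𝒱 c)
    simp only [LinearMap.comp_apply, LinearMap.add_apply, LinearEquiv.coe_coe, lid_rTensor_coΔ,
      LinearMap.mulLeft_apply] at h'
    rw [euler, LinearMap.comp_apply, LinearMap.comp_apply, coΔ_opM hv, h']
    rfl

theorem coeff_weight_euler (b : Sym 𝒱) (k : ℕ) :
    (Sym.weight 𝒱 (euler 𝒱 (1 ⊗ₜ b))).coeff k = k • (Sym.weight 𝒱 b).coeff k := by
  suffices h : ∀ a b : Sym 𝒱, (∀ k, (Sym.weight 𝒱 (euler 𝒱 (1 ⊗ₜ b))).coeff k =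
      k • (Sym.weight 𝒱 b).coeff k) → ∀ k, (Sym.weight 𝒱 (euler 𝒱 (1 ⊗ₜ (a * b)))).coeff k =
      k • (Sym.weight 𝒱 (a * b)).coeff k by
    have := h b 1 (fun k => ?_) k
    · rwa [mul_one] at this
    · have : euler 𝒱 (1 ⊗ₜ 1) = 0 := euler_unit₂
      rw [this, map_zero, map_one, Polynomial.coeff_zero, Polynomial.coeff_one]
      split_ifs with h
      · rw [h, zero_smul]
      · rw [smul_zero]
  intro a
  induction a using Sym.induction with
  | hr r =>
    intro b hb k
    rw [← Algebra.smul_def, TensorProduct.tmul_smul, map_smul, map_smul, map_smul,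
      Polynomial.coeff_smul, Polynomial.coeff_smul, hb, smul_comm]
  | hι v =>
    intro b hb k
    rw [← opM_one_tmul 𝒱, euler_opM, leftCounit_tmul, map_one, one_smul, map_mul, map_mul,
      Sym.weight_ι, mul_assoc, mul_assoc, Polynomial.coeff_C_mul, Polynomial.coeff_C_mul, map_add]
    cases k with
    | zero => simp
    | succ k =>
      rw [Polynomial.coeff_X_mul, Polynomial.coeff_X_mul, Polynomial.coeff_add, hb,
        ← mul_smul_comm, succ_nsmul']
  | hmul a a' ha ha' =>
    intro b hb
    rw [mul_assoc]
    exact ha _ (ha' _ hb)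
  | hadd a a' ha ha' =>
    intro b hb k
    rw [add_mul, TensorProduct.tmul_add, map_add, map_add, map_add, Polynomial.coeff_add,
      Polynomial.coeff_add, ha b hb, ha' b hb, smul_add]

/-- In characteristic zero, the Euler operator is injective on `S̅ym(V)`. -/
theorem eq_zero_of_euler_eq_zero [CharZero K] {b : Sym 𝒱} (hb : Sym.counit 𝒱 b = 0)
    (h : euler 𝒱 (1 ⊗ₜ b) = 0) : b = 0 := by
  have hw : Sym.weight 𝒱 b = 0 := by
    ext k
    rcases Nat.eq_zero_or_pos k with rfl | hk
    · rw [Sym.coeff_zero_weight, hb, map_zero, Polynomial.coeff_zero]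
    · have := coeff_weight_euler b k
      rw [h, map_zero, Polynomial.coeff_zero, ← Nat.cast_smul_eq_nsmul K] at this
      exact (smul_eq_zero.1 this.symm).resolve_left (Nat.cast_ne_zero.2 hk.ne')
  rw [← Sym.eval_one_weight b, hw, Polynomial.eval_zero]

/-- An element that is annihilated by `Δ`, by `δ` and by the projection to `V` is zero. -/
theorem eq_zero_of_primitive [CharZero K] {t : Trias 𝒱} (hΔ : triasΔ 𝒱 t = 0)
    (hδ : triasδ 𝒱 t = 0) (hV : triasProj 𝒱 t = 0) : t = 0 := by
  obtain ⟨b, rfl⟩ : ∃ b : Sym.bar 𝒱, t = 1 ⊗ₜ b := ⟨_, eq_one_tmul_of_triasδ_eq_zero hδ⟩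
  have hof : ofTrias 𝒱 (1 ⊗ₜ b) = 1 ⊗ₜ (b : Sym 𝒱) := rfl
  -- replacing `Id` by the projection to `S̅ym(V)` in the Euler operator changes it by `π`
  have h1 : LinearMap.mul' K (Sym 𝒱) ∘ₗ TensorProduct.map (Sym.ι 𝒱 ∘ₗ triasProj 𝒱)
        ((Sym.bar 𝒱).subtype ∘ₗ leftCounitBar 𝒱) ∘ₗ
        TensorProduct.map (toTrias 𝒱) (toTrias 𝒱) =
      LinearMap.mul' K (Sym 𝒱) ∘ₗ TensorProduct.map (Sym.ι 𝒱 ∘ₗ projV 𝒱) (leftCounit 𝒱) -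
        Sym.ι 𝒱 ∘ₗ projV 𝒱 ∘ₗ (TensorProduct.rid K _).toLinearMap ∘ₗ (counit₂ 𝒱).lTensor _ := by
    refine TensorProduct.ext' fun c d => ?_
    simp only [LinearMap.comp_apply, LinearMap.sub_apply, TensorProduct.map_tmul,
      triasProj_toTrias, leftCounitBar_toTrias, Submodule.subtype_apply, Sym.coe_toBar,
      LinearMap.mul'_apply, LinearMap.lTensor_tmul, LinearEquiv.coe_coe, TensorProduct.rid_tmul,
      map_smul, mul_sub, Algebra.algebraMap_eq_smul_one, mul_smul_comm, mul_one]
    rfl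
  have h2 := LinearMap.congr_fun h1 (coΔ 𝒱 (1 ⊗ₜ (b : Sym 𝒱)))
  simp only [LinearMap.comp_apply, LinearMap.sub_apply, LinearEquiv.coe_coe,
    rid_lTensor_coΔ] at h2
  have h3 : projV 𝒱 (1 ⊗ₜ (b : Sym 𝒱)) = 0 := hV
  have h4 : TensorProduct.map (toTrias 𝒱) (toTrias 𝒱) (coΔ 𝒱 (1 ⊗ₜ (b : Sym 𝒱))) = 0 := hΔ
  rw [h3, h4, map_zero, map_zero, map_zero, sub_zero] at h2
  have hb : (b : Sym 𝒱) = 0 := eq_zero_of_euler_eq_zero b.2 h2.symm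
  rw [show b = 0 from Subtype.ext hb, TensorProduct.tmul_zero]

/-! ### A coderivation is determined by its projection to `V` -/

/-- A block of a sequence is the product of a shorter sequence. -/
theorem Sym.block_eq_block (𝒱 : ℤ → Submodule K V) {n s t : ℕ} (x : Fin n → V) (ht : t ≤ n) :
    Sym.block 𝒱 x s t = Sym.block 𝒱 (fun i : Fin (t - s) => x ⟨s + i, by omega⟩) 0 (t - s) := by
  rw [Sym.block_full, Sym.block]
  congr 2
  refine List.ext_getElem (by simp; omega) fun i h1 h2 => ?_
  simp

theorem eq_zero_of_triasProj_comp_eq_zero [CharZero K] {k : ℤ} {D : Trias 𝒱 →ₗ[K] Trias 𝒱}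
    (hD : D ∈ coDer 𝒱 (triasΔ 𝒱) (triasδ 𝒱) k) (h0 : triasProj 𝒱 ∘ₗ D = 0) : D = 0 := by
  obtain ⟨-, hΔ, hδ⟩ := hD
  suffices h : ∀ (N n m : ℕ) (x : Fin n → V) (y : Fin m → V) (a : Fin n → ℤ) (b : Fin m → ℤ),
      1 ≤ m → (∀ i, x i ∈ 𝒱 (a i)) → (∀ i, y i ∈ 𝒱 (b i)) → n + m = N → D (mono 𝒱 x y) = 0 from
    trias_ext fun n m x y a b hm hx hy => h _ n m x y a b hm hx hy rfl
  intro N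
  induction N using Nat.strong_induction_on with
  | _ N ih =>
    intro n m x y a b hm hx hy hN
    have hsmall : ∀ {n' m' : ℕ} (x' : Fin n' → V) (y' : Fin m' → V) (a' : Fin n' → ℤ)
        (b' : Fin m' → ℤ) (s t s' t' : ℕ), (∀ i, x' i ∈ 𝒱 (a' i)) → (∀ i, y' i ∈ 𝒱 (b' i)) →
        t ≤ n' → s' < t' → t' ≤ m' → t - s + (t' - s') < N →
        D (tm 𝒱 (Sym.block 𝒱 x' s t) (Sym.block 𝒱 y' s' t')) = 0 := by
      intro n' m' x' y' a' b' s t s' t' hx' hy' ht hs' ht' hlt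
      rw [Sym.block_eq_block 𝒱 x' ht, Sym.block_eq_block 𝒱 y' ht']
      exact ih _ hlt _ _ _ _ (fun i => a' ⟨s + i, by omega⟩) (fun i => b' ⟨s' + i, by omega⟩)
        (by omega) (fun i => hx' _) (fun i => hy' _) rfl
    have hleib : ∀ u w : Trias 𝒱, D u = 0 → D w = 0 → leibniz 𝒱 k D (u ⊗ₜ w) = 0 := by
      intro u w hu hw
      simp [leibniz, hu, hw]
    refine eq_zero_of_primitive ?_ ?_ (LinearMap.congr_fun h0 _)
    · rw [← LinearMap.comp_apply, hΔ, LinearMap.comp_apply,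
        isCoproductΔ_triasΔ n m x y a b hm hx hy]
      simp only [map_sum, map_smul]
      refine Finset.sum_eq_zero fun i hi => Finset.sum_eq_zero fun j hj =>
        Finset.sum_eq_zero fun σ _ => Finset.sum_eq_zero fun τ _ => ?_
      rw [Finset.mem_range] at hi
      rw [Finset.mem_Ico] at hj
      rw [hleib, smul_zero]
      · exact hsmall _ _ (a ∘ σ) (b ∘ τ) _ _ _ _ (fun i => hx _) (fun i => hy _) (by omega)
          (by omega) (by omega) (by omega)
      · exact hsmall _ _ (a ∘ σ) (b ∘ τ) _ _ _ _ (fun i => hx _) (fun i => hy _) (by omega)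
          (by omega) (by omega) (by omega)
    · rw [← LinearMap.comp_apply, hδ, LinearMap.comp_apply,
        isCoproductδ_triasδ n m x y a b hm hx hy]
      simp only [map_sum, map_smul]
      refine Finset.sum_eq_zero fun i hi => Finset.sum_eq_zero fun j hj =>
        Finset.sum_eq_zero fun σ _ => ?_
      rw [Finset.mem_range] at hi
      rw [Finset.mem_Icc] at hj
      rw [hleib, smul_zero]
      · exact hsmall _ _ (a ∘ σ) (a ∘ σ) _ _ _ _ (fun i => hx _) (fun i => hx _) (by omega)
          (by omega) (by omega) (by omega)
      · exact hsmall _ _ (a ∘ σ) b _ _ _ _ (fun i => hx _) hy (by omega)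
          (by omega) (by omega) (by omega)

end

/-! ### Graded Lie algebras of linear maps -/

section

theorem lof_eq_lof {X : Type*} [AddCommGroup X] [Module K X] {L : ℤ → Submodule K X} {i j : ℤ}
    (h : i = j) {x : L i} {y : L j} (hxy : x.1 = y.1) :
    DirectSum.lof K ℤ (fun k => L k) i x = DirectSum.lof K ℤ (fun k => L k) j y := by
  subst h
  rw [Subtype.ext hxy]

/-- A graded Lie algebra whose homogeneous parts are subspaces of one vector space; the axioms may
be checked in that vector space. -/
def GradedLieAlgebra.ofSubmodules {X : Type*} [AddCommGroup X] [Module K X]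
    (L : ℤ → Submodule K X) (br : ℤ → ℤ → X →ₗ[K] X →ₗ[K] X)
    (mem : ∀ i j, ∀ x ∈ L i, ∀ y ∈ L j, br i j x y ∈ L (i + j))
    (antisymm : ∀ i j x y, br i j x y = -((-1 : K) ^ (i * j) • br j i y x))
    (jacobi : ∀ i j k, ∀ x ∈ L i, ∀ y ∈ L j, ∀ z ∈ L k,
      br i (j + k) x (br j k y z) = br (i + j) k (br i j x y) z +
        (-1 : K) ^ (i * j) • br j (i + k) y (br i k x z)) :
    GradedLieAlgebra K (fun i => L i) where
  bracket i j := LinearMap.mk₂ K (fun x y => ⟨br i j x.1 y.1, mem i j _ x.2 _ y.2⟩)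
    (fun _ _ _ => Subtype.ext (by simp)) (fun _ _ _ => Subtype.ext (by simp))
    (fun _ _ _ => Subtype.ext (by simp)) (fun _ _ _ => Subtype.ext (by simp))
  antisymm i j x y := by
    rw [← map_smul, ← map_neg]
    exact lof_eq_lof (add_comm i j) (antisymm i j x.1 y.1)
  jacobi i j k x y z := by
    have hz : br j (i + k) y.1 (br i k x.1 z.1) ∈ L (i + j + k) := by
      have := mem _ _ _ y.2 _ (mem _ _ _ x.2 _ z.2)
      rwa [add_left_comm, ← add_assoc] at this
    have h := lof_eq_lof (K := K) (L := L) (i := j + (i + k)) (j := i + j + k) (by ring)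
      (x := ⟨br j (i + k) y.1 (br i k x.1 z.1), mem _ _ _ y.2 _ (mem _ _ _ x.2 _ z.2)⟩)
      (y := ⟨_, hz⟩) rfl
    simp only [LinearMap.mk₂_apply]
    rw [h, ← map_smul, ← map_add]
    exact lof_eq_lof (add_assoc i j k).symm (jacobi i j k x.1 x.2 y.1 y.2 z.1 z.2)

variable {X : Type*} [AddCommGroup X] [Module K X]

/-- The graded commutator `D E - (-1)^{ij} E D`. -/
def gradedCommutator (K X : Type*) [Field K] [AddCommGroup X] [Module K X] (i j : ℤ) :
    Module.End K X →ₗ[K] Module.End K X →ₗ[K] Module.End K X :=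
  LinearMap.mul K (Module.End K X) - (-1 : K) ^ (i * j) • (LinearMap.mul K (Module.End K X)).flip

theorem gradedCommutator_apply (i j : ℤ) (D E : Module.End K X) :
    gradedCommutator K X i j D E = D * E - (-1 : K) ^ (i * j) • (E * D) := rfl

theorem gradedCommutator_antisymm (i j : ℤ) (D E : Module.End K X) :
    gradedCommutator K X i j D E = -((-1 : K) ^ (i * j) • gradedCommutator K X j i E D) := by
  rw [gradedCommutator_apply, gradedCommutator_apply, smul_sub, smul_smul, mul_comm j i,
    sgn_mul_self, one_smul, neg_sub]

theorem gradedCommutator_jacobi (i j k : ℤ) (D E F : Module.End K X) :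
    gradedCommutator K X i (j + k) D (gradedCommutator K X j k E F) =
      gradedCommutator K X (i + j) k (gradedCommutator K X i j D E) F +
        (-1 : K) ^ (i * j) • gradedCommutator K X j (i + k) E (gradedCommutator K X i k D F) := by
  have hp := sgn_mul_self (K := K) (i * j)
  simp only [gradedCommutator_apply, mul_add, add_mul, sgn_add, mul_comm j i]
  generalize (-1 : K) ^ (i * j) = p at *
  generalize (-1 : K) ^ (i * k) = q at *
  generalize (-1 : K) ^ (j * k) = s at *
  simp only [mul_sub, sub_mul, smul_sub, smul_mul_assoc, mul_smul_comm, smul_smul, mul_assoc]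
  match_scalars <;> grind

end

section

variable {𝒱 : ℤ → Submodule K V}
  [DirectSum.Decomposition 𝒱]

theorem triasSign_eq (k : ℤ) (t : Trias 𝒱) :
    triasSign 𝒱 k t = toTrias 𝒱 (sgnOp 𝒱 k (ofTrias 𝒱 t)) := by
  rw [toTrias_sgnOp, toTrias_ofTrias]

theorem triasSign_add (k l : ℤ) (t : Trias 𝒱) :
    triasSign 𝒱 (k + l) t = triasSign 𝒱 k (triasSign 𝒱 l t) := by
  rw [triasSign_eq l, ← toTrias_sgnOp, ← Module.End.mul_apply, ← sgnOp_add, triasSign_eq]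

theorem triasSign_of_mem (k : ℤ) {d : ℤ} {t : Trias 𝒱} (ht : t ∈ triasGr 𝒱 d) :
    triasSign 𝒱 k t = (-1 : K) ^ (k * d) • t := by
  rw [triasSign_eq, sgnOp_of_mem_biGr (ofTrias_mem_biGr ht), map_smul, toTrias_ofTrias]

theorem homDeg_triasSign {k : ℤ} {D : Trias 𝒱 →ₗ[K] Trias 𝒱}
    (hD : D ∈ HomDeg (triasGr 𝒱) (triasGr 𝒱) k) (l : ℤ) (t : Trias 𝒱) :
    D (triasSign 𝒱 l t) = (-1 : K) ^ (k * l) • triasSign 𝒱 l (D t) := by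
  refine LinearMap.congr_fun (f := D ∘ₗ triasSign 𝒱 l)
    (g := (-1 : K) ^ (k * l) • triasSign 𝒱 l ∘ₗ D) (trias_ext fun n m x y a b hm hx hy => ?_) t
  have h : mono 𝒱 x y ∈ triasGr 𝒱 (∑ i, a i + ∑ i, b i) :=
    Submodule.subset_span ⟨n, m, x, y, a, b, hm, hx, hy, rfl, rfl⟩
  dsimp only
  rw [LinearMap.comp_apply, LinearMap.smul_apply, LinearMap.comp_apply, triasSign_of_mem l h,
    triasSign_of_mem l (hD _ _ h), map_smul, smul_smul, ← sgn_add]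
  congr 1
  exact sgn_eq_of_even_sub ⟨-(k * l), by ring⟩

/-- `D ↦ D ⊗ Id + Id ⊗ D` is compatible with graded commutators. -/
theorem leibniz_gradedCommutator {k l : ℤ} {D E : Module.End K (Trias 𝒱)}
    (hD : D ∈ HomDeg (triasGr 𝒱) (triasGr 𝒱) k) (hE : E ∈ HomDeg (triasGr 𝒱) (triasGr 𝒱) l) :
    leibniz 𝒱 (k + l) (gradedCommutator K _ k l D E) =
      gradedCommutator K _ k l (leibniz 𝒱 k D) (leibniz 𝒱 l E) := by
  refine TensorProduct.ext' fun s t => ?_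
  have hs : triasSign 𝒱 l (triasSign 𝒱 k s) = triasSign 𝒱 k (triasSign 𝒱 l s) := by
    rw [← triasSign_add, ← triasSign_add, add_comm]
  have hp := sgn_mul_self (K := K) (k * l)
  simp only [leibniz, gradedCommutator_apply, LinearMap.add_apply, LinearMap.sub_apply,
    LinearMap.smul_apply, Module.End.mul_apply, TensorProduct.map_tmul, LinearMap.id_apply, map_add,
    homDeg_triasSign hD, homDeg_triasSign hE, triasSign_add, hs, TensorProduct.sub_tmul,
    TensorProduct.tmul_sub, ← TensorProduct.smul_tmul', TensorProduct.tmul_smul, mul_comm l k]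
  generalize (-1 : K) ^ (k * l) = p at *
  match_scalars <;> grind

theorem gradedCommutator_mem_coDer {Δ δ : Trias 𝒱 →ₗ[K] Trias 𝒱 ⊗[K] Trias 𝒱} {k l : ℤ}
    {D E : Module.End K (Trias 𝒱)} (hD : D ∈ coDer 𝒱 Δ δ k) (hE : E ∈ coDer 𝒱 Δ δ l) :
    gradedCommutator K _ k l D E ∈ coDer 𝒱 Δ δ (k + l) := by
  obtain ⟨hD, hD₁, hD₂⟩ := hD
  obtain ⟨hE, hE₁, hE₂⟩ := hE
  have key : ∀ Γ : Trias 𝒱 →ₗ[K] Trias 𝒱 ⊗[K] Trias 𝒱, Γ ∘ₗ D = leibniz 𝒱 k D ∘ₗ Γ →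
      Γ ∘ₗ E = leibniz 𝒱 l E ∘ₗ Γ → Γ ∘ₗ gradedCommutator K _ k l D E =
        leibniz 𝒱 (k + l) (gradedCommutator K _ k l D E) ∘ₗ Γ := by
    intro Γ h h'
    have h := fun t => LinearMap.congr_fun h t
    have h' := fun t => LinearMap.congr_fun h' t
    simp only [LinearMap.comp_apply] at h h'
    refine LinearMap.ext fun t => ?_
    rw [leibniz_gradedCommutator hD hE]
    simp only [gradedCommutator_apply, LinearMap.comp_apply, LinearMap.sub_apply,
      LinearMap.smul_apply, Module.End.mul_apply, map_sub, map_smul, h, h']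
  refine ⟨?_, key Δ hD₁ hE₁, key δ hD₂ hE₂⟩
  refine Submodule.sub_mem _ (mem_homDeg_comp hD hE) (Submodule.smul_mem _ _ ?_)
  have := mem_homDeg_comp hE hD
  rwa [add_comm] at this

variable (𝒱) in
/-- The graded Lie algebra of coderivations. -/
def coDerLie (Δ δ : Trias 𝒱 →ₗ[K] Trias 𝒱 ⊗[K] Trias 𝒱) :
    GradedLieAlgebra K (fun k => coDer 𝒱 Δ δ k) :=
  .ofSubmodules (coDer 𝒱 Δ δ) (gradedCommutator K _)
    (fun _ _ _ hD _ hE => gradedCommutator_mem_coDer hD hE) gradedCommutator_antisymm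
    (fun i j k D _ E _ F _ => gradedCommutator_jacobi i j k D E F)

/-! ### The graded Lie algebra `Hom(Sym(V) ⊗ S̅ym(V), V)` -/

theorem comp_hat_mem {k l : ℤ} {f g : Trias 𝒱 →ₗ[K] V} (hf : f ∈ PLHom 𝒱 k) (hg : g ∈ PLHom 𝒱 l) :
    f ∘ₗ hat g ∈ PLHom 𝒱 (k + l) :=
  mem_homDeg_comp hf (hat_homDeg hg)

/-- The composition is `f ∘ g = f Ψ(g)`. -/
theorem isCirc_comp_hat {l : ℤ} (f : Trias 𝒱 →ₗ[K] V) {g : Trias 𝒱 →ₗ[K] V} (hg : g ∈ PLHom 𝒱 l) :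
    IsCirc 𝒱 l f g (f ∘ₗ hat g) := by
  intro n m x y a b hm hx hy
  rw [LinearMap.comp_apply, isHat_hat hg n m x y a b hm hx hy]
  simp only [map_add, map_sum, map_smul]

variable (𝒱) in
/-- The bracket on `Hom(Sym(V) ⊗ S̅ym(V), V)`: the graded commutator of coderivations, projected
to `V`. -/
def plBracket (k l : ℤ) :
    (Trias 𝒱 →ₗ[K] V) →ₗ[K] (Trias 𝒱 →ₗ[K] V) →ₗ[K] (Trias 𝒱 →ₗ[K] V) :=
  let Ψ : (Trias 𝒱 →ₗ[K] V) →ₗ[K] Module.End K (Trias 𝒱) := ⟨⟨hat, hat_add⟩, hat_smul⟩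
  ((gradedCommutator K _ k l).compl₁₂ Ψ Ψ).compr₂ (LinearMap.llcomp K _ _ _ (triasProj 𝒱))

theorem plBracket_eq (k l : ℤ) (f g : Trias 𝒱 →ₗ[K] V) :
    plBracket 𝒱 k l f g = triasProj 𝒱 ∘ₗ gradedCommutator K _ k l (hat f) (hat g) := rfl

theorem plBracket_apply (k l : ℤ) (f g : Trias 𝒱 →ₗ[K] V) :
    plBracket 𝒱 k l f g = f ∘ₗ hat g - (-1 : K) ^ (k * l) • (g ∘ₗ hat f) := by
  rw [plBracket_eq, gradedCommutator_apply, LinearMap.comp_sub, LinearMap.comp_smul,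
    Module.End.mul_eq_comp, Module.End.mul_eq_comp, ← LinearMap.comp_assoc, ← LinearMap.comp_assoc,
    triasProj_comp_hat, triasProj_comp_hat]

theorem plBracket_mem {k l : ℤ} {f g : Trias 𝒱 →ₗ[K] V} (hf : f ∈ PLHom 𝒱 k)
    (hg : g ∈ PLHom 𝒱 l) : plBracket 𝒱 k l f g ∈ PLHom 𝒱 (k + l) := by
  rw [plBracket_apply]
  refine Submodule.sub_mem _ (comp_hat_mem hf hg) (Submodule.smul_mem _ _ ?_)
  rw [add_comm]
  exact comp_hat_mem hg hf

theorem triasProj_comp_mem {k : ℤ} {D : Trias 𝒱 →ₗ[K] Trias 𝒱}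
    (hD : D ∈ HomDeg (triasGr 𝒱) (triasGr 𝒱) k) : triasProj 𝒱 ∘ₗ D ∈ PLHom 𝒱 k := by
  have := mem_homDeg_comp triasProj_homDeg hD
  rwa [zero_add] at this

variable [CharZero K]

/-- A coderivation `D` equals `Ψ(π D)`. -/
theorem hat_triasProj_comp {k : ℤ} {D : Trias 𝒱 →ₗ[K] Trias 𝒱}
    (hD : D ∈ coDer 𝒱 (triasΔ 𝒱) (triasδ 𝒱) k) : hat (triasProj 𝒱 ∘ₗ D) = D := by
  refine sub_eq_zero.1 (eq_zero_of_triasProj_comp_eq_zero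
    (Submodule.sub_mem _ (hat_mem_coDer (triasProj_comp_mem hD.1)) hD) ?_)
  rw [LinearMap.comp_sub, triasProj_comp_hat, sub_self]

/-- `Ψ` carries the bracket to the graded commutator. -/
theorem hat_plBracket {k l : ℤ} {f g : Trias 𝒱 →ₗ[K] V} (hf : f ∈ PLHom 𝒱 k)
    (hg : g ∈ PLHom 𝒱 l) :
    hat (plBracket 𝒱 k l f g) = gradedCommutator K _ k l (hat f) (hat g) :=
  hat_triasProj_comp (gradedCommutator_mem_coDer (hat_mem_coDer hf) (hat_mem_coDer hg))

variable (𝒱) in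
/-- The graded Lie algebra `⨁ Hom^k(Sym(V) ⊗ S̅ym(V), V)`. -/
def plLie : GradedLieAlgebra K (fun k => PLHom 𝒱 k) :=
  .ofSubmodules (PLHom 𝒱) (plBracket 𝒱) (fun _ _ _ hf _ hg => plBracket_mem hf hg)
    (fun i j f g => by
      rw [plBracket_eq, plBracket_eq, gradedCommutator_antisymm, LinearMap.comp_neg,
        LinearMap.comp_smul])
    (fun i j k f hf g hg h hh => by
      rw [plBracket_eq i, hat_plBracket hg hh, plBracket_eq (i + j), hat_plBracket hf hg,
        plBracket_eq j, hat_plBracket hf hh, gradedCommutator_jacobi, LinearMap.comp_add,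
        LinearMap.comp_smul])

variable (𝒱) in
/-- The isomorphism `Ψ` between `Hom^k(Sym(V) ⊗ S̅ym(V), V)` and the coderivations of
degree `k`. -/
def hatEquiv (k : ℤ) : PLHom 𝒱 k ≃ₗ[K] coDer 𝒱 (triasΔ 𝒱) (triasδ 𝒱) k where
  toFun R := ⟨hat R.1, hat_mem_coDer R.2⟩
  map_add' R S := Subtype.ext (hat_add R.1 S.1)
  map_smul' r R := Subtype.ext (hat_smul r R.1)
  invFun D := ⟨triasProj 𝒱 ∘ₗ D.1, triasProj_comp_mem D.2.1⟩
  left_inv R := Subtype.ext (triasProj_comp_hat R.1)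
  right_inv D := Subtype.ext (hat_triasProj_comp D.2)

end

end PostLie

end

theorem mainTheorem2 {K : Type*} [Field K] [CharZero K] {V : Type*} [AddCommGroup V] [Module K V]
    (𝒱 : ℤ → Submodule K V) [DirectSum.Decomposition 𝒱] :
    -- the explicit formulas determine unique linear maps `Δ`, `δ` and `f ∘ g`
    (∃! Δ, PostLie.IsCoproductΔ 𝒱 Δ) ∧ (∃! δ, PostLie.IsCoproductδ 𝒱 δ) ∧
    (∀ (k l : ℤ) (f : PostLie.PLHom 𝒱 k) (g : PostLie.PLHom 𝒱 l),
      ∃! h : PostLie.PLHom 𝒱 (k + l), PostLie.IsCirc 𝒱 l f.1 g.1 h.1) ∧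
    ∃ circ : ∀ k l : ℤ, PostLie.PLHom 𝒱 k → PostLie.PLHom 𝒱 l → PostLie.PLHom 𝒱 (k + l),
      (∀ k l f g, PostLie.IsCirc 𝒱 l f.1 g.1 (circ k l f g).1) ∧
      -- `[f, g] = f ∘ g - (-1)^{kl} g ∘ f` is a graded Lie bracket
      ∃ G : PostLie.GradedLieAlgebra K (fun k => PostLie.PLHom 𝒱 k),
        (∀ (k l : ℤ) (f : PostLie.PLHom 𝒱 k) (g : PostLie.PLHom 𝒱 l),
          (G.bracket k l f g).1 = (circ k l f g).1 - (-1 : K) ^ (k * l) • (circ l k g f).1) ∧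
        -- it is transported along `Ψ` from the commutator bracket on coderivations
        ∀ Δ δ : PostLie.Trias 𝒱 →ₗ[K] TensorProduct K (PostLie.Trias 𝒱) (PostLie.Trias 𝒱),
          PostLie.IsCoproductΔ 𝒱 Δ → PostLie.IsCoproductδ 𝒱 δ →
          ∃ C : PostLie.GradedLieAlgebra K (fun k => PostLie.coDer 𝒱 Δ δ k),
            (∀ (k l : ℤ) (D : PostLie.coDer 𝒱 Δ δ k) (E : PostLie.coDer 𝒱 Δ δ l),
              (C.bracket k l D E).1 = D.1 ∘ₗ E.1 - (-1 : K) ^ (k * l) • (E.1 ∘ₗ D.1)) ∧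
            ∃ Ψ : ∀ k : ℤ, PostLie.PLHom 𝒱 k ≃ₗ[K] PostLie.coDer 𝒱 Δ δ k,
              (∀ (k : ℤ) (R : PostLie.PLHom 𝒱 k), PostLie.IsHat 𝒱 k R.1 (Ψ k R).1) ∧
              ∀ (k l : ℤ) (f : PostLie.PLHom 𝒱 k) (g : PostLie.PLHom 𝒱 l),
                Ψ (k + l) (G.bracket k l f g) = C.bracket k l (Ψ k f) (Ψ l g) := by
  have hΔ : ∀ Δ, PostLie.IsCoproductΔ 𝒱 Δ → Δ = PostLie.triasΔ 𝒱 := fun Δ h =>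
    PostLie.trias_ext fun n m x y a b hm hx hy => (h n m x y a b hm hx hy).trans
      (PostLie.isCoproductΔ_triasΔ n m x y a b hm hx hy).symm
  have hδ : ∀ δ, PostLie.IsCoproductδ 𝒱 δ → δ = PostLie.triasδ 𝒱 := fun δ h =>
    PostLie.trias_ext fun n m x y a b hm hx hy => (h n m x y a b hm hx hy).trans
      (PostLie.isCoproductδ_triasδ n m x y a b hm hx hy).symm
  refine ⟨⟨_, PostLie.isCoproductΔ_triasΔ, hΔ⟩, ⟨_, PostLie.isCoproductδ_triasδ, hδ⟩, ?_,
    fun k l f g => ⟨f.1 ∘ₗ PostLie.hat g.1, PostLie.comp_hat_mem f.2 g.2⟩,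
    fun k l f g => PostLie.isCirc_comp_hat f.1 g.2, PostLie.plLie 𝒱,
    fun k l f g => PostLie.plBracket_apply k l f.1 g.1, ?_⟩
  · intro k l f g
    refine ⟨⟨f.1 ∘ₗ PostLie.hat g.1, PostLie.comp_hat_mem f.2 g.2⟩,
      PostLie.isCirc_comp_hat f.1 g.2, fun h hh => Subtype.ext ?_⟩
    exact PostLie.trias_ext fun n m x y a b hm hx hy => (hh n m x y a b hm hx hy).trans
      (PostLie.isCirc_comp_hat f.1 g.2 n m x y a b hm hx hy).symm
  · intro Δ δ h h'
    obtain rfl := hΔ Δ h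
    obtain rfl := hδ δ h'
    exact ⟨PostLie.coDerLie 𝒱 _ _, fun k l D E => rfl, PostLie.hatEquiv 𝒱,
      fun k R => PostLie.isHat_hat R.2,
      fun k l f g => Subtype.ext (PostLie.hat_plBracket f.2 g.2)⟩
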